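/- Let $p\neq 2$ be a prime, $g\ge 1$ an integer, and $J\subseteq\mathbb Z$ a subset with $J=-J$, $J+2g\mathbb Z=J$ and $0\in J$. Let $e_1,\dots,e_g,e_{-g},\dots,e_{-1}$ be the standard basis of $\mathbb Z_p^{2g}$, with the symplectic form $\psi(e_i,e_{-i})=1=-\psi(e_{-i},e_i)$ for $1\le i\le g$ (all other values being $0$). Let $\Lambda^j=\mathbb Z_p^{2g-j}\oplus (p\mathbb Z_p)^{j}$ for $0\le j\le 2g$ and $\Lambda^{j+2g}=p\Lambda^j$ for $j\in\mathbb Z$, so that $\psi$ induces perfect pairings $\Lambda^j\times\Lambda^{-j}\to\mathbb Z_p$. Let $\mathcal G_K$ be the parahoric group scheme over $\mathbb Z_p$ given by the automorphism group of the standard Siegel lattice chain of type $J$: using the bases of the $\Lambda^j$ consisting of the vectors $e_k$ or their multiples by powers of $p$, an $R$-point of $\mathcal G_K$ is a family $f=((f^j)_{j\in J},c)$ with $f^j\in \mathrm{GL}_{2g}(R)$ and $c\in R^\times$ such that $f^i\circ\alpha_{j,i}=\alpha_{j,i}\circ f^j$ for all $i\le j$ in $J$, where $\alpha_{j,i}$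 is the (diagonal) matrix of the inclusion $\Lambda^j\subseteq\Lambda^i$ (a \emph{transition map}), $f^{j-2g}=f^j$, and $\psi(f^jx,f^{-j}y)=c\,\psi(x,y)$. Let $\overline{\mathcal G}_K=\mathcal G_K\otimes_{\mathbb Z_p}\mathbb F_p$. For $j'\ge j''$ in $J$, the transition map $\alpha_{j',j''}$ (over an $\mathbb F_p$-algebra) is called \emph{symmetric} if $j'+j''\in 2g\mathbb Z$ and $ng\ge j'\ge j''>(n-2)g$ for some $n\in\mathbb Z$, and \emph{one-sided} if $ng\ge j'\ge j''\ge (n-1)g$ for some $n\in\mathbb Z$. Let $\mathcal A$ be the group scheme over $\mathbb F_p$ whose $R$-points are the symplectic similitudes $h$ of $R^{2g}$ (with multiplier in $R^\times$) that map the kernel of every symmetric and of every one-sided transition map over $R$ onto itself. Then $\mathcal A$ is a (connected) reductive group over $\mathbb F_p$ and it is the maximal reductive quotient of $\overline{\mathcal G}_K$. More precisely, there are homomorphisms of group schemes $\pi\colon\overline{\mathcal G}_K\to\mathcal A$ and $s\colon\mathcal A\to\overline{\mathcal G}_K$ such that: 1. for all neighbouring elements $j'>j''$ of $J$ (that is,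 no element of $J$ lies strictly between them), $\pi(f)$ acts on $\ker(\alpha_{j',j''})$ as $f^{j'}$; 2. $s(h)$ is the automorphism of the chain with the multiplier of $h$ and with $s(h)^j=h$ for all $j\in J$, and $\pi\circ s=\mathrm{id}_{\mathcal A}$; 3. $\ker(\pi)$ is the unipotent radical $R_u\overline{\mathcal G}_K$, i.e. the largest smooth connected unipotent closed normal subgroup scheme of $\overline{\mathcal G}_K$; 4. $\overline{\mathcal G}_K=\mathcal A\ltimes R_u\overline{\mathcal G}_K$, with $\mathcal A$ embedded by $s$. -/

import Mathlib

open CategoryTheory Matrix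

noncomputable section

namespace SiegelParahoric

/-! ### Group functors and affine algebraic groups -/

/-- Group-valued functors on commutative `k`-algebras. Affine group schemes over `k` are the
corepresentable ones, a homomorphism of group schemes is a natural transformation. -/
abbrev GroupFunctor (k : Type) [CommRing k] := CommAlgCat.{0} k ⥤ GrpCat.{0}

/-- Restriction of scalars of commutative algebras along a ring homomorphism. -/
def resScalars {k l : Type} [CommRing k] [CommRing l] (φ : k →+* l) :
    CommAlgCat.{0} l ⥤ CommAlgCat.{0} k where
  obj R :=
    letI : Algebra k R := ((algebraMap l R).comp φ).toAlgebra
    CommAlgCat.of k R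
  map {R S} f :=
    letI : Algebra k R := ((algebraMap l R).comp φ).toAlgebra
    letI : Algebra k S := ((algebraMap l S).comp φ).toAlgebra
    CommAlgCat.ofHom
      { f.hom.toRingHom with commutes' := fun r => f.hom.commutes (φ r) }

/-- Base change of a group functor along `k → l`: the restriction to `l`-algebras. -/
abbrev baseChange {k l : Type} [CommRing k] [CommRing l] (φ : k →+* l) (G : GroupFunctor k) :
    GroupFunctor l :=
  resScalars φ ⋙ G

section Generalities

variable {k : Type} [CommRing k]

/-- `G` is corepresented by a smooth `k`-algebra with connected spectrum, that is, `G` is a smooth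
connected affine group scheme (of finite presentation). Over a field, connected is the same as
geometrically connected here, because a group scheme has a rational point. -/
def IsSmoothConnected (G : GroupFunctor k) : Prop :=
  ∃ H : CommAlgCat.{0} k, Nonempty ((G ⋙ forget GrpCat).CorepresentableBy H) ∧
    Algebra.Smooth k H ∧ ConnectedSpace (PrimeSpectrum H)

/-- A subgroup functor of a group functor. -/
@[ext]
structure SubgroupFunctor (G : GroupFunctor k) where
  /-- the subgroup of `R`-points -/
  pts : ∀ R : CommAlgCat.{0} k, Subgroup (G.obj R)
  map_mem : ∀ {R S : CommAlgCat.{0} k} (φ : R ⟶ S) (x : G.obj R),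
    x ∈ pts R → (G.map φ).hom x ∈ pts S

/-- A subgroup functor as a group functor. -/
def SubgroupFunctor.toFunctor {G : GroupFunctor k} (U : SubgroupFunctor G) : GroupFunctor k where
  obj R := GrpCat.of (U.pts R)
  map {R S} φ := GrpCat.ofHom
    (((G.map φ).hom.comp (U.pts R).subtype).codRestrict (U.pts S)
      (fun x => U.map_mem φ x.1 x.2))
  map_id R := by
    ext x
    simp
  map_comp φ ψ := by
    ext x
    simp
    rfl

/-- A subgroup functor is closed if its preimage under every `A`-point of `G` is cut out by an
ideal of `A`. -/
def SubgroupFunctor.IsClosed {G : GroupFunctor k} (U : SubgroupFunctor G) : Prop :=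
  ∀ (A : CommAlgCat.{0} k) (y : G.obj A), ∃ I : Ideal A,
    ∀ (R : CommAlgCat.{0} k) (φ : A ⟶ R),
      (G.map φ).hom y ∈ U.pts R ↔ ∀ a ∈ I, φ.hom a = 0

/-- A homomorphism is a closed immersion if it is injective on points and its image is closed. -/
def IsClosedImmersion {F G : GroupFunctor k} (ρ : F ⟶ G) : Prop :=
  (∀ R : CommAlgCat.{0} k, Function.Injective (ρ.app R).hom) ∧
  ∀ (A : CommAlgCat.{0} k) (y : G.obj A), ∃ I : Ideal A,
    ∀ (R : CommAlgCat.{0} k) (φ : A ⟶ R),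
      (G.map φ).hom y ∈ (ρ.app R).hom.range ↔ ∀ a ∈ I, φ.hom a = 0

/-- The kernel of a homomorphism. -/
def kernel {F G : GroupFunctor k} (ρ : F ⟶ G) : SubgroupFunctor F where
  pts R := (ρ.app R).hom.ker
  map_mem {R S} φ x hx := by
    have h := congrArg (fun t => t.hom x) (ρ.naturality φ)
    simp only [GrpCat.hom_comp, MonoidHom.comp_apply] at h
    rw [MonoidHom.mem_ker] at hx ⊢
    rw [h, hx, map_one]

variable (k) in
/-- The general linear group `GL_n`. -/
def generalLinear (n : ℕ) : GroupFunctor k where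
  obj R := GrpCat.of (GL (Fin n) R)
  map φ := GrpCat.ofHom (GeneralLinearGroup.map φ.hom.toRingHom)
  map_id R := by ext; rfl
  map_comp φ ψ := by ext; rfl

/-- `G` is unipotent: it is isomorphic to a closed subgroup of the group of upper triangular
`n × n`-matrices with ones on the diagonal, for some `n`. -/
def IsUnipotent (G : GroupFunctor k) : Prop :=
  ∃ (n : ℕ) (ρ : G ⟶ generalLinear k n), IsClosedImmersion ρ ∧
    ∀ (R : CommAlgCat.{0} k) (x : G.obj R),
      (∀ a b : Fin n, b < a → ((ρ.app R).hom x : GL (Fin n) R).1 a b = 0) ∧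
      ∀ a : Fin n, ((ρ.app R).hom x : GL (Fin n) R).1 a a = 1

/-- `U` is a smooth connected unipotent closed normal subgroup of `G`. -/
structure IsUnipotentNormal {G : GroupFunctor k} (U : SubgroupFunctor G) : Prop where
  closed : U.IsClosed
  normal : ∀ R, (U.pts R).Normal
  smoothConnected : IsSmoothConnected U.toFunctor
  unipotent : IsUnipotent U.toFunctor

/-- `U` is the unipotent radical of `G`: the largest smooth connected unipotent closed normal
subgroup. -/
def IsUnipotentRadical {G : GroupFunctor k} (U : SubgroupFunctor G) : Prop :=
  IsUnipotentNormal U ∧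
    ∀ U' : SubgroupFunctor G, IsUnipotentNormal U' → ∀ R, U'.pts R ≤ U.pts R

end Generalities

/-- `G` is a (connected) reductive group over the field `k`: it is smooth, connected and affine,
and over an algebraic closure of `k` it has no nontrivial smooth connected unipotent closed normal
subgroup. -/
def IsReductive {k : Type} [Field k] (G : GroupFunctor k) : Prop :=
  IsSmoothConnected G ∧
    ∀ U : SubgroupFunctor (baseChange (algebraMap k (AlgebraicClosure k)) G),
      IsUnipotentNormal U → ∀ R, U.pts R = ⊥

/-! ### The standard Siegel lattice chain

The basis `e_1, …, e_g, e_{-g}, …, e_{-1}` is indexed by `0, 1, …, 2g-1`. -/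

/-- The lattice `Λ^j` has the basis `p ^ (chainExp g j k) • e_k`, `k = 0, …, 2g-1`. So
`Λ^j = ℤ_p^(2g-j) ⊕ (p ℤ_p)^j` for `0 ≤ j ≤ 2g` and `Λ^(j+2g) = p Λ^j`
(the division is rounded down). -/
def chainExp (g : ℕ) (j : ℤ) (k : Fin (2 * g)) : ℤ := (j + (k : ℕ)) / (2 * (g : ℤ))

/-- For `i ≤ j`, the matrix of the transition map `α_{j,i}`, the inclusion `Λ^j ⊆ Λ^i`, with
respect to the bases above, over an arbitrary coefficient ring. -/
def transition (p g : ℕ) (R : Type) [CommRing R] (j i : ℤ) :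
    Matrix (Fin (2 * g)) (Fin (2 * g)) R :=
  diagonal fun k => (p : R) ^ (chainExp g j k - chainExp g i k).toNat

/-- The standard symplectic form, with Gram matrix antidiagonal with entries `1` in the upper and
`-1` in the lower half. It pairs `Λ^j` perfectly with `Λ^(-j)` and has the same Gram matrix with
respect to the bases above. -/
def sympl (g : ℕ) (R : Type) [CommRing R] : Matrix (Fin (2 * g)) (Fin (2 * g)) R :=
  of fun a b => if b = a.rev then (if (a : ℕ) < g then 1 else -1) else 0

/-- The automorphisms over `R` of the standard Siegel lattice chain of type `J`: families of
automorphisms `f^j` of `𝒱^j = R^{2g}` and `c` of the line bundle `ℒ = R`, compatible with the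
transition maps `α_{j,i}`, with the periodicity isomorphisms `θ_j : 𝒱^j ≅ 𝒱^{j-2g}` (which are the
identity in the bases above) and with the pairings `ψ_j : 𝒱^j × 𝒱^{-j} → ℒ`. -/
def chainAut (p g : ℕ) (J : Set ℤ) (R : Type) [CommRing R] :
    Subgroup ((J → GL (Fin (2 * g)) R) × Rˣ) where
  carrier := {x |
    (∀ i j : J, (i : ℤ) ≤ j →
      (x.1 i).1 * transition p g R j i = transition p g R j i * (x.1 j).1) ∧
    (∀ i j : J, (j : ℤ) = i + 2 * g → x.1 i = x.1 j) ∧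
    (∀ i j : J, (i : ℤ) = -j →
      (x.1 j).1ᵀ * sympl g R * (x.1 i).1 = (x.2 : R) • sympl g R)}
  one_mem' := by simp
  mul_mem' := by
    rintro x y ⟨hx1, hx2, hx3⟩ ⟨hy1, hy2, hy3⟩
    refine ⟨fun i j h => ?_, fun i j h => ?_, fun i j h => ?_⟩
    · simp only [Prod.fst_mul, Pi.mul_apply, Units.val_mul]
      rw [Matrix.mul_assoc, hy1 i j h, ← Matrix.mul_assoc, hx1 i j h, Matrix.mul_assoc]
    · simp [hx2 i j h, hy2 i j h]
    · simp only [Prod.fst_mul, Pi.mul_apply, Units.val_mul, Matrix.transpose_mul, Prod.snd_mul]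
      calc _ = (y.1 j).1ᵀ * ((x.1 j).1ᵀ * sympl g R * (x.1 i).1) * (y.1 i).1 := by
              simp only [Matrix.mul_assoc]
        _ = _ := by
              rw [hx3 i j h, Matrix.mul_smul, Matrix.smul_mul, hy3 i j h, smul_smul]
  inv_mem' := by
    rintro x ⟨hx1, hx2, hx3⟩
    refine ⟨fun i j h => ?_, fun i j h => ?_, fun i j h => ?_⟩
    · simp only [Prod.fst_inv, Pi.inv_apply]
      calc _ = (x.1 i)⁻¹.1 * (transition p g R j i * (x.1 j).1) * (x.1 j)⁻¹.1 := by
              simp only [Matrix.mul_assoc, Units.mul_inv, Matrix.mul_one]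
        _ = _ := by
              rw [← hx1 i j h]
              simp only [← Matrix.mul_assoc, Units.inv_mul, Matrix.one_mul]
    · simp [hx2 i j h]
    · simp only [Prod.fst_inv, Pi.inv_apply, Prod.snd_inv]
      have e1 : (x.1 j)⁻¹.1ᵀ * (x.1 j).1ᵀ = 1 := by
        rw [← Matrix.transpose_mul, Units.mul_inv, Matrix.transpose_one]
      have e2 : ((x.2 : R) • sympl g R : Matrix _ _ R) = (x.1 j).1ᵀ * sympl g R * (x.1 i).1 :=
        (hx3 i j h).symm
      have e3 : (x.1 j)⁻¹.1ᵀ * ((x.2 : R) • sympl g R) * (x.1 i)⁻¹.1 = sympl g R := by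
        rw [e2]
        calc _ = ((x.1 j)⁻¹.1ᵀ * (x.1 j).1ᵀ) * sympl g R * ((x.1 i).1 * (x.1 i)⁻¹.1) := by
                simp only [Matrix.mul_assoc]
          _ = _ := by rw [e1, Units.mul_inv, Matrix.one_mul, Matrix.mul_one]
      rw [Matrix.mul_smul, Matrix.smul_mul] at e3
      conv_rhs => rw [← e3, smul_smul, Units.inv_mul, one_smul]

lemma transition_map (p g : ℕ) {R S : Type} [CommRing R] [CommRing S] (φ : R →+* S) (j i : ℤ) :
    (transition p g R j i).map φ = transition p g S j i := by
  simp [transition, Matrix.diagonal_map]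

lemma sympl_map (g : ℕ) {R S : Type} [CommRing R] [CommRing S] (φ : R →+* S) :
    (sympl g R).map φ = sympl g S := by
  ext a b
  simp only [sympl, Matrix.map_apply, Matrix.of_apply]
  split_ifs <;> simp

lemma map_smul_sympl (g : ℕ) {R S : Type} [CommRing R] [CommRing S] (φ : R →+* S) (c : R) :
    (c • sympl g R).map φ = φ c • sympl g S := by
  rw [← sympl_map g φ]
  ext a b
  simp

/-- Change of coefficient rings for families of matrices and multipliers. -/
def pairMap (g : ℕ) (J : Set ℤ) {R S : Type} [CommRing R] [CommRing S] (φ : R →+* S) :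
    ((J → GL (Fin (2 * g)) R) × Rˣ) →* ((J → GL (Fin (2 * g)) S) × Sˣ) where
  toFun x := (fun j => GeneralLinearGroup.map φ (x.1 j), Units.map φ x.2)
  map_one' := by ext <;> simp
  map_mul' x y := by ext <;> simp

lemma pairMap_mem (p g : ℕ) (J : Set ℤ) {R S : Type} [CommRing R] [CommRing S] (φ : R →+* S)
    (x : (J → GL (Fin (2 * g)) R) × Rˣ) (hx : x ∈ chainAut p g J R) :
    pairMap g J φ x ∈ chainAut p g J S := by
  obtain ⟨h1, h2, h3⟩ := hx
  refine ⟨fun i j h => ?_, fun i j h => ?_, fun i j h => ?_⟩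
  · have := congrArg (fun M => M.map φ) (h1 i j h)
    simp only [Matrix.map_mul, transition_map] at this
    exact this
  · exact congrArg (GeneralLinearGroup.map φ) (h2 i j h)
  · have := congrArg (fun M => M.map φ) (h3 i j h)
    simp only [Matrix.map_mul, sympl_map, map_smul_sympl] at this
    exact this

/-- The parahoric group scheme `𝒢_K` over `ℤ_p`: the automorphism group of the standard Siegel
lattice chain of type `J`. -/
def parahoric (p g : ℕ) [Fact p.Prime] (J : Set ℤ) : GroupFunctor ℤ_[p] where
  obj R := GrpCat.of (chainAut p g J R)
  map {R S} φ := GrpCat.ofHom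
    (((pairMap g J φ.hom.toRingHom).comp (chainAut p g J R).subtype).codRestrict
      (chainAut p g J S) (fun x => pairMap_mem p g J φ.hom.toRingHom x.1 x.2))
  map_id R := by ext x <;> rfl
  map_comp φ ψ := by ext x <;> rfl

/-- The special fiber `𝒢_K ⊗ 𝔽_p`. -/
abbrev specialFiber (p g : ℕ) [Fact p.Prime] (J : Set ℤ) : GroupFunctor (ZMod p) :=
  baseChange (PadicInt.toZMod (p := p)) (parahoric p g J)

/-! ### Distinguished subspaces and their automorphism group -/

/-- The transition map from `j` to `i` is symmetric. -/
def IsSymmetricTransition (g : ℕ) (J : Set ℤ) (j i : ℤ) : Prop :=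
  j ∈ J ∧ i ∈ J ∧ (∃ n : ℤ, j ≤ n * g ∧ i ≤ j ∧ (n - 2) * g < i) ∧ 2 * (g : ℤ) ∣ j + i

/-- The transition map from `j` to `i` is one-sided. -/
def IsOneSidedTransition (g : ℕ) (J : Set ℤ) (j i : ℤ) : Prop :=
  j ∈ J ∧ i ∈ J ∧ ∃ n : ℤ, j ≤ n * g ∧ i ≤ j ∧ (n - 1) * g ≤ i

/-- The kernel of the transition map from `j` to `i`. -/
def transitionKer (p g : ℕ) (R : Type) [CommRing R] (j i : ℤ) :
    Submodule R (Fin (2 * g) → R) :=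
  LinearMap.ker (transition p g R j i).mulVecLin

/-- The automorphisms of the symplectic space `R^{2g}` (symplectic similitudes `h` with multiplier
`c`) that map the kernels of all symmetric and of all one-sided transition maps onto themselves. -/
def distAut (p g : ℕ) (J : Set ℤ) (R : Type) [CommRing R] :
    Subgroup (GL (Fin (2 * g)) R × Rˣ) where
  carrier := {x |
    x.1.1ᵀ * sympl g R * x.1.1 = (x.2 : R) • sympl g R ∧
    ∀ j i : ℤ, IsSymmetricTransition g J j i ∨ IsOneSidedTransition g J j i →
      ∀ v, x.1.1 *ᵥ v ∈ transitionKer p g R j i ↔ v ∈ transitionKer p g R j i}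
  one_mem' := by simp
  mul_mem' := by
    rintro x y ⟨hx1, hx2⟩ ⟨hy1, hy2⟩
    refine ⟨?_, fun j i h v => ?_⟩
    · simp only [Prod.fst_mul, Units.val_mul, Matrix.transpose_mul, Prod.snd_mul]
      calc _ = y.1.1ᵀ * (x.1.1ᵀ * sympl g R * x.1.1) * y.1.1 := by
              simp only [Matrix.mul_assoc]
        _ = _ := by
              rw [hx1, Matrix.mul_smul, Matrix.smul_mul, hy1, smul_smul]
    · simp only [Prod.fst_mul, Units.val_mul]
      rw [← Matrix.mulVec_mulVec, hx2 j i h, hy2 j i h]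
  inv_mem' := by
    rintro x ⟨hx1, hx2⟩
    refine ⟨?_, fun j i h v => ?_⟩
    · simp only [Prod.fst_inv, Prod.snd_inv]
      have e1 : x.1⁻¹.1ᵀ * x.1.1ᵀ = 1 := by
        rw [← Matrix.transpose_mul, Units.mul_inv, Matrix.transpose_one]
      have e3 : x.1⁻¹.1ᵀ * ((x.2 : R) • sympl g R) * x.1⁻¹.1 = sympl g R := by
        rw [← hx1]
        calc _ = (x.1⁻¹.1ᵀ * x.1.1ᵀ) * sympl g R * (x.1.1 * x.1⁻¹.1) := by
                simp only [Matrix.mul_assoc]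
          _ = _ := by rw [e1, Units.mul_inv, Matrix.one_mul, Matrix.mul_one]
      rw [Matrix.mul_smul, Matrix.smul_mul] at e3
      conv_rhs => rw [← e3, smul_smul, Units.inv_mul, one_smul]
    · rw [← hx2 j i h (((x⁻¹).1).1 *ᵥ v), Matrix.mulVec_mulVec]
      simp only [Prod.fst_inv, Units.mul_inv, Matrix.one_mulVec]

/-- Change of coefficient rings for a matrix and a multiplier. -/
def simMap (g : ℕ) {R S : Type} [CommRing R] [CommRing S] (φ : R →+* S) :
    (GL (Fin (2 * g)) R × Rˣ) →* (GL (Fin (2 * g)) S × Sˣ) :=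
  MonoidHom.prodMap (GeneralLinearGroup.map φ) (Units.map φ)

/-- In characteristic `p`, the transition matrices are idempotent. -/
lemma transition_idem (p g : ℕ) (R : Type) [CommRing R] (hp : (p : R) = 0) (j i : ℤ) :
    transition p g R j i * transition p g R j i = transition p g R j i := by
  rw [transition, Matrix.diagonal_mul_diagonal]
  congr 1
  ext k
  rw [hp]
  rcases Nat.eq_zero_or_pos (chainExp g j k - chainExp g i k).toNat with h | h
  · simp [h]
  · simp [zero_pow h.ne']

lemma stable_iff {n : ℕ} {R : Type} [CommRing R] (D h : Matrix (Fin n) (Fin n) R)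
    (hD : D * D = D) :
    (∀ v, D *ᵥ v = 0 → D *ᵥ (h *ᵥ v) = 0) ↔ D * h * (1 - D) = 0 := by
  constructor
  · intro H
    apply Matrix.ext_of_mulVec_single
    intro b
    rw [← Matrix.mulVec_mulVec, ← Matrix.mulVec_mulVec, Matrix.zero_mulVec]
    apply H
    rw [Matrix.mulVec_mulVec, Matrix.mul_sub, Matrix.mul_one, hD, sub_self, Matrix.zero_mulVec]
  · intro H v hv
    have e : v = (1 - D) *ᵥ v := by rw [Matrix.sub_mulVec, hv, Matrix.one_mulVec, sub_zero]
    rw [e, Matrix.mulVec_mulVec, Matrix.mulVec_mulVec, H, Matrix.zero_mulVec]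

lemma simMap_mem (p g : ℕ) (J : Set ℤ) {R S : Type} [CommRing R] [CommRing S] (φ : R →+* S)
    (hR : (p : R) = 0) (x : GL (Fin (2 * g)) R × Rˣ) (hx : x ∈ distAut p g J R) :
    simMap g φ x ∈ distAut p g J S := by
  have hS : (p : S) = 0 := by rw [← map_natCast φ, hR, map_zero]
  have key : ∀ y ∈ distAut p g J R, ∀ j i : ℤ,
      IsSymmetricTransition g J j i ∨ IsOneSidedTransition g J j i →
      ∀ v, v ∈ transitionKer p g S j i →
        (simMap g φ y).1.1 *ᵥ v ∈ transitionKer p g S j i := by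
    rintro y ⟨-, hy⟩ j i h
    have h1 := (stable_iff (transition p g R j i) y.1.1 (transition_idem p g R hR j i)).1
      (fun v hv => (hy j i h v).2 hv)
    have h2 := congrArg (fun M => M.map φ) h1
    have h3 : (1 - transition p g R j i).map φ = 1 - transition p g S j i := by
      rw [Matrix.map_sub φ (map_sub φ), transition_map, Matrix.map_one φ (map_zero φ) (map_one φ)]
    simp only [Matrix.map_mul, transition_map, h3, Matrix.map_zero φ (map_zero φ)] at h2
    exact (stable_iff (transition p g S j i) (y.1.1.map φ)
      (transition_idem p g S hS j i)).2 h2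
  refine ⟨?_, fun j i h v => ⟨fun hv => ?_, key x hx j i h v⟩⟩
  · have := congrArg (fun M => M.map φ) hx.1
    simp only [Matrix.map_mul, sympl_map, map_smul_sympl] at this
    exact this
  · have := key x⁻¹ (inv_mem hx) j i h _ hv
    rw [Matrix.mulVec_mulVec, map_inv, Prod.fst_inv, Units.inv_mul, Matrix.one_mulVec] at this
    exact this

lemma natCast_eq_zero (p : ℕ) (R : Type) [CommRing R] [Algebra (ZMod p) R] : (p : R) = 0 := by
  rw [← map_natCast (algebraMap (ZMod p) R), ZMod.natCast_self, map_zero]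

/-- The automorphism group scheme `𝒜` over `𝔽_p` of the standard symplectic space together with
all kernels of symmetric and one-sided transition maps. -/
def distinguished (p g : ℕ) (J : Set ℤ) : GroupFunctor (ZMod p) where
  obj R := GrpCat.of (distAut p g J R)
  map {R S} φ := GrpCat.ofHom
    (((simMap g φ.hom.toRingHom).comp (distAut p g J R).subtype).codRestrict
      (distAut p g J S)
      (fun x => simMap_mem p g J φ.hom.toRingHom (natCast_eq_zero p R) x.1 x.2))
  map_id R := by ext x <;> rfl
  map_comp φ ψ := by ext x <;> rfl

/-- The component `f^j` of a point `f` of the special fiber of the parahoric group scheme. -/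
def component {p g : ℕ} [Fact p.Prime] {J : Set ℤ} {R : CommAlgCat.{0} (ZMod p)}
    (f : (specialFiber p g J).obj R) (j : J) : Matrix (Fin (2 * g)) (Fin (2 * g)) R :=
  ((show chainAut p g J R from f).1.1 j).1

/-- The multiplier of a point of the special fiber of the parahoric group scheme. -/
def multiplier {p g : ℕ} [Fact p.Prime] {J : Set ℤ} {R : CommAlgCat.{0} (ZMod p)}
    (f : (specialFiber p g J).obj R) : R :=
  ((show chainAut p g J R from f).1.2 : Rˣ)

/-- The matrix of a point of `𝒜`. -/
def matrixOf {p g : ℕ} {J : Set ℤ} {R : CommAlgCat.{0} (ZMod p)}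
    (h : (distinguished p g J).obj R) : Matrix (Fin (2 * g)) (Fin (2 * g)) R :=
  (show distAut p g J R from h).1.1.1

/-- The multiplier of a point of `𝒜`. -/
def multiplierOf {p g : ℕ} {J : Set ℤ} {R : CommAlgCat.{0} (ZMod p)}
    (h : (distinguished p g J).obj R) : R :=
  ((show distAut p g J R from h).1.2 : Rˣ)

end SiegelParahoric

end

open CategoryTheory Matrix

noncomputable section

namespace SiegelParahoric

/-! Write e_l(k) for `chainExp g l k`. Over ℤ_p, an endomorphism of the chain is a matrix over ℚ_p
whose (a, b) entry has valuation at least e_l(a) - e_l(b) for every l in J, hence at least `level g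
J a b`, which is 0 or 1. Dividing by that power of p and reducing modulo p leaves one free
coordinate m_ab for each pair: it is the entry of f^l at (a, b) when e_l(a) - e_l(b) attains the
level, and that entry is 0 otherwise. `isChain_chainOf` and `IsChain.chainOf_coeff` prove this
description directly over every ring in which p = 0.

Two indices lie in one block if e_l agrees on them for all l. The entries inside blocks do not
depend on l, and the entries outside them become strictly upper triangular after a cyclic rotation
of the basis (`rot_lt_rot`). Hence taking the block diagonal part is multiplicative
(`IsChain.blockFam_mul`); this is π. The kernels of symmetric and one-sided transition maps separate
the blocks (`exists_distinguished_transition`), so 𝒜 consists of the block diagonal similitudes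
(`mem_distAut_iff`), and constant families give the section s.

The kernel of π consists of chains with f* f = 1 and block part 1, where * is the symplectic
adjoint. The Cayley transform (1 - f)(1 + f)⁻¹ carries them to skew adjoint chains with block part
0, which form an affine space (`kernelCorepresentableBy`), so the kernel is smooth and connected.
Placing finitely many rotated f^l in one large block diagonal matrix embeds it as a closed subgroup
of the unitriangular group (`isUnipotent_kernel`).

𝒜 is smooth because an approximate similitude over a square-zero extension is corrected by a
first-order square root (`exists_distAut_lift`). It is connected because an idempotent function is
constant along families over domains, and the points joined to 1 by such families generate 𝒜 over
every field: they contain the big cell lower · Levi · upper, and multiplication by elementary upper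
elements moves every point into it (`eq_top_of_isJoined`).

Finally, over a field, a smooth connected unipotent normal subgroup yields a normal nilpotent group
of p-power exponent in 𝒜. The common fixed space of its centre meets every block and is stable under
root vectors, so it is everything and the group is trivial (`eq_bot_of_normal_of_isNilpotent`).
Smooth algebras are reduced, so points over residue fields decide
(`map_eq_one_of_isUnipotentNormal`). Applied to the identity of 𝒜 over an algebraic closure this
gives reductivity; applied to π it gives maximality of the kernel. The condition p ≠ 2 enters
through the Cayley transform, the lifting and the root vectors 2E_{d', d} for dual indices d, d'. -/

/-- The conditions on the index set of a self-dual periodic lattice chain. -/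
structure IsChainIndex (g : ℕ) (J : Set ℤ) : Prop where
  pos : 1 ≤ g
  neg_mem : ∀ j ∈ J, -j ∈ J
  period : ∀ j : ℤ, j ∈ J ↔ j + 2 * g ∈ J
  zero_mem : (0 : ℤ) ∈ J

/-! ### Exponents of the lattice chain, blocks and the transition maps separating them -/

section Combinatorics

variable {g : ℕ} {J : Set ℤ}

lemma IsChainIndex.add_mul_mem (hJ : IsChainIndex g J) {l : ℤ} (hl : l ∈ J) (t : ℤ) :
    l + t * (2 * g) ∈ J := by
  induction t using Int.induction_on with
  | zero => simpa
  | succ n ih =>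
    rw [hJ.period] at ih
    convert ih using 1
    ring
  | pred n ih =>
    rw [hJ.period]
    convert ih using 1
    ring

lemma chainExp_add_mul (hg : 1 ≤ g) (l t : ℤ) (k : Fin (2 * g)) :
    chainExp g (l + t * (2 * g)) k = chainExp g l k + t := by
  rw [chainExp, chainExp, show l + t * (2 * (g : ℤ)) + (k : ℕ) = l + (k : ℕ) + t * (2 * g) by ring,
    Int.add_mul_ediv_right _ _ (by omega)]

lemma chainExp_zero (k : Fin (2 * g)) : chainExp g 0 k = 0 := by
  rw [chainExp, zero_add]
  exact Int.ediv_eq_zero_of_lt (by omega) (by omega)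

lemma chainExp_mono_left (hg : 1 ≤ g) {i j : ℤ} (h : i ≤ j) (k : Fin (2 * g)) :
    chainExp g i k ≤ chainExp g j k :=
  Int.ediv_le_ediv (by omega) (by omega)

lemma chainExp_mono_right (hg : 1 ≤ g) (l : ℤ) {a b : Fin (2 * g)} (h : a ≤ b) :
    chainExp g l a ≤ chainExp g l b :=
  Int.ediv_le_ediv (by omega) (by have : (a : ℕ) ≤ b := h; omega)

lemma chainExp_le_add_one (hg : 1 ≤ g) (l : ℤ) (a b : Fin (2 * g)) :
    chainExp g l a ≤ chainExp g l b + 1 := by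
  rw [chainExp, chainExp, ← Int.add_mul_ediv_right _ 1 (by omega)]
  exact Int.ediv_le_ediv (by omega) (by omega)

/-- This is the duality between Λ^l and Λ^(-l). If l + k has remainder r modulo 2g, then -l + (2g -
1 - k) has remainder 2g - 1 - r, again in the range [0, 2g), so the quotient just changes sign. -/
lemma chainExp_neg_rev (hg : 1 ≤ g) (l : ℤ) (k : Fin (2 * g)) :
    chainExp g (-l) k.rev = - chainExp g l k := by
  have h2 : (0 : ℤ) < 2 * g := by omega
  have e1 : ((k.rev : Fin (2 * g)) : ℕ) = (2 * g - 1 - k : ℤ) := by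
    rw [Fin.val_rev]; omega
  rw [chainExp, chainExp, e1]
  have h3 := Int.emod_add_mul_ediv (l + (k : ℕ)) (2 * g)
  have h4 := Int.emod_nonneg (l + (k : ℕ)) h2.ne'
  have h5 := Int.emod_lt_of_pos (l + (k : ℕ)) h2
  generalize (l + (k : ℕ)) % (2 * g) = r at *
  generalize (l + (k : ℕ)) / (2 * g) = q at *
  rw [show -l + (2 * (g : ℤ) - 1 - (k : ℕ)) = (2 * g - 1 - r) + (-q) * (2 * g) by linarith,
    Int.add_mul_ediv_right _ _ h2.ne', Int.ediv_eq_zero_of_lt (by omega) (by omega), zero_add]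

/-- Two basis vectors belong to the same block if no member of the chain separates them. -/
def SameBlock (g : ℕ) (J : Set ℤ) (a b : Fin (2 * g)) : Prop :=
  ∀ l ∈ J, chainExp g l a = chainExp g l b

lemma SameBlock.refl (a : Fin (2 * g)) : SameBlock g J a a := fun _ _ => rfl

lemma SameBlock.symm {a b : Fin (2 * g)} (h : SameBlock g J a b) : SameBlock g J b a :=
  fun l hl => (h l hl).symm

lemma SameBlock.trans {a b c : Fin (2 * g)} (h : SameBlock g J a b) (h' : SameBlock g J b c) :
    SameBlock g J a c :=
  fun l hl => (h l hl).trans (h' l hl)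

lemma SameBlock.rev (hJ : IsChainIndex g J) {a b : Fin (2 * g)} (h : SameBlock g J a b) :
    SameBlock g J a.rev b.rev := fun l hl => by
  have := h (-l) (hJ.neg_mem l hl)
  have h1 := chainExp_neg_rev hJ.pos (-l) a
  have h2 := chainExp_neg_rev hJ.pos (-l) b
  rw [neg_neg] at h1 h2
  rw [h1, h2, this]

lemma sameBlock_rev_iff (hJ : IsChainIndex g J) {a b : Fin (2 * g)} :
    SameBlock g J a.rev b.rev ↔ SameBlock g J a b :=
  ⟨fun h => by simpa using h.rev hJ, fun h => h.rev hJ⟩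

open Classical in
/-- The largest value of `chainExp g l a - chainExp g l b` for `l` in the index set. -/
def level (g : ℕ) (J : Set ℤ) (a b : Fin (2 * g)) : ℤ :=
  if SameBlock g J a b ∨ a ≤ b then 0 else 1

/-- The symplectic adjoint moves the entry (b.rev, a.rev) to (a, b); this symmetry is what makes the
parametrization of chains by their coefficients compatible with adjoints. -/
lemma level_neg_rev (hJ : IsChainIndex g J) (a b : Fin (2 * g)) :
    level g J b.rev a.rev = level g J a b := by
  rw [level, level]
  have h1 : SameBlock g J b.rev a.rev ↔ SameBlock g J a b :=
    (sameBlock_rev_iff hJ).trans ⟨SameBlock.symm, SameBlock.symm⟩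
  have h2 : b.rev ≤ a.rev ↔ a ≤ b := Fin.rev_le_rev
  by_cases h : SameBlock g J a b ∨ a ≤ b
  · rw [if_pos ((or_congr h1 h2).2 h), if_pos h]
  · rw [if_neg (mt (or_congr h1 h2).1 h), if_neg h]

lemma sub_le_level (hJ : IsChainIndex g J) {l : ℤ} (hl : l ∈ J) (a b : Fin (2 * g)) :
    chainExp g l a - chainExp g l b ≤ level g J a b := by
  rw [level]
  split_ifs with h
  · rcases h with h | h
    · rw [h l hl, sub_self]
    · have := chainExp_mono_right hJ.pos l h
      omega
  · have := chainExp_le_add_one hJ.pos l a b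
    omega

lemma exists_level (hJ : IsChainIndex g J) (a b : Fin (2 * g)) :
    ∃ l ∈ J, chainExp g l a - chainExp g l b = level g J a b := by
  rw [level]
  split_ifs with h
  · exact ⟨0, hJ.zero_mem, by simp [chainExp_zero]⟩
  · push Not at h
    obtain ⟨h1, h2⟩ := h
    rw [SameBlock] at h1
    push Not at h1
    obtain ⟨l, hl, h3⟩ := h1
    refine ⟨l, hl, ?_⟩
    have := chainExp_le_add_one hJ.pos l a b
    have := chainExp_mono_right hJ.pos l h2.le
    omega

/-- Any two members of the index set become comparable within one period. -/
lemma exists_shift (hJ : IsChainIndex g J) (l l' : ℤ) :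
    ∃ t : ℤ, l ≤ l' + t * (2 * g) ∧ l' + t * (2 * g) < l + 2 * g := by
  have hg := hJ.pos
  have h2 : (0 : ℤ) < 2 * g := by omega
  refine ⟨-((l' - l) / (2 * g)), ?_⟩
  have h3 := Int.emod_add_mul_ediv (l' - l) (2 * g)
  have h4 := Int.emod_nonneg (l' - l) h2.ne'
  have h5 := Int.emod_lt_of_pos (l' - l) h2
  constructor <;> nlinarith

/-- Between neighbours, the basis vectors that disappear form a block. -/
lemma sameBlock_of_neighbours (hJ : IsChainIndex g J) {i j : ℤ}
    (hn : ∀ l ∈ J, l ≤ i ∨ j ≤ l) {a b : Fin (2 * g)}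
    (ha : chainExp g i a < chainExp g j a) (hb : chainExp g i b < chainExp g j b) :
    SameBlock g J a b := by
  have hg := hJ.pos
  -- Shift l by periods into the interval (i, i + 2g]. As i and j are neighbours the shifted index
  -- is at least j, so its exponents at a and b are squeezed between those at j, which exceed those
  -- at i, and those at i + 2g, which are one more than those at i.
  have key : ∀ l ∈ J, ∃ t : ℤ, chainExp g l a = chainExp g i a + t ∧
      chainExp g l b = chainExp g i b + t := by
    intro l hl
    obtain ⟨t, h1, h2⟩ := exists_shift hJ (i + 1) l
    have h3 : j ≤ l + t * (2 * g) := by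
      rcases hn _ (hJ.add_mul_mem hl t) with h | h <;> omega
    refine ⟨1 - t, ?_⟩
    have h4 : l + t * (2 * g) ≤ i + 1 * (2 * g) := by omega
    have a1 := chainExp_mono_left hg h3 a
    have a2 := chainExp_mono_left hg h4 a
    have b1 := chainExp_mono_left hg h3 b
    have b2 := chainExp_mono_left hg h4 b
    rw [chainExp_add_mul hg] at a1 a2 b1 b2
    rw [chainExp_add_mul hg] at a2 b2
    omega
  -- At l = 0 all exponents vanish, which forces the exponents at i of a and b to agree.
  obtain ⟨t, h1, h2⟩ := key 0 hJ.zero_mem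
  rw [chainExp_zero] at h1 h2
  intro l hl
  obtain ⟨t', h3, h4⟩ := key l hl
  omega

/-- Distinct blocks are separated by the kernel of a symmetric or one-sided transition map. -/
lemma exists_distinguished_transition (hJ : IsChainIndex g J) {a b : Fin (2 * g)}
    (hab : ¬ SameBlock g J a b) :
    ∃ j i : ℤ, (IsSymmetricTransition g J j i ∨ IsOneSidedTransition g J j i) ∧
      chainExp g i a = chainExp g j a ∧ chainExp g i b < chainExp g j b := by
  have hg := hJ.pos
  have h2 : (0 : ℤ) < 2 * g := by omega
  -- Periodicity and the reflection m ↦ 2g - m bring a separating index into (0, g], at the cost of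
  -- allowing either l or 2g - l to separate.
  have sep : ∃ l ∈ J, 0 < l ∧ l ≤ g ∧
      (chainExp g l a ≠ chainExp g l b ∨ chainExp g (2 * g - l) a ≠ chainExp g (2 * g - l) b) := by
    rw [SameBlock] at hab
    push Not at hab
    obtain ⟨l, hl, h⟩ := hab
    obtain ⟨t, h3, h4⟩ := exists_shift hJ 0 l
    have h5 := hJ.add_mul_mem hl t
    have h6 : chainExp g (l + t * (2 * g)) a ≠ chainExp g (l + t * (2 * g)) b := by
      rw [chainExp_add_mul hg, chainExp_add_mul hg]
      omega
    generalize l + t * (2 * g) = m at *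
    rcases h3.eq_or_lt with rfl | h3
    · simp [chainExp_zero] at h6
    rcases le_or_gt m g with h7 | h7
    · exact ⟨m, h5, h3, h7, Or.inl h6⟩
    · refine ⟨2 * g - m, ?_, by omega, by omega, Or.inr ?_⟩
      · have := (hJ.period _).1 (hJ.neg_mem m h5)
        rwa [neg_add_eq_sub] at this
      · rwa [sub_sub_cancel]
  obtain ⟨l, hl, l0, lg, h⟩ := sep
  have hl' : 2 * (g : ℤ) - l ∈ J := by
    have := (hJ.period _).1 (hJ.neg_mem l hl)
    rwa [neg_add_eq_sub] at this
  have h2g : 2 * (g : ℤ) ∈ J := by simpa using (hJ.period 0).1 hJ.zero_mem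
  have val : ∀ m : ℤ, 0 ≤ m → m ≤ 2 * g → ∀ k : Fin (2 * g),
      (chainExp g m k = 0 ∧ m + (k : ℕ) < 2 * g) ∨ (chainExp g m k = 1 ∧ 2 * g ≤ m + (k : ℕ)) := by
    intro m m0 m1 k
    rcases lt_or_ge (m + (k : ℕ)) (2 * g) with h | h
    · exact Or.inl ⟨Int.ediv_eq_zero_of_lt (by omega) h, h⟩
    · refine Or.inr ⟨?_, h⟩
      rw [chainExp, show m + ((k : ℕ) : ℤ) = (m + (k : ℕ) - 2 * g) + 1 * (2 * g) by ring,
        Int.add_mul_ediv_right _ _ h2.ne', Int.ediv_eq_zero_of_lt (by omega) (by omega)]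
      rfl
  have a1 := val l l0.le (by omega) a
  have b1 := val l l0.le (by omega) b
  have a2 := val (2 * g - l) (by omega) (by omega) a
  have b2 := val (2 * g - l) (by omega) (by omega) b
  have a3 := val (2 * g) (by omega) le_rfl a
  have b3 := val (2 * g) (by omega) le_rfl b
  have a0 := chainExp_zero a
  have b0 := chainExp_zero b
  -- From 0 to 2g each exponent rises from 0 to 1, in exactly one of the intervals [0, l], [l, 2g -
  -- l], [2g - l, 2g]. The outer two give one-sided maps, the middle one a symmetric map. Take the
  -- interval where b rises; by `h`, a rises in another one.
  by_cases c1 : chainExp g l b = 1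
  · refine ⟨l, 0, Or.inr ⟨hl, hJ.zero_mem, 1, by omega, by omega, by omega⟩, ?_, ?_⟩ <;> omega
  by_cases c2 : chainExp g (2 * g - l) b = 1
  · have hlt : l < g := by
      by_contra hc
      obtain rfl : l = g := by omega
      have : 2 * (g : ℤ) - g = g := by ring
      rw [this] at c2
      exact c1 c2
    refine ⟨2 * g - l, l, Or.inl ⟨hl', hl, ⟨2, by omega, by omega, by omega⟩, ?_⟩, ?_, ?_⟩
    · simp
    · omega
    · omega
  · refine ⟨2 * g, 2 * g - l, Or.inr ⟨h2g, hl', 2, by omega, by omega, by omega⟩, ?_, ?_⟩ <;> omega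

end Combinatorics

/-! ### The symplectic adjoint as an anti-involution of the matrix ring -/

section Adjoint

variable {g : ℕ} {R : Type} [CommRing R]

/-- The signs of the antidiagonal entries of the Gram matrix of the symplectic form. -/
def sgn (R : Type) [CommRing R] {g : ℕ} (a : Fin (2 * g)) : R := if (a : ℕ) < g then 1 else -1

lemma sgn_mul_self (a : Fin (2 * g)) : sgn R a * sgn R a = 1 := by
  rw [sgn]; split_ifs <;> simp

lemma sgn_rev (a : Fin (2 * g)) : sgn R a.rev = - sgn R a := by
  rw [sgn, sgn, Fin.val_rev]
  split_ifs <;> first | omega | simp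

lemma map_sgn {S : Type} [CommRing S] (φ : R →+* S) (a : Fin (2 * g)) :
    φ (sgn R a) = sgn S a := by
  rw [sgn, sgn]; split_ifs <;> simp

/-- The adjoint of a matrix with respect to the symplectic form. -/
def adj (x : Matrix (Fin (2 * g)) (Fin (2 * g)) R) : Matrix (Fin (2 * g)) (Fin (2 * g)) R :=
  of fun a b => sgn R a * sgn R b * x b.rev a.rev

lemma adj_apply (x : Matrix (Fin (2 * g)) (Fin (2 * g)) R) (a b : Fin (2 * g)) :
    adj x a b = sgn R a * sgn R b * x b.rev a.rev := rfl

lemma adj_adj (x : Matrix (Fin (2 * g)) (Fin (2 * g)) R) : adj (adj x) = x := by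
  ext a b
  rw [adj_apply, adj_apply, sgn_rev, sgn_rev, Fin.rev_rev, Fin.rev_rev]
  linear_combination (x a b) * (sgn R b * sgn R b * sgn_mul_self (R := R) a +
    sgn_mul_self (R := R) b)

lemma adj_one : adj (1 : Matrix (Fin (2 * g)) (Fin (2 * g)) R) = 1 := by
  ext a b
  rw [adj_apply]
  by_cases h : a = b
  · subst h; simp [sgn_mul_self]
  · rw [one_apply_ne h, one_apply_ne (fun h' => h (Fin.rev_injective h').symm), mul_zero]

lemma adj_add (x y : Matrix (Fin (2 * g)) (Fin (2 * g)) R) : adj (x + y) = adj x + adj y := by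
  ext a b; simp only [adj_apply, Matrix.add_apply]; ring

lemma adj_sub (x y : Matrix (Fin (2 * g)) (Fin (2 * g)) R) : adj (x - y) = adj x - adj y := by
  ext a b; simp only [adj_apply, Matrix.sub_apply]; ring

lemma adj_smul (c : R) (x : Matrix (Fin (2 * g)) (Fin (2 * g)) R) :
    adj (c • x) = c • adj x := by
  ext a b; simp only [adj_apply, Matrix.smul_apply, smul_eq_mul]; ring

lemma adj_mul (x y : Matrix (Fin (2 * g)) (Fin (2 * g)) R) : adj (x * y) = adj y * adj x := by
  ext a b
  rw [adj_apply, mul_apply, mul_apply, Finset.mul_sum, ← Equiv.sum_comp Fin.revPerm]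
  refine Finset.sum_congr rfl fun c _ => ?_
  rw [Fin.revPerm_apply, adj_apply, adj_apply]
  linear_combination (- sgn R a * sgn R b * x b.rev c.rev * y c.rev a.rev) *
    sgn_mul_self (R := R) c

lemma adj_map {S : Type} [CommRing S] (φ : R →+* S)
    (x : Matrix (Fin (2 * g)) (Fin (2 * g)) R) : adj (x.map φ) = (adj x).map φ := by
  ext a b
  simp [adj_apply, map_sgn]

lemma sympl_apply (a b : Fin (2 * g)) : sympl g R a b = if b = a.rev then sgn R a else 0 := rfl

lemma sympl_mul_apply (x : Matrix (Fin (2 * g)) (Fin (2 * g)) R) (a b : Fin (2 * g)) :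
    (sympl g R * x) a b = sgn R a * x a.rev b := by
  simp [mul_apply, sympl_apply]

/-- Moving the transpose across the Gram matrix turns similitude conditions into equations in the
ring with involution `adj`, from which the Gram matrix can be cancelled. -/
lemma transpose_mul_sympl (x : Matrix (Fin (2 * g)) (Fin (2 * g)) R) :
    xᵀ * sympl g R = sympl g R * adj x := by
  ext a b
  rw [sympl_mul_apply, adj_apply, mul_apply, Finset.sum_eq_single b.rev]
  · rw [sympl_apply, if_pos (Fin.rev_rev b).symm, transpose_apply, sgn_rev, sgn_rev, Fin.rev_rev]
    linear_combination (sgn R b * x b.rev a) * sgn_mul_self (R := R) a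
  · intro c _ hc
    rw [sympl_apply, if_neg, mul_zero]
    rintro rfl
    exact hc (Fin.rev_rev c).symm
  · simp

lemma sympl_mul_sympl : sympl g R * sympl g R = -1 := by
  ext a b
  rw [sympl_mul_apply, sympl_apply, sgn_rev, Fin.rev_rev, neg_apply]
  by_cases h : b = a
  · subst h; simp [sgn_mul_self]
  · rw [if_neg h, one_apply_ne (Ne.symm h)]; simp

/-- A pair of matrices is adjoint up to `c` for the symplectic form if and only if the adjoint of
the first one is `c` times the inverse of the second one. -/
lemma similitude_iff (x y : Matrix (Fin (2 * g)) (Fin (2 * g)) R) (c : R) :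
    xᵀ * sympl g R * y = c • sympl g R ↔ adj x * y = c • (1 : Matrix _ _ R) := by
  rw [transpose_mul_sympl, Matrix.mul_assoc]
  constructor
  · intro h
    have h1 := congrArg (fun M => -(sympl g R * M)) h
    simpa [← Matrix.mul_assoc, sympl_mul_sympl] using h1
  · intro h
    rw [h]; simp

end Adjoint

/-! ### Block diagonal matrices and the points of 𝒜 -/

section BlockDiagonal

variable {g : ℕ} {J : Set ℤ} {R : Type} [CommRing R]

/-- The matrix is block diagonal for the blocks of the lattice chain. -/
def IsBlockDiag (J : Set ℤ) (x : Matrix (Fin (2 * g)) (Fin (2 * g)) R) : Prop :=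
  ∀ a b, ¬ SameBlock g J a b → x a b = 0

lemma IsBlockDiag.one : IsBlockDiag J (1 : Matrix (Fin (2 * g)) (Fin (2 * g)) R) :=
  fun a b h => one_apply_ne (by rintro rfl; exact h (.refl a))

lemma IsBlockDiag.mul {x y : Matrix (Fin (2 * g)) (Fin (2 * g)) R} (hx : IsBlockDiag J x)
    (hy : IsBlockDiag J y) : IsBlockDiag J (x * y) := fun a b h => by
  rw [mul_apply]
  refine Finset.sum_eq_zero fun c _ => ?_
  by_cases hc : SameBlock g J a c
  · rw [hy c b fun h' => h (hc.trans h'), mul_zero]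
  · rw [hx a c hc, zero_mul]

lemma IsBlockDiag.add {x y : Matrix (Fin (2 * g)) (Fin (2 * g)) R} (hx : IsBlockDiag J x)
    (hy : IsBlockDiag J y) : IsBlockDiag J (x + y) := fun a b h => by
  rw [Matrix.add_apply, hx a b h, hy a b h, add_zero]

lemma IsBlockDiag.sub {x y : Matrix (Fin (2 * g)) (Fin (2 * g)) R} (hx : IsBlockDiag J x)
    (hy : IsBlockDiag J y) : IsBlockDiag J (x - y) := fun a b h => by
  rw [Matrix.sub_apply, hx a b h, hy a b h, sub_zero]

lemma IsBlockDiag.smul {x : Matrix (Fin (2 * g)) (Fin (2 * g)) R} (hx : IsBlockDiag J x)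
    (c : R) : IsBlockDiag J (c • x) := fun a b h => by
  rw [Matrix.smul_apply, hx a b h, smul_zero]

lemma IsBlockDiag.adj (hJ : IsChainIndex g J) {x : Matrix (Fin (2 * g)) (Fin (2 * g)) R}
    (hx : IsBlockDiag J x) : IsBlockDiag J (adj x) := fun a b h => by
  rw [adj_apply, hx _ _ fun h' => h ((sameBlock_rev_iff hJ).1 h').symm, mul_zero]

lemma IsBlockDiag.map {S : Type} [CommRing S] (φ : R →+* S)
    {x : Matrix (Fin (2 * g)) (Fin (2 * g)) R}
    (hx : IsBlockDiag J x) : IsBlockDiag J (x.map φ) := fun a b h => by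
  rw [map_apply, hx a b h, map_zero]

/-- In characteristic `p` the transition maps are projectors. -/
lemma transition_eq {p : ℕ} (hR : (p : R) = 0) (j i : ℤ) :
    transition p g R j i =
      diagonal fun k => if chainExp g j k ≤ chainExp g i k then 1 else 0 := by
  rw [transition]
  congr 1
  ext k
  split_ifs with h
  · rw [Int.toNat_of_nonpos (by omega), pow_zero]
  · rw [hR, zero_pow (by omega)]

lemma mem_transitionKer_iff {p : ℕ} (hR : (p : R) = 0) (j i : ℤ) (v : Fin (2 * g) → R) :
    v ∈ transitionKer p g R j i ↔ ∀ k, chainExp g j k ≤ chainExp g i k → v k = 0 := by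
  rw [transitionKer, LinearMap.mem_ker, mulVecLin_apply, transition_eq hR, funext_iff]
  refine forall_congr' fun k => ?_
  rw [mulVec_diagonal]
  by_cases h : chainExp g j k ≤ chainExp g i k <;> simp [h]

lemma IsBlockDiag.mulVec_mem_transitionKer {p : ℕ} (hR : (p : R) = 0) {j i : ℤ} (hj : j ∈ J)
    (hi : i ∈ J) {x : Matrix (Fin (2 * g)) (Fin (2 * g)) R} (hx : IsBlockDiag J x)
    {v : Fin (2 * g) → R} (hv : v ∈ transitionKer p g R j i) :
    x *ᵥ v ∈ transitionKer p g R j i := by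
  rw [mem_transitionKer_iff hR] at hv ⊢
  intro a ha
  rw [mulVec_apply]
  refine Finset.sum_eq_zero fun b _ => ?_
  by_cases h : SameBlock g J a b
  · rw [hv b (by rw [← h i hi, ← h j hj]; exact ha), mul_zero]
  · rw [row_apply, hx a b h, zero_mul]

/-- The points of `𝒜` are the block diagonal symplectic similitudes. -/
lemma mem_distAut_iff {p : ℕ} (hJ : IsChainIndex g J) (hR : (p : R) = 0)
    (x : GL (Fin (2 * g)) R × Rˣ) :
    x ∈ distAut p g J R ↔
      adj x.1.1 * x.1.1 = (x.2 : R) • (1 : Matrix _ _ R) ∧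
        IsBlockDiag J x.1.1 := by
  rw [← similitude_iff]
  refine and_congr_right fun hsim => ?_
  constructor
  · intro h a b hab
    obtain ⟨j, i, h1, h2, h3⟩ := exists_distinguished_transition hJ hab
    -- The separating transition map kills the basis vector b but not the coordinate a, so stability
    -- of its kernel forces the (a, b) entry to vanish.
    have h4 : (Pi.single b 1 : Fin (2 * g) → R) ∈ transitionKer p g R j i := by
      rw [mem_transitionKer_iff hR]
      intro k hk
      rw [Pi.single_eq_of_ne]
      rintro rfl
      omega
    have h5 := (h j i h1 _).2 h4
    rw [mem_transitionKer_iff hR] at h5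
    simpa using h5 a h2.ge
  · intro hx j i h v
    have hij : j ∈ J ∧ i ∈ J := by
      rcases h with h | h
      · exact ⟨h.1, h.2.1⟩
      · exact ⟨h.1, h.2.1⟩
    refine ⟨fun hv => ?_, hx.mulVec_mem_transitionKer hR hij.1 hij.2⟩
    -- For the other direction of the equivalence use the inverse of x, the adjoint divided by the
    -- multiplier, which is block diagonal too.
    have h1 := ((hx.adj hJ).smul (↑(x.2⁻¹) : R)).mulVec_mem_transitionKer hR hij.1 hij.2 hv
    rw [mulVec_mulVec, Matrix.smul_mul, (similitude_iff _ _ _).1 hsim, smul_smul, Units.inv_mul,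
      one_smul, one_mulVec] at h1
    exact h1

/-- A block diagonal symplectic similitude as a point of `𝒜`. -/
def mkDistAut {p : ℕ} (hJ : IsChainIndex g J) (hR : (p : R) = 0)
    (x : Matrix (Fin (2 * g)) (Fin (2 * g)) R) (c : Rˣ)
    (hx : adj x * x = (c : R) • (1 : Matrix _ _ R)) (hd : IsBlockDiag J x) :
    distAut p g J R :=
  have h : ((↑c⁻¹ : R) • adj x) * x = 1 := by
    rw [Matrix.smul_mul, hx, smul_smul, Units.inv_mul, one_smul]
  ⟨(⟨x, (↑c⁻¹ : R) • adj x, mul_eq_one_comm.1 h, h⟩, c),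
    (mem_distAut_iff hJ hR _).2 ⟨hx, hd⟩⟩

/-- The multiplier of a symplectic similitude is determined by the similitude. -/
lemma multiplier_unique (hg : 1 ≤ g) {x : Matrix (Fin (2 * g)) (Fin (2 * g)) R} {c d : R}
    (hc : adj x * x = c • (1 : Matrix _ _ R))
    (hd : adj x * x = d • (1 : Matrix _ _ R)) : c = d := by
  have h := congrFun (congrFun (hc.symm.trans hd) ⟨0, by omega⟩) ⟨0, by omega⟩
  simpa using h

end BlockDiagonal

/-! ### Chains of endomorphisms in characteristic p, their coefficients, and π and s on points -/

section Chains

variable {p g : ℕ} {J : Set ℤ} {R : Type} [CommRing R]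

/-- A family of endomorphisms of the members of the standard lattice chain that is compatible with
the transition and periodicity maps. -/
structure IsChain (p : ℕ) (f : J → Matrix (Fin (2 * g)) (Fin (2 * g)) R) : Prop where
  comm : ∀ i j : J, (i : ℤ) ≤ j → f i * transition p g R j i = transition p g R j i * f j
  period : ∀ i j : J, (j : ℤ) = i + 2 * g → f i = f j

/-- The negative of a member of the index set. -/
def IsChainIndex.neg (hJ : IsChainIndex g J) (l : J) : J := ⟨-l, hJ.neg_mem l l.2⟩

/-- The element `0` of the index set. -/
def IsChainIndex.zero (hJ : IsChainIndex g J) : J := ⟨0, hJ.zero_mem⟩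

/-- The adjoint of a family of endomorphisms. -/
def adjFam (hJ : IsChainIndex g J) (f : J → Matrix (Fin (2 * g)) (Fin (2 * g)) R) :
    J → Matrix (Fin (2 * g)) (Fin (2 * g)) R :=
  fun l => adj (f (hJ.neg l))

lemma adjFam_mul (hJ : IsChainIndex g J) (f f' : J → Matrix (Fin (2 * g)) (Fin (2 * g)) R) :
    adjFam hJ (f * f') = adjFam hJ f' * adjFam hJ f :=
  funext fun _ => adj_mul _ _

lemma adjFam_add (hJ : IsChainIndex g J) (f f' : J → Matrix (Fin (2 * g)) (Fin (2 * g)) R) :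
    adjFam hJ (f + f') = adjFam hJ f + adjFam hJ f' :=
  funext fun _ => adj_add _ _

lemma adjFam_sub (hJ : IsChainIndex g J) (f f' : J → Matrix (Fin (2 * g)) (Fin (2 * g)) R) :
    adjFam hJ (f - f') = adjFam hJ f - adjFam hJ f' :=
  funext fun _ => adj_sub _ _

lemma adjFam_one (hJ : IsChainIndex g J) :
    adjFam hJ (1 : J → Matrix (Fin (2 * g)) (Fin (2 * g)) R) = 1 :=
  funext fun _ => adj_one

lemma IsChain.one : IsChain p (1 : J → Matrix (Fin (2 * g)) (Fin (2 * g)) R) :=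
  ⟨fun i j _ => by simp, fun i j _ => rfl⟩

lemma IsChain.mul {f f' : J → Matrix (Fin (2 * g)) (Fin (2 * g)) R} (hf : IsChain p f)
    (hf' : IsChain p f') : IsChain p (f * f') := by
  refine ⟨fun i j h => ?_, fun i j h => ?_⟩
  · rw [Pi.mul_apply, Pi.mul_apply, Matrix.mul_assoc, hf'.comm i j h, ← Matrix.mul_assoc,
      hf.comm i j h, Matrix.mul_assoc]
  · rw [Pi.mul_apply, Pi.mul_apply, hf.period i j h, hf'.period i j h]

lemma IsChain.add {f f' : J → Matrix (Fin (2 * g)) (Fin (2 * g)) R} (hf : IsChain p f)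
    (hf' : IsChain p f') : IsChain p (f + f') := by
  refine ⟨fun i j h => ?_, fun i j h => ?_⟩
  · rw [Pi.add_apply, Pi.add_apply, Matrix.add_mul, hf.comm i j h, hf'.comm i j h, Matrix.mul_add]
  · rw [Pi.add_apply, Pi.add_apply, hf.period i j h, hf'.period i j h]

lemma IsChain.sub {f f' : J → Matrix (Fin (2 * g)) (Fin (2 * g)) R} (hf : IsChain p f)
    (hf' : IsChain p f') : IsChain p (f - f') := by
  refine ⟨fun i j h => ?_, fun i j h => ?_⟩
  · rw [Pi.sub_apply, Pi.sub_apply, Matrix.sub_mul, hf.comm i j h, hf'.comm i j h, Matrix.mul_sub]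
  · rw [Pi.sub_apply, Pi.sub_apply, hf.period i j h, hf'.period i j h]

lemma IsChain.of_mul_eq_one {f f' : J → Matrix (Fin (2 * g)) (Fin (2 * g)) R} (hf : IsChain p f)
    (h : f * f' = 1) : IsChain p f' := by
  have h1 : ∀ l, f l * f' l = 1 := fun l => congrFun h l
  have h2 : ∀ l, f' l * f l = 1 := fun l => mul_eq_one_comm.1 (h1 l)
  refine ⟨fun i j hij => ?_, fun i j hij => ?_⟩
  · calc f' i * transition p g R j i = f' i * (transition p g R j i * f j) * f' j := by
          rw [Matrix.mul_assoc, Matrix.mul_assoc, h1, Matrix.mul_one]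
      _ = transition p g R j i * f' j := by
          rw [← hf.comm i j hij, ← Matrix.mul_assoc, h2, Matrix.one_mul]
  · calc f' i = f' i * (f j * f' j) := by rw [h1, Matrix.mul_one]
      _ = f' j := by rw [← hf.period i j hij, ← Matrix.mul_assoc, h2, Matrix.one_mul]

lemma adj_transition (hg : 1 ≤ g) (i j : ℤ) :
    adj (transition p g R (-i) (-j)) = transition p g R j i := by
  ext a b
  rw [adj_apply, transition, transition]
  by_cases h : a = b
  · subst h
    rw [diagonal_apply_eq, diagonal_apply_eq, sgn_mul_self, one_mul, chainExp_neg_rev hg,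
      chainExp_neg_rev hg]
    congr 2
    ring
  · rw [diagonal_apply_ne _ h, diagonal_apply_ne _ fun h' => h (Fin.rev_injective h').symm,
      mul_zero]

lemma IsChain.adjFam (hJ : IsChainIndex g J) {f : J → Matrix (Fin (2 * g)) (Fin (2 * g)) R}
    (hf : IsChain p f) : IsChain p (adjFam hJ f) := by
  refine ⟨fun i j h => ?_, fun i j h => ?_⟩
  · have h1 := congrArg adj (hf.comm (hJ.neg j) (hJ.neg i) (neg_le_neg h))
    rw [adj_mul, adj_mul] at h1
    have h2 : adj (transition p g R ((hJ.neg i : J) : ℤ) ((hJ.neg j : J) : ℤ)) =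
        transition p g R j i := adj_transition hJ.pos i j
    rw [h2] at h1
    exact h1.symm
  · refine (congrArg adj (hf.period (hJ.neg j) (hJ.neg i) ?_)).symm
    change -(i : ℤ) = -j + 2 * g
    omega

lemma IsChain.shift (hJ : IsChainIndex g J) {f : J → Matrix (Fin (2 * g)) (Fin (2 * g)) R}
    (hf : IsChain p f) (l : J) (t : ℤ) :
    f ⟨l + t * (2 * g), hJ.add_mul_mem l.2 t⟩ = f l := by
  induction t using Int.induction_on with
  | zero => congr; simp
  | succ n ih =>
    rw [← ih]
    refine (hf.period _ _ ?_).symm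
    push_cast; ring
  | pred n ih =>
    rw [← ih]
    refine hf.period _ _ ?_
    push_cast; ring

lemma IsChain.apply_mul (hR : (p : R) = 0) {f : J → Matrix (Fin (2 * g)) (Fin (2 * g)) R}
    (hf : IsChain p f) {i j : J} (h : (i : ℤ) ≤ j) (a b : Fin (2 * g)) :
    f i a b * (if chainExp g j b ≤ chainExp g i b then 1 else 0) =
      (if chainExp g j a ≤ chainExp g i a then 1 else 0) * f j a b := by
  have h1 := congrFun (congrFun (hf.comm i j h) a) b
  rwa [transition_eq hR, mul_diagonal, diagonal_mul] at h1

/-- After shifting l' by periods to some m in [l, l + 2g), the exponents of a and b rise by the same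
amount, 0 or 1, from l to m. If it is 0, the transition map between l and m is the identity on both
coordinates; if it is 1, the map between m and l + 2g is. Commutation with it then identifies the
entries. -/
lemma IsChain.apply_eq_of_sub_eq (hJ : IsChainIndex g J) (hR : (p : R) = 0)
    {f : J → Matrix (Fin (2 * g)) (Fin (2 * g)) R} (hf : IsChain p f) {l l' : J}
    {a b : Fin (2 * g)}
    (h : chainExp g l a - chainExp g l b = chainExp g l' a - chainExp g l' b) :
    f l a b = f l' a b := by
  have hg := hJ.pos
  obtain ⟨t, h1, h2⟩ := exists_shift hJ l l'
  set m : J := ⟨l' + t * (2 * g), hJ.add_mul_mem l'.2 t⟩ with hm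
  have hml : (l : ℤ) ≤ m := h1
  have hml' : (m : ℤ) ≤ l + 1 * (2 * g) := by rw [one_mul]; exact h2.le
  have e1 : ∀ k, chainExp g m k = chainExp g l' k + t := chainExp_add_mul hg l' t
  rw [← hf.shift hJ l' t, ← hm]
  by_cases hc : chainExp g m a ≤ chainExp g l a
  · have h3 := hf.apply_mul hR hml a b
    have := chainExp_mono_left hg hml a
    rwa [if_pos hc, if_pos (by rw [e1] at *; omega), mul_one, one_mul] at h3
  · have e2 : ∀ k, chainExp g (l + 1 * (2 * g)) k = chainExp g l k + 1 := chainExp_add_mul hg l 1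
    have h3 := hf.apply_mul hR (i := m) (j := ⟨l + 1 * (2 * g), hJ.add_mul_mem l.2 1⟩) hml' a b
    have := chainExp_mono_left hg hml' a
    rw [hf.shift hJ l 1] at h3
    dsimp only at h3
    rw [if_pos (by rw [e2] at *; rw [e1] at *; omega), if_pos (by rw [e2] at *; omega), mul_one,
      one_mul] at h3
    exact h3.symm

/-- After the shift the exponent of a rises from l to m while that of b does not. The transition map
thus kills coordinate a and keeps coordinate b, and commutation reads f^l_ab = 0. -/
lemma IsChain.apply_eq_zero_of_sub_lt (hJ : IsChainIndex g J) (hR : (p : R) = 0)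
    {f : J → Matrix (Fin (2 * g)) (Fin (2 * g)) R} (hf : IsChain p f) {l l' : J}
    {a b : Fin (2 * g)}
    (h : chainExp g l a - chainExp g l b < chainExp g l' a - chainExp g l' b) :
    f l a b = 0 := by
  have hg := hJ.pos
  obtain ⟨t, h1, h2⟩ := exists_shift hJ l l'
  set m : J := ⟨l' + t * (2 * g), hJ.add_mul_mem l'.2 t⟩ with hm
  have hml : (l : ℤ) ≤ m := h1
  have hml' : (m : ℤ) ≤ l + 1 * (2 * g) := by rw [one_mul]; exact h2.le
  have e1 : ∀ k, chainExp g m k = chainExp g l' k + t := chainExp_add_mul hg l' t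
  have e2 : ∀ k, chainExp g (l + 1 * (2 * g)) k = chainExp g l k + 1 := chainExp_add_mul hg l 1
  have h3 := hf.apply_mul hR hml a b
  have m1 := chainExp_mono_left hg hml' a
  have m2 := chainExp_mono_left hg hml b
  rw [e2] at m1
  have e1a := e1 a
  have e1b := e1 b
  rwa [if_pos (by omega), if_neg (by omega), mul_one, zero_mul] at h3

/-- Within a block, all members of a chain of endomorphisms have the same entries. -/
lemma IsChain.apply_eq_of_sameBlock (hJ : IsChainIndex g J) (hR : (p : R) = 0)
    {f : J → Matrix (Fin (2 * g)) (Fin (2 * g)) R} (hf : IsChain p f) (l l' : J)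
    {a b : Fin (2 * g)} (h : SameBlock g J a b) : f l a b = f l' a b :=
  hf.apply_eq_of_sub_eq hJ hR (by rw [h l l.2, h l' l'.2, sub_self, sub_self])

/-- The matrix of all nontrivial entries of a family of endomorphisms. -/
def coeff (hJ : IsChainIndex g J) (f : J → Matrix (Fin (2 * g)) (Fin (2 * g)) R) :
    Matrix (Fin (2 * g)) (Fin (2 * g)) R :=
  of fun a b => f ⟨(exists_level hJ a b).choose, (exists_level hJ a b).choose_spec.1⟩ a b

/-- The chain of endomorphisms with given nontrivial entries. -/
def chainOf (m : Matrix (Fin (2 * g)) (Fin (2 * g)) R) : J → Matrix (Fin (2 * g)) (Fin (2 * g)) R :=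
  fun l => of fun a b => if chainExp g l a - chainExp g l b = level g J a b then m a b else 0

lemma chainOf_apply (m : Matrix (Fin (2 * g)) (Fin (2 * g)) R) (l : J) (a b : Fin (2 * g)) :
    chainOf m l a b =
      if chainExp g l a - chainExp g l b = level g J a b then m a b else 0 := rfl

lemma coeff_chainOf (hJ : IsChainIndex g J) (m : Matrix (Fin (2 * g)) (Fin (2 * g)) R) :
    coeff hJ (chainOf m) = m := by
  ext a b
  exact if_pos (exists_level hJ a b).choose_spec.2

lemma IsChain.apply_eq_coeff (hJ : IsChainIndex g J) (hR : (p : R) = 0)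
    {f : J → Matrix (Fin (2 * g)) (Fin (2 * g)) R} (hf : IsChain p f) (l : J) (a b : Fin (2 * g))
    (h : chainExp g l a - chainExp g l b = level g J a b) : f l a b = coeff hJ f a b :=
  hf.apply_eq_of_sub_eq hJ hR (h.trans (exists_level hJ a b).choose_spec.2.symm)

lemma IsChain.apply_eq_zero (hJ : IsChainIndex g J) (hR : (p : R) = 0)
    {f : J → Matrix (Fin (2 * g)) (Fin (2 * g)) R} (hf : IsChain p f) (l : J) (a b : Fin (2 * g))
    (h : chainExp g l a - chainExp g l b ≠ level g J a b) : f l a b = 0 := by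
  obtain ⟨l', h1, h2⟩ := exists_level hJ a b
  refine hf.apply_eq_zero_of_sub_lt hJ hR (l' := ⟨l', h1⟩) ?_
  rw [h2]
  exact lt_of_le_of_ne (sub_le_level hJ l.2 a b) h

/-- An entry at an index where the level is attained is the corresponding coefficient, since all
such indices give the same entry; where the exponent difference is smaller, the entry vanishes. -/
lemma IsChain.chainOf_coeff (hJ : IsChainIndex g J) (hR : (p : R) = 0)
    {f : J → Matrix (Fin (2 * g)) (Fin (2 * g)) R} (hf : IsChain p f) :
    chainOf (coeff hJ f) = f := by
  funext l
  ext a b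
  rw [chainOf_apply]
  split_ifs with h
  · exact (hf.apply_eq_coeff hJ hR l a b h).symm
  · exact (hf.apply_eq_zero hJ hR l a b h).symm

/-- If the level is attained at i and the exponent of b does not rise up to j, then the bound of the
difference at j by the level prevents the exponent of a from rising, so both sides equal the
coefficient. The mirrored argument starts from a nonzero right-hand side. -/
lemma isChain_chainOf (hJ : IsChainIndex g J) (hR : (p : R) = 0)
    (m : Matrix (Fin (2 * g)) (Fin (2 * g)) R) : IsChain p (chainOf (J := J) m) := by
  have hg := hJ.pos
  refine ⟨fun i j h => ?_, fun i j h => ?_⟩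
  · rw [transition_eq hR]
    ext a b
    rw [mul_diagonal, diagonal_mul, chainOf_apply, chainOf_apply]
    have h1 := chainExp_mono_left hg h a
    have h2 := chainExp_mono_left hg h b
    have h3 := sub_le_level hJ i.2 a b
    have h4 := sub_le_level hJ j.2 a b
    split_ifs <;> first | (simp; done) | (exfalso; omega)
  · ext a b
    have e : ∀ k, chainExp g j k = chainExp g i k + 1 := fun k => by
      rw [h, ← one_mul (2 * (g : ℤ)), chainExp_add_mul hg]
    rw [chainOf_apply, chainOf_apply, e, e, add_sub_add_right_eq_sub]

lemma map_chainOf {S : Type} [CommRing S] (φ : R →+* S)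
    (m : Matrix (Fin (2 * g)) (Fin (2 * g)) R) (l : J) :
    (chainOf m l).map φ = chainOf (m.map φ) l := by
  ext a b
  rw [map_apply, chainOf_apply, chainOf_apply, map_apply, apply_ite φ, map_zero]

lemma adjFam_chainOf (hJ : IsChainIndex g J) (m : Matrix (Fin (2 * g)) (Fin (2 * g)) R) :
    adjFam hJ (chainOf m) = chainOf (adj m) := by
  funext l
  ext a b
  have e := chainExp_neg_rev hJ.pos (l : ℤ)
  rw [adjFam, adj_apply, chainOf_apply, chainOf_apply, adj_apply, level_neg_rev hJ]
  have h1 : chainExp g (hJ.neg l : J) b.rev - chainExp g (hJ.neg l : J) a.rev =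
      chainExp g l a - chainExp g l b := by
    change chainExp g (-l) b.rev - chainExp g (-l) a.rev = _
    rw [e, e]; ring
  rw [h1, mul_ite, mul_zero]

open Classical in
/-- The block diagonal part of a matrix. -/
def blockPart (J : Set ℤ) (x : Matrix (Fin (2 * g)) (Fin (2 * g)) R) :
    Matrix (Fin (2 * g)) (Fin (2 * g)) R :=
  of fun a b => if SameBlock g J a b then x a b else 0

lemma blockPart_of_sameBlock (x : Matrix (Fin (2 * g)) (Fin (2 * g)) R) {a b : Fin (2 * g)}
    (h : SameBlock g J a b) : blockPart J x a b = x a b := if_pos h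

lemma isBlockDiag_blockPart (x : Matrix (Fin (2 * g)) (Fin (2 * g)) R) :
    IsBlockDiag J (blockPart J x) := fun _ _ h => if_neg h

lemma IsBlockDiag.blockPart_eq {x : Matrix (Fin (2 * g)) (Fin (2 * g)) R}
    (hx : IsBlockDiag J x) : blockPart J x = x := by
  ext a b
  by_cases h : SameBlock g J a b
  · exact blockPart_of_sameBlock x h
  · rw [hx a b h]; exact if_neg h

lemma IsBlockDiag.ext {x y : Matrix (Fin (2 * g)) (Fin (2 * g)) R}
    (hx : IsBlockDiag J x) (hy : IsBlockDiag J y) (h : ∀ a b, SameBlock g J a b → x a b = y a b) :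
    x = y := by
  ext a b
  by_cases hab : SameBlock g J a b
  · exact h a b hab
  · rw [hx a b hab, hy a b hab]

/-- The block diagonal part of a chain of endomorphisms. -/
def blockFam (hJ : IsChainIndex g J) (f : J → Matrix (Fin (2 * g)) (Fin (2 * g)) R) :
    Matrix (Fin (2 * g)) (Fin (2 * g)) R := blockPart J (f hJ.zero)

lemma isBlockDiag_blockFam (hJ : IsChainIndex g J)
    (f : J → Matrix (Fin (2 * g)) (Fin (2 * g)) R) : IsBlockDiag J (blockFam hJ f) :=
  isBlockDiag_blockPart _

lemma IsChain.blockFam_apply (hJ : IsChainIndex g J) (hR : (p : R) = 0)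
    {f : J → Matrix (Fin (2 * g)) (Fin (2 * g)) R} (hf : IsChain p f) (l : J) {a b : Fin (2 * g)}
    (h : SameBlock g J a b) : blockFam hJ f a b = f l a b :=
  (blockPart_of_sameBlock _ h).trans (hf.apply_eq_of_sameBlock hJ hR _ _ h)

lemma blockFam_one (hJ : IsChainIndex g J) :
    blockFam hJ (1 : J → Matrix (Fin (2 * g)) (Fin (2 * g)) R) = 1 :=
  IsBlockDiag.one.blockPart_eq

lemma blockFam_sub (hJ : IsChainIndex g J) (f f' : J → Matrix (Fin (2 * g)) (Fin (2 * g)) R) :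
    blockFam hJ (f - f') = blockFam hJ f - blockFam hJ f' := by
  ext a b
  rw [Matrix.sub_apply]
  by_cases h : SameBlock g J a b
  · rw [blockFam, blockFam, blockFam, blockPart_of_sameBlock _ h, blockPart_of_sameBlock _ h,
      blockPart_of_sameBlock _ h]
    rfl
  · rw [isBlockDiag_blockFam hJ _ a b h, isBlockDiag_blockFam hJ _ a b h,
      isBlockDiag_blockFam hJ _ a b h, sub_zero]

/-- The member f^0 is block upper triangular, since all exponents vanish at 0: f^0_ac f^0_cb can be
nonzero with c outside the block of a and b only if a ≤ c ≤ b, and monotonicity of the exponents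
would put such a c into that block. -/
lemma IsChain.blockFam_mul (hJ : IsChainIndex g J) (hR : (p : R) = 0)
    {f f' : J → Matrix (Fin (2 * g)) (Fin (2 * g)) R} (hf : IsChain p f) (hf' : IsChain p f') :
    blockFam hJ (f * f') = blockFam hJ f * blockFam hJ f' := by
  refine (isBlockDiag_blockFam hJ _).ext
    ((isBlockDiag_blockFam hJ _).mul (isBlockDiag_blockFam hJ _)) fun a b h => ?_
  rw [blockFam, blockPart_of_sameBlock _ h, Pi.mul_apply, mul_apply, mul_apply]
  refine Finset.sum_congr rfl fun c _ => ?_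
  by_cases hc : SameBlock g J a c
  · rw [blockFam, blockFam, blockPart_of_sameBlock _ hc, blockPart_of_sameBlock _ (hc.symm.trans h)]
  · rw [isBlockDiag_blockFam hJ _ a c hc, zero_mul]
    have hc' : ¬ SameBlock g J c b := fun h' => hc (h.trans h'.symm)
    have e0 : ∀ k, chainExp g (hJ.zero : J) k = 0 := chainExp_zero
    by_cases h1 : a ≤ c
    · by_cases h2 : c ≤ b
      · exact absurd (fun l hl => le_antisymm (chainExp_mono_right hJ.pos l h1)
          ((chainExp_mono_right hJ.pos l h2).trans (h l hl).ge)) hc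
      · rw [hf'.apply_eq_zero hJ hR _ c b, mul_zero]
        rw [e0, e0, level, if_neg (by tauto)]
        norm_num
    · rw [hf.apply_eq_zero hJ hR _ a c, zero_mul]
      rw [e0, e0, level, if_neg (by tauto)]
      norm_num

lemma IsChain.blockFam_adjFam (hJ : IsChainIndex g J) (hR : (p : R) = 0)
    {f : J → Matrix (Fin (2 * g)) (Fin (2 * g)) R} (hf : IsChain p f) :
    blockFam hJ (SiegelParahoric.adjFam hJ f) = adj (blockFam hJ f) := by
  refine (isBlockDiag_blockFam hJ _).ext ((isBlockDiag_blockFam hJ _).adj hJ) fun a b h => ?_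
  rw [blockFam, blockPart_of_sameBlock _ h, adj_apply,
    hf.blockFam_apply hJ hR (hJ.neg hJ.zero) (h.rev hJ).symm]
  rfl

lemma blockFam_map {S : Type} [CommRing S] (φ : R →+* S) (hJ : IsChainIndex g J)
    (f : J → Matrix (Fin (2 * g)) (Fin (2 * g)) R) :
    blockFam hJ (fun l => (f l).map φ) = (blockFam hJ f).map φ := by
  refine (isBlockDiag_blockFam hJ _).ext ((isBlockDiag_blockFam hJ _).map φ) fun a b h => ?_
  rw [map_apply, blockFam, blockFam, blockPart_of_sameBlock _ h, blockPart_of_sameBlock _ h,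
    map_apply]

/-- Modulo p the transition maps are diagonal projectors that are constant on blocks, so block
diagonal matrices commute with them. -/
lemma isChain_const (hR : (p : R) = 0) {x : Matrix (Fin (2 * g)) (Fin (2 * g)) R}
    (hx : IsBlockDiag J x) : IsChain p (fun _ : J => x) := by
  refine ⟨fun i j _ => ?_, fun i j _ => rfl⟩
  rw [transition_eq hR]
  ext a b
  rw [mul_diagonal, diagonal_mul]
  by_cases h : SameBlock g J a b
  · rw [h i i.2, h j j.2, mul_comm]
  · rw [hx a b h, mul_zero, zero_mul]

/-- The points of the parahoric group in terms of chains and adjoints. -/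
lemma mem_chainAut_iff (hJ : IsChainIndex g J) (x : (J → GL (Fin (2 * g)) R) × Rˣ) :
    x ∈ chainAut p g J R ↔ IsChain p (fun l => (x.1 l).1) ∧
      ∀ l, adjFam hJ (fun l => (x.1 l).1) l * (x.1 l).1 = (x.2 : R) • (1 : Matrix _ _ R) := by
  constructor
  · rintro ⟨h1, h2, h3⟩
    exact ⟨⟨h1, fun i j h => congrArg Units.val (h2 i j h)⟩, fun l =>
      (similitude_iff _ _ _).1 (h3 l (hJ.neg l) (by simp [IsChainIndex.neg]))⟩
  · rintro ⟨h1, h2⟩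
    refine ⟨h1.comm, fun i j h => Units.ext (h1.period i j h), fun i j h => ?_⟩
    obtain rfl : j = hJ.neg i := Subtype.ext (by simp [IsChainIndex.neg, h])
    exact (similitude_iff _ _ _).2 (h2 i)

/-- A chain of similitudes with the same multiplier, as a point of the parahoric group. -/
def mkChainAut (hJ : IsChainIndex g J) {f : J → Matrix (Fin (2 * g)) (Fin (2 * g)) R} {c : Rˣ}
    (hf : IsChain p f) (hc : ∀ l, adjFam hJ f l * f l = (c : R) • (1 : Matrix _ _ R)) :
    chainAut p g J R :=
  have h : ∀ l, ((↑c⁻¹ : R) • adjFam hJ f l) * f l = 1 := fun l => by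
    rw [Matrix.smul_mul, hc, smul_smul, Units.inv_mul, one_smul]
  ⟨(fun l => ⟨f l, (↑c⁻¹ : R) • adjFam hJ f l, mul_eq_one_comm.1 (h l), h l⟩, c),
    (mem_chainAut_iff hJ _).2 ⟨hf, hc⟩⟩

lemma chainAut_ext {x y : chainAut p g J R} (h : ∀ l, (x.1.1 l).1 = (y.1.1 l).1)
    (h' : (x.1.2 : R) = y.1.2) : x = y :=
  Subtype.ext (Prod.ext (funext fun l => Units.ext (h l)) (Units.ext h'))

lemma distAut_ext {x y : distAut p g J R} (h : x.1.1.1 = y.1.1.1)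
    (h' : (x.1.2 : R) = y.1.2) : x = y :=
  Subtype.ext (Prod.ext (Units.ext h) (Units.ext h'))

variable (p) in
/-- The homomorphism `π` on points. -/
def piHom (hJ : IsChainIndex g J) (hR : (p : R) = 0) : chainAut p g J R →* distAut p g J R where
  toFun x :=
    mkDistAut hJ hR (blockFam hJ fun l => (x.1.1 l).1) x.1.2 (by
      obtain ⟨h1, h2⟩ := (mem_chainAut_iff hJ x.1).1 x.2
      rw [← h1.blockFam_adjFam hJ hR, ← (h1.adjFam hJ).blockFam_mul hJ hR h1]
      rw [show SiegelParahoric.adjFam hJ (fun l => (x.1.1 l).1) * (fun l => (x.1.1 l).1) =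
        fun _ => (x.1.2 : R) • (1 : Matrix _ _ R) from funext h2]
      exact (IsBlockDiag.one.smul _).blockPart_eq) (isBlockDiag_blockFam hJ _)
  map_one' := distAut_ext (blockFam_one hJ) rfl
  map_mul' x y := distAut_ext
    (((mem_chainAut_iff hJ x.1).1 x.2).1.blockFam_mul hJ hR ((mem_chainAut_iff hJ y.1).1 y.2).1) rfl

variable (p) in
/-- The homomorphism `s` on points. -/
def sHom (hJ : IsChainIndex g J) (hR : (p : R) = 0) : distAut p g J R →* chainAut p g J R where
  toFun x :=
    mkChainAut hJ (f := fun _ => x.1.1.1) (c := x.1.2)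
      (isChain_const hR ((mem_distAut_iff hJ hR x.1).1 x.2).2)
      fun _ => ((mem_distAut_iff hJ hR x.1).1 x.2).1
  map_one' := chainAut_ext (fun _ => rfl) rfl
  map_mul' _ _ := chainAut_ext (fun _ => rfl) rfl

lemma piHom_sHom (hJ : IsChainIndex g J) (hR : (p : R) = 0) (x : distAut p g J R) :
    piHom p hJ hR (sHom p hJ hR x) = x :=
  distAut_ext ((mem_distAut_iff hJ hR x.1).1 x.2).2.blockPart_eq rfl

end Chains

/-! ### The homomorphisms π and s of group functors -/

section Morphisms

variable {p g : ℕ} [Fact p.Prime] {J : Set ℤ}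

/-- The homomorphism `π`. -/
def piMap (p : ℕ) [Fact p.Prime] (hJ : IsChainIndex g J) :
    specialFiber p g J ⟶ distinguished p g J where
  app R := GrpCat.ofHom (piHom p (R := R) hJ (natCast_eq_zero p R))
  naturality {R S} φ := by
    ext x
    exact distAut_ext (blockFam_map φ.hom.toRingHom hJ
      fun l => ((show chainAut p g J R from x).1.1 l).1) rfl

/-- The homomorphism `s`. -/
def sMap (p : ℕ) [Fact p.Prime] (hJ : IsChainIndex g J) :
    distinguished p g J ⟶ specialFiber p g J where
  app R := GrpCat.ofHom (sHom p (R := R) hJ (natCast_eq_zero p R))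
  naturality {R S} φ := by
    ext x
    exact chainAut_ext (fun _ => rfl) rfl

lemma sMap_piMap (hJ : IsChainIndex g J) :
    sMap p hJ ≫ piMap p hJ = 𝟙 (distinguished p g J) := by
  ext R x
  exact piHom_sHom hJ (natCast_eq_zero p R) x

/-- The action of `π f` on the kernel of the transition map between neighbours is given by `f`. -/
lemma piMap_mulVec (hJ : IsChainIndex g J) (R : CommAlgCat.{0} (ZMod p))
    (f : (specialFiber p g J).obj R) (i j : J) (hij : (i : ℤ) < j)
    (hn : ∀ l ∈ J, l ≤ (i : ℤ) ∨ (j : ℤ) ≤ l) (v : Fin (2 * g) → R)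
    (hv : v ∈ transitionKer p g R j i) :
    matrixOf (((piMap p hJ).app R).hom f) *ᵥ v = component f j *ᵥ v := by
  have hR := natCast_eq_zero p R
  have hf := ((mem_chainAut_iff hJ (show chainAut p g J R from f).1).1
    (show chainAut p g J R from f).2).1
  rw [mem_transitionKer_iff hR] at hv
  ext a
  rw [mulVec_apply, mulVec_apply]
  refine Finset.sum_congr rfl fun b _ => ?_
  by_cases hb : chainExp g j b ≤ chainExp g i b
  · rw [hv b hb, mul_zero, mul_zero]
  congr 1
  change blockFam hJ (fun l => ((show chainAut p g J R from f).1.1 l).1) a b =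
    ((show chainAut p g J R from f).1.1 j).1 a b
  by_cases h : SameBlock g J a b
  · exact hf.blockFam_apply hJ hR j h
  · rw [isBlockDiag_blockFam hJ _ a b h]
    -- Here b is killed by the transition map. The indices killed between neighbours form a single
    -- block, so a survives, and commutation gives f^j_ab = 0, matching the block diagonal entry.
    have h1 := hf.apply_mul hR hij.le a b
    rw [if_neg hb, mul_zero, if_pos, one_mul] at h1
    · exact h1
    · by_contra ha
      exact h (sameBlock_of_neighbours hJ hn (not_le.1 ha) (not_le.1 hb))

lemma isComplement'_range_ker {G H : Type*} [Group G] [Group H] (π : G →* H) (s : H →* G)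
    (h : ∀ x, π (s x) = x) : Subgroup.IsComplement' s.range π.ker := by
  refine Subgroup.isComplement'_of_disjoint_and_mul_eq_univ ?_ ?_
  · rw [Subgroup.disjoint_def]
    rintro _ ⟨x, rfl⟩ hx
    rw [MonoidHom.mem_ker, h] at hx
    rw [hx, map_one]
  · refine Set.eq_univ_of_forall fun x => ⟨s (π x), ⟨π x, rfl⟩, (s (π x))⁻¹ * x, ?_, by simp⟩
    simp [MonoidHom.mem_ker, h]

end Morphisms

/-! ### Smooth algebras over a field are reduced -/

section Reduced

open TensorProduct in
-- By flatness A embeds into its base change to the fraction field of P, which is étale over a field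
-- and therefore reduced.
lemma isReduced_of_etale_of_isDomain (P A : Type*) [CommRing P] [IsDomain P] [CommRing A]
    [Algebra P A] [Algebra.Etale P A] : IsReduced A := by
  have h1 : IsReduced (FractionRing P ⊗[P] A) :=
    Algebra.FormallyUnramified.isReduced_of_field (FractionRing P) _
  exact isReduced_of_injective
    (Algebra.TensorProduct.includeRight : A →ₐ[P] FractionRing P ⊗[P] A)
    (Algebra.TensorProduct.includeRight_injective (IsFractionRing.injective P (FractionRing P)))

/-- If x is a nonzero nilpotent, its annihilator lies in a maximal ideal m. Near m the algebra is
étale over a polynomial ring, hence reduced, so x dies in some A_f with f outside m; then a power of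
f annihilates x and lies in m, a contradiction. -/
lemma isReduced_of_smooth (k A : Type*) [Field k] [CommRing A] [Algebra k A]
    [Algebra.Smooth k A] : IsReduced A := by
  refine ⟨fun x hx => ?_⟩
  by_contra hx0
  have h1 : Ideal.span {x} ≠ ⊥ := by simpa using hx0
  have h2 : (⊥ : Ideal A).colon {x} ≠ ⊤ := by
    rw [Ne, Ideal.eq_top_iff_one, Submodule.mem_colon_singleton]
    simpa using hx0
  obtain ⟨m, hm, hle⟩ := Ideal.exists_le_maximal _ h2
  obtain ⟨f, hf, hstd⟩ := Algebra.IsSmoothAt.exists_notMem_isStandardSmooth k m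
  obtain ⟨n, φ, -, hφ⟩ := RingHom.IsStandardSmooth.exists_etale_mvPolynomial
    (f := algebraMap k (Localization.Away f)) (RingHom.isStandardSmooth_algebraMap.2 hstd)
  algebraize [φ]
  have : IsReduced (Localization.Away f) :=
    isReduced_of_etale_of_isDomain (MvPolynomial (Fin n) k) _
  have h3 : algebraMap A (Localization.Away f) x = 0 := (hx.map _).eq_zero
  rw [IsLocalization.map_eq_zero_iff (Submonoid.powers f)] at h3
  obtain ⟨⟨_, r, rfl⟩, hr⟩ := h3
  refine hf (hm.isPrime.mem_of_pow_mem r (hle ?_))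
  rw [Submodule.mem_colon_singleton]
  simpa using hr

end Reduced

/-! ### Groups of unitriangular matrices: nilpotency and p-power exponent -/

section Unitriangular

variable {n : ℕ} {K : Type*} [CommRing K]

/-- The matrix vanishes below the `i`-th superdiagonal. -/
def IsUpperBand (i : ℕ) (M : Matrix (Fin n) (Fin n) K) : Prop :=
  ∀ a b : Fin n, (b : ℕ) < a + i → M a b = 0

lemma IsUpperBand.add {i : ℕ} {M N : Matrix (Fin n) (Fin n) K} (hM : IsUpperBand i M)
    (hN : IsUpperBand i N) : IsUpperBand i (M + N) := fun a b h => by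
  rw [Matrix.add_apply, hM a b h, hN a b h, add_zero]

lemma IsUpperBand.sub {i : ℕ} {M N : Matrix (Fin n) (Fin n) K} (hM : IsUpperBand i M)
    (hN : IsUpperBand i N) : IsUpperBand i (M - N) := fun a b h => by
  rw [Matrix.sub_apply, hM a b h, hN a b h, sub_zero]

lemma IsUpperBand.mono {i j : ℕ} {M : Matrix (Fin n) (Fin n) K} (hM : IsUpperBand i M)
    (h : j ≤ i) : IsUpperBand j M := fun a b hab => hM a b (by omega)

lemma IsUpperBand.mul {i j : ℕ} {M N : Matrix (Fin n) (Fin n) K} (hM : IsUpperBand i M)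
    (hN : IsUpperBand j N) : IsUpperBand (i + j) (M * N) := fun a b h => by
  rw [mul_apply]
  refine Finset.sum_eq_zero fun c _ => ?_
  by_cases hc : (c : ℕ) < a + i
  · rw [hM a c hc, zero_mul]
  · rw [hN c b (by omega), mul_zero]

lemma IsUpperBand.zero (i : ℕ) : IsUpperBand i (0 : Matrix (Fin n) (Fin n) K) := fun _ _ _ => rfl

lemma IsUpperBand.one : IsUpperBand 0 (1 : Matrix (Fin n) (Fin n) K) := fun a b h =>
  one_apply_ne (by rintro rfl; omega)

lemma IsUpperBand.eq_zero {M : Matrix (Fin n) (Fin n) K} (hM : IsUpperBand n M) : M = 0 := by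
  ext a b; exact hM a b (by omega)

variable {Γ : Type*} [Group Γ]

lemma isUpperBand_sub_one {ρ : Γ →* GL (Fin n) K}
    (h1 : ∀ x, ∀ a b : Fin n, b < a → (ρ x).1 a b = 0) (h2 : ∀ x, ∀ a, (ρ x).1 a a = 1) (x : Γ) :
    IsUpperBand 1 ((ρ x).1 - 1) := fun a b hab => by
  rw [Matrix.sub_apply]
  rcases eq_or_ne a b with rfl | h
  · rw [h2, one_apply_eq, sub_self]
  · have := Fin.val_ne_of_ne h
    rw [h1 x a b (Fin.lt_def.2 (by omega)), one_apply_ne h, sub_zero]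

/-- Groups of unitriangular matrices are nilpotent. -/
lemma isNilpotent_of_unitriangular {ρ : Γ →* GL (Fin n) K} (hρ : Function.Injective ρ)
    (h1 : ∀ x, ∀ a b : Fin n, b < a → (ρ x).1 a b = 0) (h2 : ∀ x, ∀ a, (ρ x).1 a a = 1) :
    Group.IsNilpotent Γ := by
  have hb := isUpperBand_sub_one h1 h2
  have h0 : ∀ x, IsUpperBand 0 (ρ x).1 := fun x => by
    simpa using ((hb x).mono zero_le_one).add IsUpperBand.one
  -- A descending central series by superdiagonals. The offset i + 1 makes the term at 0 the whole
  -- group, while at n the band is empty and injectivity of ρ makes the term trivial.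
  let H : ℕ → Subgroup Γ := fun i =>
    { carrier := {x | IsUpperBand (i + 1) ((ρ x).1 - 1)}
      one_mem' := by
        rw [Set.mem_ofPred_eq, map_one, Units.val_one, sub_self]
        exact IsUpperBand.zero _
      mul_mem' := fun {x y} hx hy => by
        have e : (ρ (x * y)).1 - 1 = (ρ x).1 * ((ρ y).1 - 1) + ((ρ x).1 - 1) := by
          rw [map_mul, Units.val_mul, mul_sub, mul_one, sub_add_sub_cancel]
        rw [Set.mem_ofPred_eq, e]
        have := (h0 x).mul hy
        rw [zero_add] at this
        exact this.add hx
      inv_mem' := fun {x} hx => by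
        have e : (ρ x⁻¹).1 - 1 = 0 - (ρ x⁻¹).1 * ((ρ x).1 - 1) := by
          rw [mul_sub, ← Units.val_mul, ← map_mul, inv_mul_cancel, map_one, Units.val_one, mul_one]
          abel
        rw [Set.mem_ofPred_eq, e]
        have := (h0 x⁻¹).mul hx
        rw [zero_add] at this
        exact (IsUpperBand.zero _).sub this }
  rw [Subgroup.nilpotent_iff_finite_descending_central_series]
  refine ⟨n, H, ⟨?_, fun x i hx y => ?_⟩, ?_⟩
  · rw [eq_top_iff]
    exact fun x _ => hb x
  · change IsUpperBand (i + 1 + 1) ((ρ (x * y * x⁻¹ * y⁻¹)).1 - 1)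
    -- The group commutator minus 1 is the ring commutator of x - 1 and y - 1 times x⁻¹y⁻¹, and
    -- multiplication adds the widths of the bands.
    have e : (ρ (x * y * x⁻¹ * y⁻¹)).1 - 1 =
        (((ρ x).1 - 1) * ((ρ y).1 - 1) - ((ρ y).1 - 1) * ((ρ x).1 - 1)) * (ρ (x⁻¹ * y⁻¹)).1 := by
      have e1 : ((ρ x).1 - 1) * ((ρ y).1 - 1) - ((ρ y).1 - 1) * ((ρ x).1 - 1) =
          (ρ (x * y)).1 - (ρ (y * x)).1 := by
        rw [map_mul, map_mul, Units.val_mul, Units.val_mul]; noncomm_ring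
      rw [e1, sub_mul, ← Units.val_mul, ← Units.val_mul, ← map_mul, ← map_mul]
      congr 2
      · simp only [mul_assoc]
      · rw [show y * x * (x⁻¹ * y⁻¹) = 1 by group, map_one, Units.val_one]
    rw [e]
    have h3 : IsUpperBand (i + 1) ((ρ x).1 - 1) := hx
    have h4 := h3.mul (hb y)
    have h5 := (hb y).mul h3
    rw [add_comm] at h5
    exact (h4.sub h5).mul (h0 _)
  · rw [eq_bot_iff]
    intro x hx
    have h3 : IsUpperBand (n + 1) ((ρ x).1 - 1) := hx
    have h4 := (h3.mono (Nat.le_succ n)).eq_zero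
    rw [Subgroup.mem_bot, ← hρ.eq_iff, map_one]
    exact Units.ext (sub_eq_zero.1 h4)

/-- In characteristic `p`, unitriangular matrices have `p`-power order. -/
lemma pow_eq_one_of_unitriangular {p : ℕ} [Fact p.Prime] [CharP K p] [Nontrivial K]
    {ρ : Γ →* GL (Fin n) K} (hρ : Function.Injective ρ)
    (h1 : ∀ x, ∀ a b : Fin n, b < a → (ρ x).1 a b = 0) (h2 : ∀ x, ∀ a, (ρ x).1 a a = 1) (x : Γ) :
    x ^ p ^ n = 1 := by
  have hn : ∀ i : ℕ, IsUpperBand i (((ρ x).1 - 1) ^ i) := fun i => by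
    induction i with
    | zero => exact IsUpperBand.one
    | succ i ih => rw [pow_succ]; exact ih.mul (isUpperBand_sub_one h1 h2 x)
  have h3 : ((ρ x).1 - 1) ^ p ^ n = 0 :=
    pow_eq_zero_of_le (Nat.lt_pow_self (Fact.out : p.Prime).one_lt).le (hn n).eq_zero
  -- The Frobenius identity holds in the commutative ring K[X] and is evaluated at the matrix.
  have h4 : ((ρ x).1 - 1) ^ p ^ n = (ρ x).1 ^ p ^ n - 1 := by
    have h := congrArg (Polynomial.aeval (ρ x).1)
      (sub_pow_char_pow (R := Polynomial K) (n := n) (p := p) Polynomial.X 1)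
    simpa using h
  rw [← hρ.eq_iff, map_one, map_pow]
  refine Units.ext ?_
  rw [Units.val_pow_eq_pow_val, Units.val_one, ← sub_eq_zero, ← h4, h3]

end Unitriangular

/-! ### Common kernel vectors of commuting nilpotent endomorphisms -/

section FixedVectors

/-- Commuting nilpotent endomorphisms have a common kernel vector in every stable nonzero
subspace. -/
lemma exists_common_kernel_vector {K V : Type*} [Field K] [AddCommGroup V] [Module K V]
    [FiniteDimensional K V] (S : Set (Module.End K V)) (hnil : ∀ f ∈ S, IsNilpotent f)
    (hcomm : ∀ f ∈ S, ∀ f' ∈ S, Commute f f') (P : Submodule K V) (hP : P ≠ ⊥)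
    (hstab : ∀ f ∈ S, ∀ v ∈ P, f v ∈ P) : ∃ v ∈ P, v ≠ 0 ∧ ∀ f ∈ S, f v = 0 := by
  induction hd : Module.finrank K P using Nat.strong_induction_on generalizing P with
  | _ d ih =>
    subst hd
    by_cases h : ∀ f ∈ S, ∀ v ∈ P, f v = 0
    · obtain ⟨v, hv, hv0⟩ := (Submodule.ne_bot_iff P).1 hP
      exact ⟨v, hv, hv0, fun f hf => h f hf v hv⟩
    · push Not at h
      obtain ⟨f, hf, w, hw, hfw⟩ := h
      -- Pass to the smaller subspace killed by f. It is stable because everything commutes with f,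
      -- and nonzero because it contains the last nonzero iterate of f on w.
      have hlt : P ⊓ LinearMap.ker f < P := by
        refine lt_of_le_of_ne inf_le_left fun he => hfw ?_
        rw [← he] at hw
        exact hw.2
      have hne : P ⊓ LinearMap.ker f ≠ ⊥ := by
        obtain ⟨N, hN⟩ := hnil f hf
        have hpow : ∀ i : ℕ, (f ^ i) w ∈ P := fun i => by
          induction i with
          | zero => exact hw
          | succ i ih' => rw [pow_succ']; exact hstab f hf _ ih'
        classical
        have hex : ∃ i, (f ^ i) w = 0 := ⟨N, by rw [hN]; rfl⟩
        obtain ⟨m, hm⟩ : ∃ m, Nat.find hex = m + 1 := Nat.exists_eq_succ_of_ne_zero fun h0 => by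
          have := Nat.find_spec hex
          rw [h0] at this
          exact hfw (by rw [show w = 0 from this, map_zero])
        rw [Submodule.ne_bot_iff]
        have hspec := Nat.find_spec hex
        rw [hm, pow_succ'] at hspec
        exact ⟨(f ^ m) w, ⟨hpow m, hspec⟩, Nat.find_min hex (by omega)⟩
      have hst : ∀ f' ∈ S, ∀ v ∈ P ⊓ LinearMap.ker f, f' v ∈ P ⊓ LinearMap.ker f := by
        rintro f' hf' v ⟨hv1, hv2⟩
        refine ⟨hstab f' hf' v hv1, ?_⟩
        have := LinearMap.congr_fun (hcomm f hf f' hf') v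
        rw [SetLike.mem_coe, LinearMap.mem_ker] at hv2
        rw [SetLike.mem_coe, LinearMap.mem_ker]
        rw [Module.End.mul_apply, Module.End.mul_apply, hv2, map_zero] at this
        exact this
      obtain ⟨v, hv, hv'⟩ := ih _ (Submodule.finrank_lt_finrank_of_lt hlt) _ hne hst rfl
      exact ⟨v, hv.1, hv'⟩

end FixedVectors

/-! ### Root elements, and the absence of unipotent normal subgroups in 𝒜 -/

section NormalSubgroups

variable {p g : ℕ} {J : Set ℤ}

section Root

variable {R : Type} [CommRing R]

/-- A root vector of the Lie algebra of the symplectic group. -/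
def rootVec (R : Type) [CommRing R] (a b : Fin (2 * g)) : Matrix (Fin (2 * g)) (Fin (2 * g)) R :=
  single a b 1 - adj (single a b 1)

lemma adj_single (a b : Fin (2 * g)) (r : R) :
    adj (single a b r) = single b.rev a.rev (sgn R a * sgn R b * r) := by
  ext c d
  rw [adj_apply]
  by_cases h : a = d.rev ∧ b = c.rev
  · obtain ⟨rfl, rfl⟩ := h
    rw [single_apply_same, Fin.rev_rev, Fin.rev_rev, single_apply_same, sgn_rev, sgn_rev]
    ring
  · rw [single_apply_of_ne _ _ _ _ _ h, single_apply_of_ne, mul_zero]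
    rintro ⟨rfl, rfl⟩
    simp at h

lemma adj_rootVec (a b : Fin (2 * g)) : adj (rootVec R a b) = - rootVec R a b := by
  rw [rootVec, adj_sub, adj_adj, neg_sub]

lemma rev_ne (a : Fin (2 * g)) : a.rev ≠ a := fun h => by
  have := congrArg Fin.val h
  rw [Fin.val_rev] at this
  omega

/-- All products of the two elementary matrices involved vanish, since a ≠ b and no index equals its
dual. Together with skew adjointness this makes 1 + X symplectic: (1 - X)(1 + X) = 1. -/
lemma rootVec_mul_self {a b : Fin (2 * g)} (h : a ≠ b) : rootVec R a b * rootVec R a b = 0 := by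
  rw [rootVec, adj_single, sub_mul, mul_sub, mul_sub, single_mul_single_of_ne _ _ _ _ h.symm,
    single_mul_single_of_ne _ _ _ _ (rev_ne b).symm, single_mul_single_of_ne _ _ _ _ (rev_ne a),
    single_mul_single_of_ne _ _ _ _ (fun h' => h (Fin.rev_injective h'))]
  simp

lemma isBlockDiag_rootVec (hJ : IsChainIndex g J) {a b : Fin (2 * g)} (h : SameBlock g J a b) :
    IsBlockDiag J (rootVec R a b) := by
  have h1 : IsBlockDiag J (single a b (1 : R)) := fun c d hcd => by
    rw [single_apply_of_ne]
    rintro ⟨rfl, rfl⟩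
    exact hcd h
  exact h1.sub (h1.adj hJ)

/-- The root element `1 + rootVec R a b`. -/
def rootElt (hJ : IsChainIndex g J) (hR : (p : R) = 0) {a b : Fin (2 * g)} (hab : a ≠ b)
    (h : SameBlock g J a b) : distAut p g J R :=
  mkDistAut hJ hR (1 + rootVec R a b) 1 (by
    rw [adj_add, adj_one, adj_rootVec, Units.val_one, one_smul, add_mul, one_mul, neg_mul, mul_add,
      mul_one, rootVec_mul_self hab]
    abel) (IsBlockDiag.one.add (isBlockDiag_rootVec hJ h))

lemma rootVec_mulVec (a b : Fin (2 * g)) (v : Fin (2 * g) → R) :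
    rootVec R a b *ᵥ v =
      v b • Pi.single a 1 - (sgn R a * sgn R b * v a.rev) • Pi.single b.rev 1 := by
  rw [rootVec, adj_single, sub_mulVec, single_mulVec, single_mulVec]
  ext c
  simp only [Pi.sub_apply, Pi.smul_apply, smul_eq_mul, Pi.single_apply, Function.update_apply]
  split_ifs <;> simp

end Root

variable {K : Type} [Field K]

/-- Subspaces that are stable under all root elements contain the blocks that they meet. -/
lemma single_mem_of_rootVec_stable (hJ : IsChainIndex g J) (h2 : (2 : K) ≠ 0)
    (W : Submodule K (Fin (2 * g) → K))
    (hW : ∀ a b, a ≠ b → SameBlock g J a b → ∀ v ∈ W, rootVec K a b *ᵥ v ∈ W)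
    {b : Fin (2 * g)} {v : Fin (2 * g) → K} (hv : v ∈ W)
    (hsupp : ∀ c, ¬ SameBlock g J b c → v c = 0) (hb : v b ≠ 0) (c : Fin (2 * g))
    (hc : SameBlock g J b c) : (Pi.single c 1 : Fin (2 * g) → K) ∈ W := by
  have cancel : ∀ (r : K) (w : Fin (2 * g) → K), r ≠ 0 → r • w ∈ W → w ∈ W := fun r w hr h => by
    have := W.smul_mem r⁻¹ h
    rwa [smul_smul, inv_mul_cancel₀ hr, one_smul] at this
  -- In a self-dual block the root vector for (d.rev, d) is twice an elementary matrix, so it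
  -- extracts e_{d.rev} from any vector with nonzero d coordinate because 2 is invertible. Applying
  -- this twice gives e_b, and the remaining root vectors carry e_b to the other basis vectors of
  -- the block.
  by_cases hself : SameBlock g J b b.rev
  · have key : ∀ d w, SameBlock g J d d.rev → w ∈ W → w d ≠ 0 →
        (Pi.single d.rev 1 : Fin (2 * g) → K) ∈ W := fun d w hd hw hwd => by
      have h3 := hW d.rev d (rev_ne d) hd.symm w hw
      rw [rootVec_mulVec, Fin.rev_rev, sgn_rev, ← sub_smul] at h3
      refine cancel _ _ ?_ h3
      have : w d - -sgn K d * sgn K d * w d = 2 * w d := by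
        linear_combination (w d) * sgn_mul_self (R := K) d
      rw [this]
      exact mul_ne_zero h2 hwd
    have h4 := key b v hself hv hb
    have h5 := key b.rev _ (by simpa using hself.symm) h4 (by simp)
    rw [Fin.rev_rev] at h5
    rcases eq_or_ne c b with rfl | hcb
    · exact h5
    rcases eq_or_ne c b.rev with rfl | hcb'
    · exact h4
    have h6 := hW c b hcb hc.symm _ h5
    rw [rootVec_mulVec, Pi.single_eq_same, one_smul, Pi.single_eq_of_ne, mul_zero, zero_smul,
      sub_zero] at h6
    · exact h6
    · rintro h
      exact hcb' (by rw [← h, Fin.rev_rev])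
  -- In a block that is not self-dual the second term of the root vector sees only coordinates in
  -- the dual block, where v vanishes. So e_d is obtained for d ≠ b, and e_b by subtracting these
  -- from v.
  · have key : ∀ d, SameBlock g J b d → d ≠ b → (Pi.single d 1 : Fin (2 * g) → K) ∈ W :=
        fun d hd hdb => by
      have h3 := hW d b hdb hd.symm v hv
      rw [rootVec_mulVec, hsupp d.rev, mul_zero, zero_smul, sub_zero] at h3
      · exact cancel _ _ hb h3
      · exact fun h => hself (h.trans (hd.symm.rev hJ))
    rcases eq_or_ne c b with rfl | hcb
    · refine cancel _ _ hb ?_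
      have h4 : v c • (Pi.single c 1 : Fin (2 * g) → K) =
          v - ∑ d ∈ Finset.univ.erase c, v d • Pi.single d 1 := by
        rw [eq_sub_iff_add_eq, Finset.add_sum_erase _ (fun d => v d • (Pi.single d 1 :
          Fin (2 * g) → K)) (Finset.mem_univ c)]
        ext d
        simp [Pi.single_apply]
      rw [h4]
      refine W.sub_mem hv (W.sum_mem fun d hd => ?_)
      by_cases h : SameBlock g J c d
      · exact W.smul_mem _ (key d h (Finset.ne_of_mem_erase hd))
      · rw [hsupp d h, zero_smul]; exact W.zero_mem
    · exact key c hc hcb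

/-- Over a field, `𝒜` has no nontrivial normal nilpotent subgroups of `p`-power exponent. -/
lemma eq_bot_of_normal_of_isNilpotent [Fact p.Prime] [CharP K p] (hp : p ≠ 2)
    (hJ : IsChainIndex g J) (Γ : Subgroup (distAut p g J K)) [Γ.Normal] [Group.IsNilpotent Γ]
    (N : ℕ) (hN : ∀ x ∈ Γ, x ^ p ^ N = 1) : Γ = ⊥ := by
  have hR : (p : K) = 0 := CharP.cast_eq_zero K p
  have h2 : (2 : K) ≠ 0 := Ring.two_ne_zero (by rwa [ringChar.eq K p])
  by_contra hΓ
  have : Nontrivial Γ := (Subgroup.nontrivial_iff_ne_bot Γ).2 hΓ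
  obtain ⟨z₀, hz₀⟩ := Subgroup.ne_bot_iff_exists_ne_one.1 (Group.IsNilpotent.center_ne_bot Γ)
  -- The centre is nontrivial by nilpotency, abelian, and still normal in the whole group because it
  -- is characteristic in Γ. It suffices to show that it is trivial.
  set Z := (Subgroup.center Γ).map Γ.subtype with hZ
  have hZn : Z.Normal := ConjAct.normal_of_characteristic_of_normal
  have hZc : ∀ x ∈ Z, ∀ y ∈ Z, x * y = y * x := by
    rintro _ ⟨x, hx, rfl⟩ _ ⟨y, -, rfl⟩
    exact (congrArg Γ.subtype (Subgroup.mem_center_iff.1 hx y)).symm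
  have hZN : ∀ x ∈ Z, (x.1.1.1 - 1) ^ p ^ N = 0 := by
    rintro _ ⟨x, -, rfl⟩
    have h := congrArg (Polynomial.aeval (x : distAut p g J K).1.1.1)
      (sub_pow_char_pow (R := Polynomial K) (n := N) (p := p) Polynomial.X 1)
    have h' : (x : distAut p g J K).1.1.1 ^ p ^ N = 1 :=
      congrArg (fun y : distAut p g J K => y.1.1.1) (hN x x.2)
    simp only [map_sub, map_pow, Polynomial.aeval_X, map_one, one_pow, h', sub_self] at h
    exact h
  -- The fixed space of Z. Normality of Z makes it stable under all of 𝒜, hence under 1 + X and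
  -- therefore under X for every root vector X.
  let W : Submodule K (Fin (2 * g) → K) :=
    { carrier := {v | ∀ z ∈ Z, z.1.1.1 *ᵥ v = v}
      add_mem' := fun {v w} hv hw z hz => by rw [mulVec_add, hv z hz, hw z hz]
      zero_mem' := fun z _ => mulVec_zero _
      smul_mem' := fun r v hv z hz => by rw [mulVec_smul, hv z hz] }
  have hWstab : ∀ x : distAut p g J K, ∀ v ∈ W, x.1.1.1 *ᵥ v ∈ W := fun x v hv z hz => by
    have h1 := hv _ (by simpa using hZn.conj_mem z hz x⁻¹ : x⁻¹ * z * x ∈ Z)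
    have h3 : x * (x⁻¹ * z * x) = z * x := by group
    have h4 : x.1.1.1 * (x⁻¹ * z * x).1.1.1 = z.1.1.1 * x.1.1.1 :=
      congrArg (fun y : distAut p g J K => y.1.1.1) h3
    rw [mulVec_mulVec, ← h4, ← mulVec_mulVec, h1]
  have hWroot : ∀ a b, a ≠ b → SameBlock g J a b → ∀ v ∈ W, rootVec K a b *ᵥ v ∈ W :=
    fun a b hab h v hv => by
      have h1 : (1 + rootVec K a b) *ᵥ v ∈ W := hWstab (rootElt hJ hR hab h) v hv
      rw [add_mulVec, one_mulVec] at h1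
      simpa using W.sub_mem h1 hv
  have hWtop : ∀ b, (Pi.single b 1 : Fin (2 * g) → K) ∈ W := fun b => by
    let P : Submodule K (Fin (2 * g) → K) :=
      { carrier := {v | ∀ c, ¬ SameBlock g J b c → v c = 0}
        add_mem' := fun {v w} hv hw c hc => by rw [Pi.add_apply, hv c hc, hw c hc, add_zero]
        zero_mem' := fun c _ => rfl
        smul_mem' := fun r v hv c hc => by rw [Pi.smul_apply, hv c hc, smul_zero] }
    -- The operators z - 1 commute, are nilpotent and preserve the span P of the block of b, so Z
    -- fixes a nonzero vector of P; stability under root vectors then puts the whole block into W.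
    obtain ⟨v, hv, hv0, hvZ⟩ := exists_common_kernel_vector
      ((fun z : distAut p g J K => Matrix.toLin' (z.1.1.1 - 1)) '' (Z : Set (distAut p g J K)))
      (by
        rintro _ ⟨z, hz, rfl⟩
        exact ⟨p ^ N, by rw [← Matrix.toLin'_pow, hZN z hz, map_zero]⟩)
      (by
        rintro _ ⟨z, hz, rfl⟩ _ ⟨z', hz', rfl⟩
        have h1 : z.1.1.1 * z'.1.1.1 = z'.1.1.1 * z.1.1.1 :=
          congrArg (fun y : distAut p g J K => y.1.1.1) (hZc z hz z' hz')
        change Matrix.toLin' _ * Matrix.toLin' _ = Matrix.toLin' _ * Matrix.toLin' _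
        rw [Module.End.mul_eq_comp, Module.End.mul_eq_comp, ← Matrix.toLin'_mul,
          ← Matrix.toLin'_mul]
        congr 1
        simp only [sub_mul, mul_sub, h1, mul_one, one_mul]
        abel)
      P (by
        rw [Submodule.ne_bot_iff]
        refine ⟨Pi.single b 1, fun c hc => Pi.single_eq_of_ne ?_ _, by simp⟩
        rintro rfl
        exact hc (.refl c))
      (by
        rintro _ ⟨z, -, rfl⟩ v hv a ha
        have hz := ((mem_distAut_iff hJ hR z.1).1 z.2).2
        rw [Matrix.toLin'_apply, mulVec_apply]
        refine Finset.sum_eq_zero fun c _ => ?_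
        by_cases h : SameBlock g J a c
        · rw [hv c fun h' => ha (h'.trans h.symm), mul_zero]
        · rw [row_apply, (hz.sub IsBlockDiag.one) a c h, zero_mul])
    obtain ⟨c, hc⟩ : ∃ c, v c ≠ 0 := Function.ne_iff.1 hv0
    have hbc : SameBlock g J b c := by
      by_contra h
      exact hc (hv c h)
    refine single_mem_of_rootVec_stable hJ h2 W hWroot (v := v) (fun z hz => ?_)
      (fun d hd => hv d fun h => hd (hbc.symm.trans h)) hc b hbc.symm
    have := hvZ _ ⟨z, hz, rfl⟩
    rwa [Matrix.toLin'_apply, sub_mulVec, one_mulVec, sub_eq_zero] at this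
  have hone : ∀ z ∈ Z, z = 1 := fun z hz => by
    have h1 : z.1.1.1 = 1 := Matrix.ext_of_mulVec_single fun b => by
      rw [hWtop b z hz, one_mulVec]
    refine distAut_ext h1 (multiplier_unique hJ.pos ((mem_distAut_iff hJ hR z.1).1 z.2).1 ?_)
    rw [h1, adj_one]
    exact (one_mul _).trans (one_smul K (1 : Matrix _ _ K)).symm
  refine hz₀ (Subtype.ext (Subtype.ext (hone _ ⟨z₀, z₀.2, rfl⟩)))

/-- A homomorphism onto `𝒜` kills all smooth connected unipotent closed normal subgroups. -/
lemma map_eq_one_of_isUnipotentNormal {k : Type} [Field k] [Fact p.Prime] [CharP k p] (hp : p ≠ 2)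
    (hJ : IsChainIndex g J) {G : GroupFunctor k}
    (θ : ∀ R : CommAlgCat.{0} k, G.obj R →* distAut p g J R)
    (hθ : ∀ {R S : CommAlgCat.{0} k} (φ : R ⟶ S) (x : G.obj R),
      (θ S ((G.map φ).hom x)).1.1.1 = (θ R x).1.1.1.map φ.hom)
    (hsurj : ∀ R, Function.Surjective (θ R)) {U : SubgroupFunctor G} (hU : IsUnipotentNormal U)
    (R : CommAlgCat.{0} k) (x : G.obj R) (hx : x ∈ U.pts R) : θ R x = 1 := by
  obtain ⟨H, ⟨hH⟩, hsm, -⟩ := hU.smoothConnected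
  obtain ⟨n, ρ, ⟨hinj, -⟩, hρ⟩ := hU.unipotent
  have hred : IsReduced H := isReduced_of_smooth k H
  have hp0 : ∀ S : CommAlgCat.{0} k, (p : S) = 0 := fun S => by
    rw [← map_natCast (algebraMap k S), CharP.cast_eq_zero, map_zero]
  -- Over a field, the image of the points of U is normal by surjectivity of θ, nilpotent and of
  -- p-power exponent, so the group-theoretic statement applies.
  have hfield : ∀ (K : Type) [Field K] [Algebra k K] (y : G.obj (.of k K)),
      y ∈ U.pts (.of k K) → θ (.of k K) y = 1 := by
    intro K _ _ y hy
    have : CharP K p := charP_of_injective_algebraMap (algebraMap k K).injective p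
    have : Group.IsNilpotent (U.pts (.of k K)) :=
      isNilpotent_of_unitriangular (ρ := (ρ.app (.of k K)).hom) (hinj _)
        (fun x => (hρ _ x).1) (fun x => (hρ _ x).2)
    let Γ := (U.pts (.of k K)).map (θ (.of k K))
    have h1 : Γ.Normal := (hU.normal _).map _ (hsurj _)
    have h2 : Group.IsNilpotent Γ :=
      Group.nilpotent_of_surjective ((θ (.of k K)).subgroupMap (U.pts (.of k K)))
        (MonoidHom.subgroupMap_surjective _ _)
    have h3 : Γ = ⊥ := eq_bot_of_normal_of_isNilpotent (K := K) hp hJ Γ n (by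
      rintro _ ⟨z, hz, rfl⟩
      have := pow_eq_one_of_unitriangular (p := p) (ρ := (ρ.app (.of k K)).hom) (hinj _)
        (fun x => (hρ _ x).1) (fun x => (hρ _ x).2) (⟨z, hz⟩ : U.pts (.of k K))
      have h4 : z ^ p ^ n = 1 := congrArg Subtype.val this
      rw [← map_pow, h4, map_one])
    have h5 : θ (.of k K) y ∈ Γ := ⟨y, hy, rfl⟩
    rwa [h3, Subgroup.mem_bot] at h5
  -- The universal point of U lives over the reduced ring H, so its image is trivial as soon as it
  -- is trivial over all residue fields; every other point is a specialization of it.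
  set u : U.toFunctor.obj H := hH.homEquiv (𝟙 H) with hu
  have huniv : (θ H u.1).1.1.1 = 1 := by
    rw [← sub_eq_zero]
    ext a b
    refine IsNilpotent.eq_zero (nilpotent_iff_mem_prime.2 fun q hq => ?_)
    rw [← Ideal.algebraMap_residueField_eq_zero (I := q)]
    let φ : H ⟶ CommAlgCat.of k q.ResidueField :=
      CommAlgCat.ofHom (IsScalarTower.toAlgHom k H q.ResidueField)
    have h1 := hθ φ u.1
    rw [hfield q.ResidueField _ (U.map_mem φ u.1 u.2)] at h1
    have h2 := congrFun (congrFun h1 a) b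
    change _ = algebraMap H q.ResidueField _ at h2
    rw [Matrix.sub_apply, map_sub, ← h2]
    change (1 : Matrix _ _ q.ResidueField) a b - _ = 0
    by_cases hab : a = b
    · subst hab; simp
    · simp [one_apply_ne hab]
  obtain ⟨φ, hφ⟩ := hH.homEquiv.surjective (⟨x, hx⟩ : U.pts R)
  have h1 : (G.map φ).hom u.1 = x := by
    have h2 := hH.homEquiv_comp φ (𝟙 H)
    rw [Category.id_comp, hφ] at h2
    exact (congrArg Subtype.val h2).symm
  have h3 : (θ R x).1.1.1 = 1 := by
    rw [← h1, hθ, huniv, Matrix.map_one _ (map_zero _) (map_one _)]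
  refine distAut_ext h3
    (multiplier_unique hJ.pos ((mem_distAut_iff hJ (hp0 R) (θ R x).1).1 (θ R x).2).1 ?_)
  rw [h3, adj_one]
  exact (one_mul _).trans (one_smul R (1 : Matrix _ _ R)).symm

end NormalSubgroups

/-! ### The coordinate ring of 𝒜 and its smoothness -/

section Representability

variable {p g : ℕ} {J : Set ℤ}

lemma isUnit_two_of_char [Fact p.Prime] (hp : p ≠ 2) {R : Type} [CommRing R] (hR : (p : R) = 0) :
    IsUnit (2 : R) := by
  obtain ⟨m, hm⟩ := (Fact.out : p.Prime).odd_of_ne_two hp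
  refine IsUnit.of_mul_eq_one (-(m : R)) ?_
  rw [hm] at hR
  push_cast at hR
  linear_combination -hR

/-- Change of coefficients for points of `𝒜`. -/
def distMap {R S : Type} [CommRing R] [CommRing S] (hR : (p : R) = 0) (φ : R →+* S) :
    distAut p g J R →* distAut p g J S :=
  ((simMap g φ).comp (distAut p g J R).subtype).codRestrict (distAut p g J S)
    fun x => simMap_mem p g J φ hR x.1 x.2

/-- The polynomial ring in the entries of a matrix, a multiplier and its inverse. -/
abbrev SimPoly (p g : ℕ) : Type := MvPolynomial ((Fin (2 * g) × Fin (2 * g)) ⊕ Bool) (ZMod p)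

/-- The generic matrix. -/
def genMat (p g : ℕ) : Matrix (Fin (2 * g)) (Fin (2 * g)) (SimPoly p g) :=
  of fun a b => MvPolynomial.X (Sum.inl (a, b))

/-- The entries of this matrix are the equations that define similitudes. -/
def simDefect (p g : ℕ) : Matrix (Fin (2 * g)) (Fin (2 * g)) (SimPoly p g) :=
  adj (genMat p g) * genMat p g - (MvPolynomial.X (Sum.inr true) : SimPoly p g) • (1 : Matrix _ _ _)

/-- The equations of `𝒜`. -/
def distRel (p g : ℕ) (J : Set ℤ) : Ideal (SimPoly p g) :=
  Ideal.span ({q | ∃ a b, q = simDefect p g a b} ∪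
    {q | ∃ a b, ¬ SameBlock g J a b ∧ q = genMat p g a b} ∪
    {MvPolynomial.X (Sum.inr true) * MvPolynomial.X (Sum.inr false) - 1})

/-- The coordinate ring of `𝒜`. -/
abbrev DistRing (p g : ℕ) (J : Set ℤ) : Type := SimPoly p g ⧸ distRel p g J

variable [Fact p.Prime]

lemma distRing_charP : (p : DistRing p g J) = 0 := by
  rw [← map_natCast (algebraMap (ZMod p) (DistRing p g J)), ZMod.natCast_self, map_zero]

/-- The multiplier of the universal point. -/
def univMult (p g : ℕ) (J : Set ℤ) : (DistRing p g J)ˣ :=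
  have h : (Ideal.Quotient.mk (distRel p g J) (MvPolynomial.X (Sum.inr true))) *
      Ideal.Quotient.mk (distRel p g J) (MvPolynomial.X (Sum.inr false)) = 1 := by
    rw [← map_mul, ← map_one (Ideal.Quotient.mk (distRel p g J)), Ideal.Quotient.eq]
    exact Ideal.subset_span (Or.inr rfl)
  ⟨_, _, h, (mul_comm _ _).trans h⟩

/-- The universal point of `𝒜`. -/
def univPoint (p : ℕ) [Fact p.Prime] (hJ : IsChainIndex g J) : distAut p g J (DistRing p g J) :=
  mkDistAut hJ distRing_charP ((genMat p g).map (Ideal.Quotient.mk (distRel p g J)))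
    (univMult p g J)
    (by
      rw [adj_map, ← Matrix.map_mul]
      ext a b
      rw [map_apply, Matrix.smul_apply, smul_eq_mul, ← sub_eq_zero]
      have : (1 : Matrix (Fin (2 * g)) (Fin (2 * g)) (DistRing p g J)) a b =
          Ideal.Quotient.mk (distRel p g J) ((1 : Matrix _ _ (SimPoly p g)) a b) := by
        by_cases h : a = b
        · subst h; simp
        · simp [one_apply_ne h]
      rw [this]
      change Ideal.Quotient.mk (distRel p g J) _ - Ideal.Quotient.mk (distRel p g J) _ * _ = _
      rw [← map_mul, ← map_sub, Ideal.Quotient.eq_zero_iff_mem]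
      exact Ideal.subset_span (Or.inl (Or.inl ⟨a, b, rfl⟩)))
    (fun a b h => by
      rw [map_apply, Ideal.Quotient.eq_zero_iff_mem]
      exact Ideal.subset_span (Or.inl (Or.inr ⟨a, b, h, rfl⟩)))

variable {R : Type} [CommRing R] [Algebra (ZMod p) R]

lemma distRing_hom_ext {S : Type} [CommRing S] {φ ψ : DistRing p g J →+* S}
    (h1 : ∀ a b, φ (Ideal.Quotient.mk _ (genMat p g a b)) = ψ (Ideal.Quotient.mk _ (genMat p g a b)))
    (h2 : φ (univMult p g J : (DistRing p g J)ˣ) = ψ (univMult p g J : (DistRing p g J)ˣ)) :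
    φ = ψ := by
  have h3 : φ ((univMult p g J)⁻¹ : (DistRing p g J)ˣ) =
      ψ ((univMult p g J)⁻¹ : (DistRing p g J)ˣ) := by
    have : Units.map φ.toMonoidHom (univMult p g J) = Units.map ψ.toMonoidHom (univMult p g J) :=
      Units.ext h2
    have := congrArg (fun u => (u⁻¹ : Sˣ).1) this
    exact this
  refine Ideal.Quotient.ringHom_ext (MvPolynomial.ringHom_ext (fun r => ?_) ?_)
  · exact RingHom.congr_fun (Subsingleton.elim
      ((φ.comp (Ideal.Quotient.mk _)).comp MvPolynomial.C)
      ((ψ.comp (Ideal.Quotient.mk _)).comp MvPolynomial.C)) r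
  · rintro (⟨a, b⟩ | (_ | _))
    · exact h1 a b
    · exact h3
    · exact h2

/-- The homomorphism on coordinate rings that corresponds to a point of `𝒜`. -/
def distEval (hJ : IsChainIndex g J) (x : distAut p g J R) : DistRing p g J →ₐ[ZMod p] R :=
  Ideal.Quotient.liftₐ (distRel p g J)
    (MvPolynomial.aeval (Sum.elim (fun ab => x.1.1.1 ab.1 ab.2)
      (fun t => if t then (x.1.2 : R) else (↑(x.1.2)⁻¹ : R)))) (by
    obtain ⟨h1, h2⟩ := (mem_distAut_iff hJ (natCast_eq_zero p R) x.1).1 x.2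
    set φ : SimPoly p g →ₐ[ZMod p] R := MvPolynomial.aeval (Sum.elim
      (fun ab => x.1.1.1 ab.1 ab.2) (fun t => if t then (x.1.2 : R) else (↑(x.1.2)⁻¹ : R))) with hφ
    have hX : (genMat p g).map φ.toRingHom = x.1.1.1 := by
      ext a b
      simp [genMat, hφ]
    have hle : distRel p g J ≤ RingHom.ker φ.toRingHom := by
      rw [distRel, Ideal.span_le]
      rintro q ((⟨a, b, rfl⟩ | ⟨a, b, hab, rfl⟩) | rfl)
      · rw [SetLike.mem_coe, RingHom.mem_ker, simDefect, Matrix.sub_apply, map_sub]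
        have h3 : (adj (genMat p g) * genMat p g).map φ.toRingHom =
            (x.1.2 : R) • (1 : Matrix _ _ R) := by
          rw [Matrix.map_mul, ← adj_map, hX, h1]
        have h4 := congrFun (congrFun h3 a) b
        rw [map_apply] at h4
        rw [h4, Matrix.smul_apply, Matrix.smul_apply, smul_eq_mul, smul_eq_mul, map_mul]
        have h5 : φ.toRingHom (MvPolynomial.X (Sum.inr true)) = (x.1.2 : R) := by simp [hφ]
        rw [h5]
        by_cases h : a = b
        · subst h; simp
        · simp [one_apply_ne h]
      · rw [SetLike.mem_coe, RingHom.mem_ker, ← map_apply (f := φ.toRingHom), hX]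
        exact h2 a b hab
      · rw [SetLike.mem_coe, RingHom.mem_ker]
        simp [hφ]
    exact fun a ha => hle ha)

lemma distEval_genMat (hJ : IsChainIndex g J) (x : distAut p g J R) (a b : Fin (2 * g)) :
    distEval hJ x (Ideal.Quotient.mk _ (genMat p g a b)) = x.1.1.1 a b := by
  change MvPolynomial.aeval _ (MvPolynomial.X _) = _
  rw [MvPolynomial.aeval_X]
  rfl

lemma distEval_univMult (hJ : IsChainIndex g J) (x : distAut p g J R) :
    distEval hJ x (univMult p g J : (DistRing p g J)ˣ) = x.1.2 := by
  change MvPolynomial.aeval _ (MvPolynomial.X _) = _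
  rw [MvPolynomial.aeval_X]
  rfl

lemma map_distEval {S : Type} [CommRing S] [Algebra (ZMod p) S] (hJ : IsChainIndex g J)
    (φ : R →+* S) (x : distAut p g J R) (r : DistRing p g J) :
    distEval hJ (distMap (natCast_eq_zero p R) φ x) r = φ (distEval hJ x r) := by
  have : (distEval hJ (distMap (natCast_eq_zero p R) φ x)).toRingHom =
      φ.comp (distEval hJ x).toRingHom := by
    refine distRing_hom_ext (fun a b => ?_) ?_
    · exact (distEval_genMat hJ _ a b).trans (congrArg φ (distEval_genMat hJ x a b)).symm
    · exact (distEval_univMult hJ _).trans (congrArg φ (distEval_univMult hJ x)).symm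
  exact RingHom.congr_fun this r

lemma distMap_distEval (hJ : IsChainIndex g J) (x : distAut p g J R) :
    distMap distRing_charP (distEval hJ x).toRingHom (univPoint p hJ) = x :=
  distAut_ext (by ext a b; exact distEval_genMat hJ x a b) (distEval_univMult hJ x)

lemma distEval_distMap (hJ : IsChainIndex g J) (φ : DistRing p g J →+* R) (r : DistRing p g J) :
    distEval hJ (distMap distRing_charP φ (univPoint p hJ)) r = φ r := by
  refine RingHom.congr_fun (f := (distEval hJ _).toRingHom) (distRing_hom_ext (fun a b => ?_) ?_) r
  · exact distEval_genMat hJ _ a b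
  · exact distEval_univMult hJ _

/-- `𝒜` is corepresented by its coordinate ring. -/
def distCorepresentableBy (hJ : IsChainIndex g J) :
    (distinguished p g J ⋙ forget GrpCat).CorepresentableBy
      (CommAlgCat.of (ZMod p) (DistRing p g J)) where
  homEquiv {R} :=
    { toFun := fun φ => (distMap distRing_charP φ.hom.toRingHom (univPoint p hJ) : distAut p g J R)
      invFun := fun x => CommAlgCat.ofHom (distEval hJ (show distAut p g J R from x))
      left_inv := fun φ => by
        ext r
        exact distEval_distMap hJ φ.hom.toRingHom r
      right_inv := fun x => distMap_distEval hJ (show distAut p g J R from x) }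
  homEquiv_comp {R S} φ ψ := rfl

/-- Infinitesimal lifting for `𝒜`. -/
lemma exists_distAut_lift (hp : p ≠ 2) (hJ : IsChainIndex g J) {B : Type} [CommRing B]
    (hB : (p : B) = 0) (I : Ideal B) (hI : I ^ 2 = ⊥) (x : distAut p g J (B ⧸ I)) :
    ∃ y : distAut p g J B, distMap hB (Ideal.Quotient.mk I) y = x := by
  have hBI : (p : B ⧸ I) = 0 := by rw [← map_natCast (Ideal.Quotient.mk I), hB, map_zero]
  obtain ⟨hx1, hx2⟩ := (mem_distAut_iff hJ hBI x.1).1 x.2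
  have hI0 : ∀ r ∈ I, ∀ s ∈ I, r * s = 0 := fun r hr s hs => by
    have := Ideal.mul_mem_mul hr hs
    rwa [← pow_two, hI, Ideal.mem_bot] at this
  choose σ hσ using Ideal.Quotient.mk_surjective (I := I)
  classical
  -- Lift the entries arbitrarily inside the blocks and by 0 outside, so that only the similitude
  -- equation can fail.
  let h : Matrix (Fin (2 * g)) (Fin (2 * g)) B :=
    of fun a b => if SameBlock g J a b then σ (x.1.1.1 a b) else 0
  have hd : IsBlockDiag J h := fun a b hab => if_neg hab
  have hmap : h.map (Ideal.Quotient.mk I) = x.1.1.1 := by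
    refine (hd.map _).ext hx2 fun a b hab => ?_
    rw [map_apply]
    change Ideal.Quotient.mk I (if SameBlock g J a b then σ (x.1.1.1 a b) else 0) = _
    rw [if_pos hab, hσ]
  have hcu : IsUnit (σ x.1.2) := by
    rw [← IsNilpotent.isUnit_quotient_mk_iff ⟨2, hI⟩, hσ]
    exact x.1.2.isUnit
  obtain ⟨c, hc⟩ := hcu
  obtain ⟨t, ht⟩ := isUnit_two_of_char hp hB
  have hc' : Ideal.Quotient.mk I c = (x.1.2 : B ⧸ I) := by rw [hc, hσ]
  -- The defect ε is self-adjoint, block diagonal and has square zero. With r = 1/(2c), the factor y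
  -- = 1 - rε is a first-order inverse square root: y(c + ε)y = c + ε - 2rcε = c.
  set ε := adj h * h - (c : B) • (1 : Matrix _ _ B) with hε
  have hε1 : ε.map (Ideal.Quotient.mk I) = 0 := by
    rw [hε, Matrix.map_sub _ (map_sub _), Matrix.map_mul, ← adj_map, hmap, hx1, sub_eq_zero]
    ext a b
    rw [map_apply, Matrix.smul_apply, Matrix.smul_apply, smul_eq_mul, smul_eq_mul, map_mul, hc']
    by_cases hab : a = b
    · subst hab; simp
    · simp [one_apply_ne hab]
  have hεI : ∀ a b, ε a b ∈ I := fun a b => by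
    rw [← Ideal.Quotient.eq_zero_iff_mem]
    exact congrFun (congrFun hε1 a) b
  have hε2 : ε * ε = 0 := by
    ext a b
    rw [mul_apply]
    exact Finset.sum_eq_zero fun d _ => hI0 _ (hεI a d) _ (hεI d b)
  have hε3 : adj ε = ε := by rw [hε, adj_sub, adj_mul, adj_adj, adj_smul, adj_one]
  have hε4 : adj h * h = (c : B) • (1 : Matrix _ _ B) + ε := by rw [hε]; abel
  have hε5 : IsBlockDiag J ε := ((hd.adj hJ).mul hd).sub (IsBlockDiag.one.smul _)
  set r : B := ↑t⁻¹ * ↑c⁻¹ with hr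
  have hr2 : 2 * (r * c) = 1 := by
    rw [hr, ← ht, mul_assoc (↑t⁻¹ : B), Units.inv_mul, mul_one, Units.mul_inv]
  set y := 1 - r • ε with hy
  have hy1 : adj y = y := by rw [hy, adj_sub, adj_one, adj_smul, hε3]
  have hyd : IsBlockDiag J y := IsBlockDiag.one.sub (hε5.smul r)
  have hy2 : adj (h * y) * (h * y) = (c : B) • (1 : Matrix _ _ B) := by
    have e1 : adj (h * y) * (h * y) = y * (adj h * h) * y := by
      rw [adj_mul, hy1]; simp only [Matrix.mul_assoc]
    rw [e1, hε4, hy]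
    simp only [sub_mul, mul_sub, mul_add, add_mul, Matrix.one_mul, Matrix.mul_one, Matrix.smul_mul,
      Matrix.mul_smul, hε2, smul_zero, sub_zero, add_zero]
    have e2 : ε - (r * c) • ε - (r * c) • ε = 0 := by
      rw [sub_sub, ← add_smul, ← two_mul, hr2, one_smul, sub_self]
    rw [mul_smul] at e2
    rw [smul_comm (c : B) r ε, ← sub_eq_zero, ← e2]
    abel
  refine ⟨mkDistAut hJ hB (h * y) c hy2 (hd.mul hyd), distAut_ext ?_ hc'⟩
  change (h * y).map (Ideal.Quotient.mk I) = _
  rw [Matrix.map_mul, hmap]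
  have : y.map (Ideal.Quotient.mk I) = 1 := by
    rw [hy, Matrix.map_sub _ (map_sub _), Matrix.map_one _ (map_zero _) (map_one _)]
    have : (r • ε).map (Ideal.Quotient.mk I) = 0 := by
      ext a b
      rw [map_apply, Matrix.smul_apply, smul_eq_mul, Ideal.Quotient.eq_zero_iff_mem.2
        (I.mul_mem_left r (hεI a b))]
      rfl
    rw [this, sub_zero]
  rw [this, Matrix.mul_one]

/-- Formal smoothness is the infinitesimal lifting of points, transported through the correspondence
between points of 𝒜 and homomorphisms from the coordinate ring. -/
lemma distRing_smooth (hp : p ≠ 2) (hJ : IsChainIndex g J) :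
    Algebra.Smooth (ZMod p) (DistRing p g J) where
  formallySmooth := by
    refine Algebra.FormallySmooth.of_comp_surjective fun B _ _ I hI φ => ?_
    obtain ⟨y, hy⟩ := exists_distAut_lift hp hJ (natCast_eq_zero p B) I hI
      (distMap distRing_charP φ.toRingHom (univPoint p hJ))
    refine ⟨distEval hJ y, AlgHom.ext fun r => ?_⟩
    have h := map_distEval hJ (Ideal.Quotient.mk I) y r
    rw [hy] at h
    exact h.symm.trans (distEval_distMap hJ φ.toRingHom r)
  finitePresentation :=
    Algebra.FinitePresentation.quotient (IsNoetherian.noetherian _)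

end Representability

/-! ### Lagrangian halves of the basis and 2 × 2 block matrices -/

section Halves

variable {g : ℕ} {J : Set ℤ} {R : Type} [CommRing R]

/-- The basis of the standard symplectic space as the union of two dual halves. -/
def halves (g : ℕ) : Fin g ⊕ Fin g ≃ Fin (2 * g) :=
  ((Equiv.refl _).sumCongr Fin.revPerm).trans (finSumFinEquiv.trans (finCongr (two_mul g).symm))

lemma halves_inl_val (i : Fin g) : (halves g (Sum.inl i) : ℕ) = i := rfl

lemma halves_inr (i : Fin g) : halves g (Sum.inr i) = (halves g (Sum.inl i)).rev := by
  ext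
  simp [halves, Fin.val_rev]
  omega

lemma sgn_inl (i : Fin g) : sgn R (halves g (Sum.inl i)) = 1 := if_pos i.2

/-- A matrix with given blocks for the two halves of the basis. -/
def ofBlocks (A B C D : Matrix (Fin g) (Fin g) R) : Matrix (Fin (2 * g)) (Fin (2 * g)) R :=
  (fromBlocks A B C D).submatrix (halves g).symm (halves g).symm

lemma ofBlocks_mul (A B C D A' B' C' D' : Matrix (Fin g) (Fin g) R) :
    ofBlocks A B C D * ofBlocks A' B' C' D' =
      ofBlocks (A * A' + B * C') (A * B' + B * D') (C * A' + D * C') (C * B' + D * D') := by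
  rw [ofBlocks, ofBlocks, submatrix_mul_equiv, fromBlocks_multiply]
  rfl

lemma ofBlocks_one : ofBlocks (1 : Matrix (Fin g) (Fin g) R) 0 0 1 = 1 := by
  rw [ofBlocks, fromBlocks_one, submatrix_one_equiv]

lemma ofBlocks_smul_one (c : R) :
    ofBlocks (c • (1 : Matrix (Fin g) (Fin g) R)) 0 0 (c • 1) = c • (1 : Matrix _ _ R) := by
  have h := fromBlocks_smul c (1 : Matrix (Fin g) (Fin g) R) 0 0 (1 : Matrix (Fin g) (Fin g) R)
  rw [smul_zero] at h
  rw [← ofBlocks_one, ofBlocks, ← h]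
  rfl

lemma ofBlocks_map {S : Type} [CommRing S] (φ : R →+* S) (A B C D : Matrix (Fin g) (Fin g) R) :
    (ofBlocks A B C D).map φ = ofBlocks (A.map φ) (B.map φ) (C.map φ) (D.map φ) := by
  rw [ofBlocks, ofBlocks, ← fromBlocks_map, submatrix_map]

omit [CommRing R] in
lemma exists_ofBlocks (x : Matrix (Fin (2 * g)) (Fin (2 * g)) R) :
    ∃ A B C D, x = ofBlocks A B C D := by
  let y := x.submatrix (halves g) (halves g)
  refine ⟨y.toBlocks₁₁, y.toBlocks₁₂, y.toBlocks₂₁, y.toBlocks₂₂, ?_⟩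
  rw [ofBlocks, fromBlocks_toBlocks, submatrix_submatrix]
  simp

omit [CommRing R] in
lemma ofBlocks_inj {A B C D A' B' C' D' : Matrix (Fin g) (Fin g) R} :
    ofBlocks A B C D = ofBlocks A' B' C' D' ↔ A = A' ∧ B = B' ∧ C = C' ∧ D = D' := by
  rw [← fromBlocks_inj]
  refine ⟨fun h => ?_, fun h => congrArg (fun M => submatrix M _ _) h⟩
  have := congrArg (fun M => M.submatrix (halves g) (halves g)) h
  simpa [ofBlocks] using this

omit [CommRing R] in
lemma ofBlocks_apply (A B C D : Matrix (Fin g) (Fin g) R) (a b : Fin g ⊕ Fin g) :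
    ofBlocks A B C D (halves g a) (halves g b) = fromBlocks A B C D a b := by
  simp [ofBlocks]

lemma adj_ofBlocks (A B C D : Matrix (Fin g) (Fin g) R) :
    adj (ofBlocks A B C D) = ofBlocks Dᵀ (-Bᵀ) (-Cᵀ) Aᵀ := by
  ext a b
  obtain ⟨a, rfl⟩ := (halves g).surjective a
  obtain ⟨b, rfl⟩ := (halves g).surjective b
  rw [ofBlocks_apply, adj_apply]
  rcases a with i | i <;> rcases b with j | j <;>
    simp only [halves_inr, sgn_inl, sgn_rev, Fin.rev_rev]
  · rw [← halves_inr, ← halves_inr, ofBlocks_apply]; simp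
  · rw [← halves_inr, ofBlocks_apply]; simp
  · rw [← halves_inr, ofBlocks_apply]; simp
  · rw [ofBlocks_apply]; simp

lemma isBlockDiag_ofBlocks_iff {A B C D : Matrix (Fin g) (Fin g) R} :
    IsBlockDiag J (ofBlocks A B C D) ↔
      (∀ i j, ¬ SameBlock g J (halves g (.inl i)) (halves g (.inl j)) → A i j = 0) ∧
      (∀ i j, ¬ SameBlock g J (halves g (.inl i)) (halves g (.inr j)) → B i j = 0) ∧
      (∀ i j, ¬ SameBlock g J (halves g (.inr i)) (halves g (.inl j)) → C i j = 0) ∧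
      (∀ i j, ¬ SameBlock g J (halves g (.inr i)) (halves g (.inr j)) → D i j = 0) := by
  constructor
  · intro h
    refine ⟨fun i j hij => ?_, fun i j hij => ?_, fun i j hij => ?_, fun i j hij => ?_⟩ <;>
      simpa [ofBlocks_apply] using h _ _ hij
  · rintro ⟨hA, hB, hC, hD⟩ a b
    obtain ⟨a, rfl⟩ := (halves g).surjective a
    obtain ⟨b, rfl⟩ := (halves g).surjective b
    rw [ofBlocks_apply]
    rcases a with i | i <;> rcases b with j | j
    exacts [hA i j, hB i j, hC i j, hD i j]

lemma sameBlock_of_le_of_le (hJ : IsChainIndex g J) {a b c : Fin (2 * g)} (hab : a ≤ b)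
    (hbc : b ≤ c) (h : SameBlock g J a c) : SameBlock g J a b := fun l hl =>
  le_antisymm (chainExp_mono_right hJ.pos l hab)
    ((chainExp_mono_right hJ.pos l hbc).trans (h l hl).ge)

/-- A block that meets both halves of the basis is self-dual. -/
lemma sameBlock_inl_inr (hJ : IsChainIndex g J) {i j : Fin g}
    (h : SameBlock g J (halves g (.inr i)) (halves g (.inl j))) :
    SameBlock g J (halves g (.inl i)) (halves g (.inr i)) := by
  have hr : SameBlock g J (halves g (.inl i)) (halves g (.inr j)) := by
    have := h.rev hJ
    rwa [halves_inr, Fin.rev_rev, ← halves_inr] at this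
  -- Blocks are intervals of the basis and the first half precedes the second. Whichever of i and j
  -- is smaller, the interval between it and its dual contains the vectors of the other.
  have lt : ∀ i j : Fin g, halves g (.inl i) ≤ halves g (.inr j) := fun i j => by
    rw [halves_inr, Fin.le_def, Fin.val_rev, halves_inl_val, halves_inl_val]
    omega
  rcases le_total i j with hij | hij
  · have h1 : halves g (.inl i) ≤ halves g (.inl j) := hij
    exact (sameBlock_of_le_of_le hJ h1 (lt j j) hr).trans h.symm
  · have h1 : halves g (.inl j) ≤ halves g (.inl i) := hij
    exact (sameBlock_of_le_of_le hJ h1 (lt i i) h.symm).symm.trans h.symm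

/-- A matrix supported on an equivalence relation commutes with the projector onto each class, hence
so does its inverse, and this forces the inverse to have the same support. -/
lemma units_inv_supported {n : Type*} [Fintype n] [DecidableEq n] (r : n → n → Prop)
    (hrefl : ∀ i, r i i) (htrans : ∀ {i j k}, r i j → r j k → r i k)
    (hsymm : ∀ {i j}, r i j → r j i) (A : (Matrix n n R)ˣ)
    (hA : ∀ i j, ¬ r i j → A.1 i j = 0) (i j : n) (hij : ¬ r i j) : (A⁻¹).1 i j = 0 := by
  classical
  let D : Matrix n n R := diagonal fun k => if r k j then 1 else 0
  have h1 : Commute A.1 D := by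
    ext k l
    rw [mul_diagonal, diagonal_mul]
    by_cases hkl : r k l
    · have : r k j ↔ r l j := ⟨fun h => htrans (hsymm hkl) h, fun h => htrans hkl h⟩
      simp [this]
    · rw [hA k l hkl, mul_zero, zero_mul]
  have h2 := congrFun (congrFun h1.units_inv_left.eq i) j
  rw [mul_diagonal, diagonal_mul, if_pos (hrefl j), if_neg hij, mul_one, zero_mul] at h2
  exact h2

variable {p : ℕ}

/-- The upper unipotent element of `𝒜` with a given symmetric block. -/
def upperElt (hJ : IsChainIndex g J) (hR : (p : R) = 0) (S : Matrix (Fin g) (Fin g) R)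
    (hS : Sᵀ = S)
    (hd : ∀ i j, ¬ SameBlock g J (halves g (.inl i)) (halves g (.inr j)) → S i j = 0) :
    distAut p g J R :=
  mkDistAut hJ hR (ofBlocks 1 S 0 1) 1
    (by
      rw [adj_ofBlocks, ofBlocks_mul, hS, Units.val_one, ← ofBlocks_smul_one]
      simp)
    (isBlockDiag_ofBlocks_iff.2
      ⟨fun i j h => one_apply_ne (by rintro rfl; exact h (.refl _)), hd, fun _ _ _ => rfl,
        fun i j h => one_apply_ne (by rintro rfl; exact h (.refl _))⟩)

/-- The lower unipotent element of `𝒜` with a given symmetric block. -/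
def lowerElt (hJ : IsChainIndex g J) (hR : (p : R) = 0) (S : Matrix (Fin g) (Fin g) R)
    (hS : Sᵀ = S)
    (hd : ∀ i j, ¬ SameBlock g J (halves g (.inr i)) (halves g (.inl j)) → S i j = 0) :
    distAut p g J R :=
  mkDistAut hJ hR (ofBlocks 1 0 S 1) 1
    (by
      rw [adj_ofBlocks, ofBlocks_mul, hS, Units.val_one, ← ofBlocks_smul_one]
      simp)
    (isBlockDiag_ofBlocks_iff.2
      ⟨fun i j h => one_apply_ne (by rintro rfl; exact h (.refl _)), fun _ _ _ => rfl, hd,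
        fun i j h => one_apply_ne (by rintro rfl; exact h (.refl _))⟩)

/-- The element of `𝒜` that preserves both halves, with given multiplier and given action on the
first half. -/
def leviElt (hJ : IsChainIndex g J) (hR : (p : R) = 0) (A : (Matrix (Fin g) (Fin g) R)ˣ) (c : Rˣ)
    (hd : ∀ i j, ¬ SameBlock g J (halves g (.inl i)) (halves g (.inl j)) → A.1 i j = 0) :
    distAut p g J R :=
  mkDistAut hJ hR (ofBlocks A.1 0 0 ((c : R) • (A⁻¹).1ᵀ)) c
    (by
      rw [adj_ofBlocks, ofBlocks_mul, ← ofBlocks_smul_one]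
      have h1 : A.1ᵀ * (A⁻¹).1ᵀ = 1 := by
        rw [← transpose_mul, Units.inv_mul, transpose_one]
      simp only [transpose_smul, transpose_transpose, transpose_zero, Matrix.smul_mul,
        Matrix.mul_smul, neg_zero, Matrix.mul_zero, Matrix.zero_mul, add_zero, zero_add,
        Units.inv_mul, h1, smul_zero])
    (isBlockDiag_ofBlocks_iff.2
      ⟨hd, fun _ _ _ => rfl, fun _ _ _ => rfl, fun i j h => by
        rw [Matrix.smul_apply, transpose_apply, units_inv_supported
          (fun i j => SameBlock g J (halves g (.inl i)) (halves g (.inl j)))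
          (fun _ => .refl _) SameBlock.trans SameBlock.symm A hd j i, smul_zero]
        intro h'
        rw [halves_inr, halves_inr] at h
        exact h (h'.symm.rev hJ)⟩)

end Halves

/-! ### Rational paths in the big cell -/

section Paths

variable {p g : ℕ} {J : Set ℤ} {K : Type} [Field K]

/-- The point `x` is joined to the identity by a family of points over the spectrum of a
domain. -/
def IsJoined (_hK : (p : K) = 0) (x : distAut p g J K) : Prop :=
  ∃ (D : Type) (_ : CommRing D) (_ : IsDomain D) (hD : (p : D) = 0) (i : K →+* D)
    (ev₀ ev₁ : D →+* K), ev₀.comp i = RingHom.id K ∧ ev₁.comp i = RingHom.id K ∧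
    ∃ γ : distAut p g J D, distMap hD ev₀ γ = 1 ∧ distMap hD ev₁ γ = x

open Polynomial in
/-- The points with invertible upper left block are joined to the identity. -/
lemma isJoined_of_isUnit (hJ : IsChainIndex g J) (hK : (p : K) = 0) (x : distAut p g J K)
    {A B C D : Matrix (Fin g) (Fin g) K} (hx : x.1.1.1 = ofBlocks A B C D) (hA : IsUnit A) :
    IsJoined hK x := by
  obtain ⟨hx1, hx2⟩ := (mem_distAut_iff hJ hK x.1).1 x.2
  rw [hx, adj_ofBlocks, ofBlocks_mul, ← ofBlocks_smul_one, ofBlocks_inj] at hx1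
  rw [hx, isBlockDiag_ofBlocks_iff] at hx2
  obtain ⟨e1, e2, e3, e4⟩ := hx1
  obtain ⟨dA, dB, dC, dD⟩ := hx2
  obtain ⟨A, rfl⟩ := hA
  set c := x.1.2 with hc
  have dA' := units_inv_supported
    (fun i j => SameBlock g J (halves g (.inl i)) (halves g (.inl j)))
    (fun _ => .refl _) SameBlock.trans SameBlock.symm A dA
  have tA : A.1ᵀ * (A⁻¹).1ᵀ = 1 := by rw [← transpose_mul, Units.inv_mul, transpose_one]
  have tA' : (A⁻¹).1ᵀ * A.1ᵀ = 1 := by rw [← transpose_mul, Units.mul_inv, transpose_one]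
  have f3 : Cᵀ * A.1 = A.1ᵀ * C := by
    have := e3; rw [Matrix.neg_mul, neg_add_eq_zero] at this; exact this
  have f4 : A.1ᵀ * D = (c : K) • 1 + Cᵀ * B := by
    rw [← e4, Matrix.neg_mul]; abel
  have f2 : Dᵀ * B = Bᵀ * D := by
    have := e2; rw [Matrix.neg_mul, add_neg_eq_zero] at this; exact this
  -- The factorization of x as lower(S₁) · Levi(A, c) · upper(S₂). The similitude equations make S₁
  -- and S₂ symmetric and determine D.
  set S₁ := C * (A⁻¹).1 with hS₁
  set S₂ := (A⁻¹).1 * B with hS₂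
  have s1 : S₁ᵀ = S₁ := by
    calc S₁ᵀ = (A⁻¹).1ᵀ * Cᵀ * (A.1 * (A⁻¹).1) := by
          rw [Units.mul_inv, Matrix.mul_one, hS₁, transpose_mul]
      _ = (A⁻¹).1ᵀ * (Cᵀ * A.1) * (A⁻¹).1 := by simp only [Matrix.mul_assoc]
      _ = ((A⁻¹).1ᵀ * A.1ᵀ) * (C * (A⁻¹).1) := by rw [f3]; simp only [Matrix.mul_assoc]
      _ = S₁ := by rw [tA', Matrix.one_mul]
  have hD : D = S₁ * B + (c : K) • (A⁻¹).1ᵀ := by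
    calc D = ((A⁻¹).1ᵀ * A.1ᵀ) * D := by rw [tA', Matrix.one_mul]
      _ = (A⁻¹).1ᵀ * Cᵀ * B + (c : K) • (A⁻¹).1ᵀ := by
          rw [Matrix.mul_assoc, f4, Matrix.mul_add, Matrix.mul_smul, Matrix.mul_one,
            ← Matrix.mul_assoc, add_comm]
      _ = _ := by rw [← transpose_mul, ← hS₁, s1]
  have s2 : S₂ᵀ = S₂ := by
    have h1 := f2
    rw [hD, transpose_add, transpose_mul, s1, transpose_smul, transpose_transpose, Matrix.add_mul,
      Matrix.mul_add, Matrix.smul_mul, Matrix.mul_smul, Matrix.mul_assoc, add_right_inj] at h1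
    have h2 := (smul_right_injective (Matrix (Fin g) (Fin g) K) c.ne_zero) h1
    rw [hS₂, transpose_mul, h2]
  have d1 : ∀ i j, ¬ SameBlock g J (halves g (.inr i)) (halves g (.inl j)) → S₁ i j = 0 := by
    intro i j h
    rw [hS₁, mul_apply]
    refine Finset.sum_eq_zero fun k _ => ?_
    by_cases hk : SameBlock g J (halves g (.inr i)) (halves g (.inl k))
    · rw [dA' k j fun h' => h (hk.trans h'), mul_zero]
    · rw [dC i k hk, zero_mul]
  have d2 : ∀ i j, ¬ SameBlock g J (halves g (.inl i)) (halves g (.inr j)) → S₂ i j = 0 := by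
    intro i j h
    rw [hS₂, mul_apply]
    refine Finset.sum_eq_zero fun k _ => ?_
    by_cases hk : SameBlock g J (halves g (.inl i)) (halves g (.inl k))
    · rw [dB k j fun h' => h (hk.trans h'), mul_zero]
    · rw [dA' i k hk, zero_mul]
  -- The path scales S₁ and S₂ by X and joins A and c to 1 by straight lines. It is defined where f
  -- = det(At) · ct is invertible; f takes the values 1 at 0 and det(A) · c at 1, so both end points
  -- survive in the domain K[X][1/f].
  let At : Matrix (Fin g) (Fin g) K[X] := (1 - X : K[X]) • 1 + (X : K[X]) • A.1.map Polynomial.C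
  let ct : K[X] := (1 - X) + X * Polynomial.C (c : K)
  have hAt : ∀ r : K, At.map (evalRingHom r) = (1 - r) • 1 + r • A.1 := fun r => by
    ext i j
    by_cases h : i = j
    · subst h; simp [At]; ring
    · simp [At, one_apply_ne h]; ring
  have hct : ∀ r : K, evalRingHom r ct = (1 - r) + r * c := fun r => by simp [ct]; ring
  set f : K[X] := At.det * ct with hf
  have hf0 : evalRingHom 0 f = 1 := by
    rw [hf, map_mul, RingHom.map_det, RingHom.mapMatrix_apply, hAt, hct]; simp
  have hf1 : evalRingHom 1 f = A.1.det * c := by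
    rw [hf, map_mul, RingHom.map_det, RingHom.mapMatrix_apply, hAt, hct]; simp
  have hfne : f ≠ 0 := fun h => by rw [h, map_zero] at hf0; exact zero_ne_one hf0
  let E := Localization.Away f
  have hEdom : IsDomain E :=
    IsLocalization.isDomain_localization (powers_le_nonZeroDivisors_of_noZeroDivisors hfne)
  let ι : K[X] →+* E := algebraMap K[X] E
  have hE : (p : E) = 0 := by
    rw [← map_natCast (ι.comp Polynomial.C), hK, map_zero]
  have hfu : IsUnit (ι At.det * ι ct) := by
    rw [← map_mul]; exact IsLocalization.Away.algebraMap_isUnit f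
  have hev : ∀ r : K, IsUnit (evalRingHom r f) → ∃ ev : E →+* K, ev.comp ι = evalRingHom r :=
    fun r hr => ⟨IsLocalization.Away.lift f hr, IsLocalization.Away.lift_comp f hr⟩
  obtain ⟨ev₀, hev₀⟩ := hev 0 (by rw [hf0]; exact isUnit_one)
  obtain ⟨ev₁, hev₁⟩ := hev 1 (by
    rw [hf1]; exact ((Matrix.isUnit_iff_isUnit_det _).1 A.isUnit).mul c.isUnit)
  have hAu : IsUnit (At.map ι) := by
    rw [Matrix.isUnit_iff_isUnit_det, ← RingHom.mapMatrix_apply, ← RingHom.map_det]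
    exact isUnit_of_mul_isUnit_left hfu
  have hcu : IsUnit (ι ct) := by
    exact isUnit_of_mul_isUnit_right hfu
  obtain ⟨A', hA'⟩ := hAu
  obtain ⟨c', hc'⟩ := hcu
  have dA'' : ∀ i j, ¬ SameBlock g J (halves g (.inl i)) (halves g (.inl j)) → A'.1 i j = 0 := by
    intro i j h
    have : i ≠ j := by rintro rfl; exact h (.refl _)
    rw [hA', map_apply]
    simp [At, dA i j h, one_apply_ne this]
  let j : K →+* E := ι.comp Polynomial.C
  have sj : ∀ S : Matrix (Fin g) (Fin g) K, Sᵀ = S → (ι X • S.map j)ᵀ = ι X • S.map j :=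
    fun S hS => by rw [transpose_smul, ← transpose_map, hS]
  let γ : distAut p g J E :=
    lowerElt hJ hE (ι X • S₁.map j) (sj _ s1)
      (fun i k h => by rw [Matrix.smul_apply, map_apply, d1 i k h, map_zero, smul_zero]) *
    leviElt hJ hE A' c' dA'' *
    upperElt hJ hE (ι X • S₂.map j) (sj _ s2)
      (fun i k h => by rw [Matrix.smul_apply, map_apply, d2 i k h, map_zero, smul_zero])
  have hγ : γ.1.1.1 = ofBlocks 1 0 (ι X • S₁.map j) 1 * ofBlocks A'.1 0 0 ((c' : E) • (A'⁻¹).1ᵀ) *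
    ofBlocks 1 (ι X • S₂.map j) 0 1 := rfl
  have hγc : (γ.1.2 : E) = c' := by
    change (1 : E) * c' * 1 = c'
    simp
  -- The factorization is evaluated at a general parameter r; the two end points of the path are the
  -- cases r = 0 and r = 1.
  have key : ∀ (r : K) (ev : E →+* K) (hev : ev.comp ι = evalRingHom r) (A₁ : (Matrix _ _ K)ˣ)
      (hA₁ : A₁.1 = (1 - r) • 1 + r • A.1) (c₁ : K) (hc₁ : c₁ = (1 - r) + r * c),
      (γ.1.1.1).map ev = ofBlocks 1 0 (r • S₁) 1 * ofBlocks A₁.1 0 0 (c₁ • (A₁⁻¹).1ᵀ) *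
        ofBlocks 1 (r • S₂) 0 1 ∧ ev γ.1.2 = c₁ := by
    intro r ev hev A₁ hA₁ c₁ hc₁
    have evι : ∀ q, ev (ι q) = eval r q := fun q => RingHom.congr_fun hev q
    have evc : ev c' = c₁ := by rw [hc', evι, hc₁]; exact hct r
    have evA : Units.map (RingHom.mapMatrix ev).toMonoidHom A' = A₁ := by
      refine Units.ext ?_
      change A'.1.map ev = _
      rw [hA', hA₁, ← hAt, ← hev]
      ext; simp
    have evA' : ((A'⁻¹).1).map ev = (A₁⁻¹).1 := by
      rw [← evA]; rfl
    have evS : ∀ S : Matrix (Fin g) (Fin g) K, (ι X • S.map j).map ev = r • S := fun S => by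
      ext a b
      simp only [map_apply, Matrix.smul_apply, smul_eq_mul, map_mul, j, RingHom.comp_apply, evι]
      simp
    refine ⟨?_, by rw [hγc, evc]⟩
    have evA1 : A'.1.map ev = A₁.1 := by rw [← evA]; rfl
    have evD : ((c' : E) • (A'⁻¹).1ᵀ).map ev = c₁ • (A₁⁻¹).1ᵀ := by
      ext a b
      have := congrFun (congrFun evA' b) a
      rw [map_apply] at this
      rw [map_apply, Matrix.smul_apply, transpose_apply, smul_eq_mul, map_mul, evc, this]
      rfl
    rw [hγ, Matrix.map_mul, Matrix.map_mul, ofBlocks_map, ofBlocks_map, ofBlocks_map, evS, evS, evD,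
      evA1, Matrix.map_one _ (map_zero _) (map_one _), Matrix.map_zero _ (map_zero _)]
  refine ⟨E, inferInstance, hEdom, hE, j, ev₀, ev₁, ?_, ?_, γ, ?_, ?_⟩
  · rw [← RingHom.comp_assoc, hev₀]; ext r; simp
  · rw [← RingHom.comp_assoc, hev₁]; ext r; simp
  · obtain ⟨k1, k2⟩ := key 0 ev₀ hev₀ 1 (by simp) 1 (by simp)
    refine distAut_ext (k1.trans ?_) k2
    simp [ofBlocks_one]
  · obtain ⟨k1, k2⟩ := key 1 ev₁ hev₁ A (by simp) c (by simp)
    refine distAut_ext (k1.trans ?_) k2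
    rw [hx, one_smul, one_smul, ofBlocks_mul, ofBlocks_mul, ofBlocks_inj]
    have h1 : A.1 * S₂ = B := by rw [hS₂, ← Matrix.mul_assoc, Units.mul_inv, Matrix.one_mul]
    have h2 : S₁ * A.1 = C := by rw [hS₁, Matrix.mul_assoc, Units.inv_mul, Matrix.mul_one]
    refine ⟨by simp, by simp [h1], by simp [h2], ?_⟩
    rw [hD]
    simp [Matrix.mul_assoc, h1]

end Paths

/-! ### Connectedness and reductivity of 𝒜 -/

section Connected

variable {p g : ℕ} {J : Set ℤ}

/-- A subgroup that contains all points joined to the identity is the whole group. -/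
lemma eq_top_of_isJoined {K : Type} [Field K] (hJ : IsChainIndex g J) (hK : (p : K) = 0)
    (H : Subgroup (distAut p g J K)) (hH : ∀ x, IsJoined hK x → x ∈ H) : H = ⊤ := by
  suffices h : ∀ (n : ℕ) (x : distAut p g J K) (A B C D : Matrix (Fin g) (Fin g) K),
      x.1.1.1 = ofBlocks A B C D → Module.finrank K (LinearMap.ker A.mulVecLin) = n → x ∈ H by
    refine eq_top_iff.2 fun x _ => ?_
    obtain ⟨A, B, C, D, hx⟩ := exists_ofBlocks x.1.1.1
    exact h _ x A B C D hx rfl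
  intro n
  -- The induction is on the dimension of the kernel of the upper left block A; when it is 0, the
  -- point lies in the big cell.
  induction n using Nat.strong_induction_on with
  | _ n ih =>
  intro x A B C D hx hn
  by_cases hker : LinearMap.ker A.mulVecLin = ⊥
  · refine hH x (isJoined_of_isUnit hJ hK x hx ?_)
    rw [← Matrix.mulVec_injective_iff_isUnit]
    exact LinearMap.ker_eq_bot.1 hker
  obtain ⟨v, hv, hv0⟩ := Submodule.exists_mem_ne_zero_of_ne_bot hker
  have hAv : A *ᵥ v = 0 := hv
  obtain ⟨hx1, hx2⟩ := (mem_distAut_iff hJ hK x.1).1 x.2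
  rw [hx, adj_ofBlocks, ofBlocks_mul, ← ofBlocks_smul_one, ofBlocks_inj] at hx1
  rw [hx, isBlockDiag_ofBlocks_iff] at hx2
  obtain ⟨e1, -, e3, -⟩ := hx1
  obtain ⟨-, -, dC, -⟩ := hx2
  have hCA : Cᵀ * A = Aᵀ * C := by rwa [Matrix.neg_mul, neg_add_eq_zero] at e3
  -- The similitude relation Dᵀ A - Bᵀ C = c, applied to a kernel vector v of A, shows that C cannot
  -- kill v as well.
  have hCv : C *ᵥ v ≠ 0 := by
    intro h
    have h1 := congrArg (· *ᵥ v) e1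
    simp only [add_mulVec, ← mulVec_mulVec, hAv, h, mulVec_zero, add_zero, smul_mulVec,
      one_mulVec] at h1
    exact hv0 ((smul_eq_zero.1 h1.symm).resolve_left x.1.2.ne_zero)
  obtain ⟨i, hi⟩ := Function.ne_iff.1 hCv
  rw [Pi.zero_apply] at hi
  obtain ⟨j, -, hj⟩ := Finset.exists_ne_zero_of_sum_ne_zero (s := Finset.univ)
    (f := fun j => C i j * v j) hi
  -- A nonzero entry of row i of C means that the block of i meets both halves and is self-dual.
  -- Hence the elementary upper element with block E_ii respects the blocks.
  have hij : SameBlock g J (halves g (.inl i)) (halves g (.inr i)) :=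
    sameBlock_inl_inr hJ (j := j) (by
      by_contra h
      exact hj (mul_eq_zero_of_left (dC i j h) _))
  let S : Matrix (Fin g) (Fin g) K := Matrix.single i i 1
  let u : distAut p g J K := upperElt hJ hK S (by simp [S]) (fun a b hab => by
    refine Matrix.single_apply_of_ne _ _ _ _ _ ?_
    rintro ⟨rfl, rfl⟩
    exact hab hij)
  have hu : u.1.1.1 = ofBlocks 1 S 0 1 := rfl
  have huH : u ∈ H := hH u (isJoined_of_isUnit hJ hK u hu isUnit_one)
  have hux : (u * x).1.1.1 = ofBlocks (A + S * C) (B + S * D) C D := by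
    change u.1.1.1 * x.1.1.1 = _
    rw [hu, hx, ofBlocks_mul]
    simp only [Matrix.one_mul, Matrix.zero_mul, zero_add]
  have hSC : ∀ w, (S * C) *ᵥ w = Pi.single i ((C *ᵥ w) i) := fun w => by
    rw [← mulVec_mulVec]
    ext k
    rw [Matrix.single_mulVec]
    simp [Function.update_apply, Pi.single_apply]
  have hlt : LinearMap.ker (A + S * C).mulVecLin < LinearMap.ker A.mulVecLin := by
    have key : ∀ w, (A + S * C) *ᵥ w = 0 → (C *ᵥ w) i = 0 := by
      intro w hw
      -- By symmetry of Cᵀ A this pairing equals (Av) · (Cw) = 0. Pairing (A + E_ii C)w = 0 with Cv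
      -- therefore leaves (Cv)_i (Cw)_i = 0, so w lies in ker A, while v is no longer in the new
      -- kernel.
      have h1 : (C *ᵥ v) ⬝ᵥ (A *ᵥ w) = 0 := by
        rw [← vecMul_transpose, ← dotProduct_mulVec, mulVec_mulVec, hCA, ← mulVec_mulVec,
          dotProduct_mulVec, vecMul_transpose, hAv, zero_dotProduct]
      rw [add_mulVec, hSC] at hw
      have h2 := congrArg ((C *ᵥ v) ⬝ᵥ ·) hw
      simp only [dotProduct_add, h1, dotProduct_single, dotProduct_zero, zero_add] at h2
      exact (mul_eq_zero.1 h2).resolve_left hi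
    refine SetLike.lt_iff_le_and_exists.2 ⟨fun w hw => ?_, v, hv, fun h => hi (key v h)⟩
    have hw' : (A + S * C) *ᵥ w = 0 := hw
    have h1 := key w hw'
    rw [add_mulVec, hSC, h1, Pi.single_zero, add_zero] at hw'
    exact hw'
  have := ih _ (hn ▸ Submodule.finrank_lt_finrank_of_lt hlt) (u * x) _ _ _ _ hux rfl
  exact (H.mul_mem_cancel_left huH).1 this

variable [Fact p.Prime]

/-- Idempotent functions on `𝒜` are invariant. -/
lemma distEval_of_isIdempotentElem {K : Type} [Field K] [Algebra (ZMod p) K]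
    (hJ : IsChainIndex g J) {e : DistRing p g J} (he : IsIdempotentElem e)
    (x : distAut p g J K) : distEval hJ x e = distEval hJ (1 : distAut p g J K) e := by
  have hK := natCast_eq_zero p K
  -- The points whose left translation leaves the value of e unchanged everywhere; this is a
  -- subgroup, so it suffices to treat points joined to 1.
  let H : Subgroup (distAut p g J K) :=
    { carrier := {x | ∀ y, distEval hJ (x * y) e = distEval hJ y e}
      one_mem' := fun y => by rw [one_mul]
      mul_mem' := fun {a b} ha hb y => by rw [mul_assoc, ha, hb]
      inv_mem' := fun {a} ha y => by rw [← ha, mul_inv_cancel_left] }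
  have hH : H = ⊤ := by
    refine eq_top_of_isJoined hJ hK H ?_
    rintro x ⟨D, _, _, hD, i, ev₀, ev₁, h₀, h₁, γ, hγ₀, hγ₁⟩ y
    let _ : Algebra (ZMod p) D := (i.comp (algebraMap (ZMod p) K)).toAlgebra
    have hy : ∀ (ev : D →+* K), ev.comp i = RingHom.id K →
        distMap hD ev (distMap hK i y) = y := fun ev hev =>
      distAut_ext (by ext a b; exact RingHom.congr_fun hev _) (RingHom.congr_fun hev _)
    -- An idempotent of a domain is 0 or 1, so it takes the same value at both ends of the
    -- translated path.
    have hd : distEval hJ (γ * distMap hK i y) e = 0 ∨ distEval hJ (γ * distMap hK i y) e = 1 :=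
      IsIdempotentElem.iff_eq_zero_or_one.1 (he.map (distEval hJ (γ * distMap hK i y)))
    have e₀ := map_distEval hJ ev₀ (γ * distMap hK i y) e
    have e₁ := map_distEval hJ ev₁ (γ * distMap hK i y) e
    rw [map_mul, hy ev₀ h₀, hγ₀, one_mul] at e₀
    rw [map_mul, hy ev₁ h₁, hγ₁] at e₁
    rw [e₀, e₁]
    rcases hd with h | h <;> simp [h]
  have : x ∈ H := hH ▸ Subgroup.mem_top x
  simpa using this 1

/-- An idempotent function that vanishes at the identity vanishes at the universal point over every
residue field by invariance, so it is nilpotent and therefore 0. Every clopen set comes from an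
idempotent e, and either e or 1 - e vanishes at the identity. -/
lemma distRing_connectedSpace (hJ : IsChainIndex g J) :
    ConnectedSpace (PrimeSpectrum (DistRing p g J)) := by
  have hnt : Nontrivial (DistRing p g J) :=
    (distEval hJ (1 : distAut p g J (ZMod p))).toRingHom.domain_nontrivial
  have hidem : ∀ e : DistRing p g J, IsIdempotentElem e →
      distEval hJ (1 : distAut p g J (ZMod p)) e = 0 → e = 0 := by
    intro e he h0
    have hnil : IsNilpotent e := by
      rw [nilpotent_iff_mem_prime]
      intro q hq
      let ι := algebraMap (DistRing p g J) q.ResidueField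
      let _ : Algebra (ZMod p) q.ResidueField :=
        (ι.comp (algebraMap (ZMod p) (DistRing p g J))).toAlgebra
      have h1 := distEval_of_isIdempotentElem hJ he (distMap distRing_charP ι (univPoint p hJ))
      rw [distEval_distMap] at h1
      have h2 := map_distEval hJ (algebraMap (ZMod p) q.ResidueField)
        (1 : distAut p g J (ZMod p)) e
      rw [map_one, h0, map_zero] at h2
      rw [h2, ← RingHom.mem_ker, Ideal.ker_algebraMap_residueField] at h1
      exact h1
    obtain ⟨n, hn⟩ := hnil
    have := he.pow_succ_eq n
    rw [pow_succ, hn, zero_mul] at this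
    exact this.symm
  have hne : Nonempty (PrimeSpectrum (DistRing p g J)) := inferInstance
  have hpre : PreconnectedSpace (PrimeSpectrum (DistRing p g J)) := by
    rw [preconnectedSpace_iff_clopen]
    intro s hs
    obtain ⟨e, he⟩ := (PrimeSpectrum.isIdempotentElemEquivClopens
      (R := DistRing p g J)).surjective ⟨s, hs⟩
    have hse : s = PrimeSpectrum.basicOpen e.1 := by
      rw [← PrimeSpectrum.coe_isIdempotentElemEquivClopens_apply, he]; rfl
    rcases IsIdempotentElem.iff_eq_zero_or_one.1
      (e.2.map (distEval hJ (1 : distAut p g J (ZMod p)))) with h | h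
    · left
      rw [hse, hidem _ e.2 h]
      simp
    · right
      have h1 := hidem (1 - e.1) e.2.one_sub (by rw [map_sub, map_one, h, sub_self])
      rw [hse, ← sub_eq_zero.1 h1]
      simp
  exact { toPreconnectedSpace := hpre, toNonempty := hne }

lemma isSmoothConnected_distinguished (hp : p ≠ 2) (hJ : IsChainIndex g J) :
    IsSmoothConnected (distinguished p g J) :=
  ⟨_, ⟨distCorepresentableBy hJ⟩, distRing_smooth hp hJ, distRing_connectedSpace hJ⟩

lemma isReductive_distinguished (hp : p ≠ 2) (hJ : IsChainIndex g J) :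
    IsReductive (distinguished p g J) := by
  refine ⟨isSmoothConnected_distinguished hp hJ, fun U hU R => eq_bot_iff.2 fun x hx => ?_⟩
  exact map_eq_one_of_isUnipotentNormal (k := AlgebraicClosure (ZMod p)) hp hJ
    (fun R => MonoidHom.id (distAut p g J R)) (fun _ _ => rfl)
    (fun _ => Function.surjective_id) hU R x hx

end Connected

/-! ### The Cayley transform in a ring -/

section Cayley

variable {A : Type*} [Ring A]

/-- The Cayley transform. -/
def cay (x : A) : A := (1 - x) * Ring.inverse (1 + x)

lemma cay_mul {x : A} (hx : IsUnit (1 + x)) : cay x * (1 + x) = 1 - x := by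
  rw [cay, mul_assoc, Ring.inverse_mul_cancel _ hx, mul_one]

lemma eq_cay {x y : A} (hx : IsUnit (1 + x)) (h : y * (1 + x) = 1 - x) : y = cay x :=
  hx.mul_right_cancel (h.trans (cay_mul hx).symm)

/-- Everything follows from (1 + cay x)(1 + x) = 2: it makes 1 + cay x a unit when 2 is one, so the
transform can be applied again and inverts itself. -/
lemma cay_cay {x : A} (hx : IsUnit (1 + x)) (h2 : IsUnit (2 : A)) : cay (cay x) = x := by
  have h1 : (1 + cay x) * (1 + x) = 2 := by
    rw [add_mul, cay_mul hx, one_mul, ← one_add_one_eq_two]; abel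
  have h3 : IsUnit (1 + cay x) := by
    obtain ⟨u, hu⟩ := hx
    rw [← hu] at h1
    rw [← Units.mul_inv_cancel_right (1 + cay x) u, h1]
    exact h2.mul u⁻¹.isUnit
  refine (eq_cay h3 (hx.mul_right_cancel ?_)).symm
  rw [mul_assoc, h1, sub_mul, cay_mul hx, one_mul, ← one_add_one_eq_two, mul_add, mul_one]
  abel

lemma map_cay {B : Type*} [Ring B] (φ : A →+* B) {x : A} (hx : IsUnit (1 + x)) :
    φ (cay x) = cay (φ x) := by
  refine eq_cay (by simpa using hx.map φ) ?_
  rw [← map_one φ, ← map_add, ← map_mul, cay_mul hx, map_sub]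

end Cayley

/-! ### Triangularity of chains after rotating the basis -/

section Rotation

variable {g : ℕ} {J : Set ℤ}

/-- The rotation of the basis that makes the member `l` of a chain triangular. -/
def rot (g : ℕ) (l : ℤ) : Fin (2 * g) ≃ Fin (2 * g) :=
  Equiv.ofBijective
    (fun k => ⟨((l + (k : ℕ)) % (2 * (g : ℤ))).toNat, by
      have := Int.emod_lt_of_pos (l + (k : ℕ)) (show (0 : ℤ) < 2 * g by have := k.2; omega)
      have := k.2
      omega⟩)
    (Finite.injective_iff_bijective.1 fun a b h => by
      have h0 : (0 : ℤ) < 2 * g := by have := a.2; omega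
      have h1 := Int.emod_nonneg (l + (a : ℕ)) h0.ne'
      have h2 := Int.emod_nonneg (l + (b : ℕ)) h0.ne'
      have h3 := congrArg (fun k : Fin (2 * g) => (k : ℕ)) h
      have h4 : (l + (a : ℕ)) % (2 * (g : ℤ)) = (l + (b : ℕ)) % (2 * (g : ℤ)) := by
        dsimp only at h3
        omega
      have h5 : ((a : ℕ) : ℤ) % (2 * g) = ((b : ℕ) : ℤ) % (2 * g) := Int.ModEq.add_left_cancel' l h4
      rw [Int.emod_eq_of_lt (by omega) (by omega), Int.emod_eq_of_lt (by omega) (by omega)] at h5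
      exact Fin.ext (by omega))

lemma rot_val (l : ℤ) (k : Fin (2 * g)) :
    ((rot g l k : ℕ) : ℤ) = l + (k : ℕ) - 2 * g * chainExp g l k := by
  have h0 : (0 : ℤ) < 2 * g := by have := k.2; omega
  change ((((l + (k : ℕ)) % (2 * (g : ℤ))).toNat : ℕ) : ℤ) = _
  rw [Int.toNat_of_nonneg (Int.emod_nonneg _ h0.ne'), Int.emod_def, chainExp]

/-- The rotated position of k is l + k - 2g e_l(k). If the level is 0, then a < b and the exponents
agree; if it is 1, the exponent of a is larger by one, which moves a back by 2g, more than any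
difference of indices. -/
lemma rot_lt_rot {l : ℤ} {a b : Fin (2 * g)} (hab : ¬ SameBlock g J a b)
    (h : chainExp g l a - chainExp g l b = level g J a b) : rot g l a < rot g l b := by
  have ha := rot_val l a
  have hb := rot_val l b
  rw [Fin.lt_def]
  rw [level] at h
  have hne : a ≠ b := by rintro rfl; exact hab (.refl _)
  have hne' : (a : ℕ) ≠ b := fun h => hne (Fin.ext h)
  split_ifs at h with h1
  · have h2 : (a : ℕ) ≤ b := h1.resolve_left hab
    rw [show chainExp g l a = chainExp g l b by omega] at ha
    omega
  · rw [show chainExp g l a = chainExp g l b + 1 by omega, mul_add, mul_one] at ha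
    omega

variable {p : ℕ} {R : Type} [CommRing R]

lemma IsChain.apply_eq_zero_of_rot_lt (hJ : IsChainIndex g J) (hR : (p : R) = 0)
    {f : J → Matrix (Fin (2 * g)) (Fin (2 * g)) R} (hf : IsChain p f) {v : R}
    (hv : blockFam hJ f = v • (1 : Matrix _ _ R)) (l : J) {a b : Fin (2 * g)}
    (h : rot g l b < rot g l a) : f l a b = 0 := by
  by_cases hab : SameBlock g J a b
  · rw [← hf.blockFam_apply hJ hR l hab, hv, Matrix.smul_apply, one_apply_ne, smul_zero]
    rintro rfl
    exact lt_irrefl _ h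
  · exact hf.apply_eq_zero hJ hR l a b fun h' => lt_asymm h (rot_lt_rot hab h')

lemma IsChain.apply_self (hJ : IsChainIndex g J) (hR : (p : R) = 0)
    {f : J → Matrix (Fin (2 * g)) (Fin (2 * g)) R} (hf : IsChain p f) {v : R}
    (hv : blockFam hJ f = v • (1 : Matrix _ _ R)) (l : J) (a : Fin (2 * g)) : f l a a = v := by
  rw [← hf.blockFam_apply hJ hR l (.refl a), hv, Matrix.smul_apply, one_apply_eq, smul_eq_mul,
    mul_one]

/-- A chain of endomorphisms is invertible if it is scalar on the blocks. -/
lemma IsChain.isUnit (hJ : IsChainIndex g J) (hR : (p : R) = 0)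
    {f : J → Matrix (Fin (2 * g)) (Fin (2 * g)) R} (hf : IsChain p f) {v : R} (hu : IsUnit v)
    (hv : blockFam hJ f = v • (1 : Matrix _ _ R)) : IsUnit f := by
  refine Pi.isUnit_iff.2 fun l => ?_
  have h : ((f l).submatrix (rot g l).symm (rot g l).symm).IsUpperTriangular := fun a b h =>
    hf.apply_eq_zero_of_rot_lt hJ hR hv l (by simpa using h)
  have h' : ∀ a, (f l).submatrix (rot g l).symm (rot g l).symm a a = v := fun a =>
    hf.apply_self hJ hR hv l _
  rw [Matrix.isUnit_iff_isUnit_det, ← det_submatrix_equiv_self (rot g l).symm,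
    det_of_isUpperTriangular h]
  simp only [h']
  simpa using hu.pow _

end Rotation

/-! ### Skew adjoint chains and the effect of the Cayley transform -/

section Parameters

variable {p g : ℕ} {J : Set ℤ} {R : Type} [CommRing R]

lemma isUnit_adjFam (hJ : IsChainIndex g J) {f : J → Matrix (Fin (2 * g)) (Fin (2 * g)) R}
    (hf : IsUnit f) : IsUnit (adjFam hJ f) := by
  obtain ⟨u, rfl⟩ := hf
  refine ⟨⟨adjFam hJ u.1, adjFam hJ (u⁻¹).1, ?_, ?_⟩, rfl⟩
  · rw [← adjFam_mul, Units.inv_mul, adjFam_one]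
  · rw [← adjFam_mul, Units.mul_inv, adjFam_one]

/-- With f* = f⁻¹, the adjoint of (1 - f)/(1 + f) is (1 - f⁻¹)/(1 + f⁻¹) = -(1 - f)/(1 + f). The
proof clears the denominators 1 + f and its adjoint. -/
lemma adjFam_cay_eq_neg (hJ : IsChainIndex g J) {f : J → Matrix (Fin (2 * g)) (Fin (2 * g)) R}
    (hf : IsUnit (1 + f)) (h : adjFam hJ f * f = 1) : adjFam hJ (cay f) = - cay f := by
  have h1 := cay_mul hf
  have h2 := congrArg (adjFam hJ) h1
  rw [adjFam_mul, adjFam_add, adjFam_sub, adjFam_one] at h2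
  have h3 := isUnit_adjFam hJ hf
  rw [adjFam_add, adjFam_one] at h3
  refine h3.mul_left_cancel (hf.mul_right_cancel ?_)
  rw [h2, mul_neg, neg_mul, mul_assoc, h1]
  simp only [mul_add, add_mul, mul_sub, sub_mul, mul_one, one_mul, h]
  abel

/-- With f* = -f, the adjoint of (1 - f)/(1 + f) is (1 + f)/(1 - f), its inverse. -/
lemma adjFam_cay_mul_cay (hJ : IsChainIndex g J) {f : J → Matrix (Fin (2 * g)) (Fin (2 * g)) R}
    (hf : IsUnit (1 + f)) (h : adjFam hJ f = - f) : adjFam hJ (cay f) * cay f = 1 := by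
  have h1 := cay_mul hf
  have h2 := congrArg (adjFam hJ) h1
  rw [adjFam_mul, adjFam_add, adjFam_sub, adjFam_one, h] at h2
  have h3 := isUnit_adjFam hJ hf
  rw [adjFam_add, adjFam_one, h] at h3
  refine h3.mul_left_cancel (hf.mul_right_cancel ?_)
  rw [← mul_assoc, h2, mul_assoc, h1]
  noncomm_ring

lemma IsChain.cay {f : J → Matrix (Fin (2 * g)) (Fin (2 * g)) R} (hf : IsChain p f)
    (hu : IsUnit (1 + f)) : IsChain p (cay f) :=
  (IsChain.one.sub hf).mul ((IsChain.one.add hf).of_mul_eq_one (Ring.mul_inverse_cancel _ hu))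

lemma blockFam_add (hJ : IsChainIndex g J) (f f' : J → Matrix (Fin (2 * g)) (Fin (2 * g)) R) :
    blockFam hJ (f + f') = blockFam hJ f + blockFam hJ f' := by
  rw [eq_comm, ← eq_sub_iff_add_eq, ← blockFam_sub, add_sub_cancel_right]

variable (J) in
/-- The independent entries of a chain of skew adjoint endomorphisms without block part. -/
def Param : Type :=
  {t : Fin (2 * g) × Fin (2 * g) // ¬ SameBlock g J t.1 t.2 ∧ t.1 ≤ t.2.rev}

open Classical in
/-- The skew adjoint matrix with given independent entries. -/
def skewOf (hJ : IsChainIndex g J) (r : Param (g := g) J → R) :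
    Matrix (Fin (2 * g)) (Fin (2 * g)) R :=
  of fun a b => if hab : SameBlock g J a b then 0 else
    if h : a ≤ b.rev then r ⟨(a, b), hab, h⟩ else
      - (sgn R a * sgn R b * r ⟨(b.rev, a.rev), fun h' => hab ((sameBlock_rev_iff hJ).1 h').symm, by
        simpa using (not_le.1 h).le⟩)

lemma skewOf_of_sameBlock (hJ : IsChainIndex g J) (r : Param (g := g) J → R) {a b : Fin (2 * g)}
    (h : SameBlock g J a b) : skewOf hJ r a b = 0 := dif_pos h

lemma skewOf_apply (hJ : IsChainIndex g J) (r : Param (g := g) J → R)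
    (t : Param (g := g) J) : skewOf hJ r t.1.1 t.1.2 = r t :=
  (dif_neg t.2.1).trans (dif_pos t.2.2)

lemma skewOf_apply' (hJ : IsChainIndex g J) (r : Param (g := g) J → R) {a b : Fin (2 * g)}
    (hab : ¬ SameBlock g J a b) (h : b.rev < a) :
    skewOf hJ r a b = - (sgn R a * sgn R b * skewOf hJ r b.rev a.rev) := by
  have h1 : ¬ SameBlock g J b.rev a.rev := fun h' => hab ((sameBlock_rev_iff hJ).1 h').symm
  have h2 : b.rev ≤ a.rev.rev := by simpa using h.le
  rw [skewOf_apply hJ r ⟨(b.rev, a.rev), h1, h2⟩]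
  exact (dif_neg hab).trans (dif_neg (not_le.2 h))

lemma adj_skewOf (hJ : IsChainIndex g J) (r : Param (g := g) J → R) :
    adj (skewOf hJ r) = - skewOf hJ r := by
  ext a b
  rw [adj_apply, neg_apply]
  by_cases hab : SameBlock g J a b
  · rw [skewOf_of_sameBlock hJ r hab, skewOf_of_sameBlock hJ r (hab.rev hJ).symm, mul_zero,
      neg_zero]
  have hab' : ¬ SameBlock g J b.rev a.rev := fun h' => hab ((sameBlock_rev_iff hJ).1 h').symm
  rcases lt_trichotomy b.rev a with h | h | h
  · rw [skewOf_apply' hJ r hab h, neg_neg]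
  -- At a position (a, b) with b dual to a the involution fixes the entry and the two signs multiply
  -- to -1, so skewness is automatic there and the entry is a free parameter.
  · subst h
    rw [Fin.rev_rev, sgn_rev, neg_mul, sgn_mul_self, neg_one_mul]
  · rw [skewOf_apply' hJ r hab' (by simpa using h), Fin.rev_rev, Fin.rev_rev, sgn_rev, sgn_rev]
    linear_combination (- skewOf hJ r a b) * (sgn R b * sgn R b * sgn_mul_self (R := R) a +
      sgn_mul_self (R := R) b)

lemma eq_skewOf (hJ : IsChainIndex g J) {m : Matrix (Fin (2 * g)) (Fin (2 * g)) R}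
    (hm : adj m = -m) (h0 : ∀ a b, SameBlock g J a b → m a b = 0) :
    m = skewOf hJ fun t => m t.1.1 t.1.2 := by
  ext a b
  by_cases hab : SameBlock g J a b
  · rw [h0 a b hab, skewOf_of_sameBlock hJ _ hab]
  rcases le_or_gt a b.rev with h | h
  · exact (skewOf_apply hJ (fun t => m t.1.1 t.1.2) ⟨(a, b), hab, h⟩).symm
  · have hab' : ¬ SameBlock g J b.rev a.rev := fun h' => hab ((sameBlock_rev_iff hJ).1 h').symm
    have h2 : b.rev ≤ a.rev.rev := by simpa using h.le
    rw [skewOf_apply' hJ _ hab h, skewOf_apply hJ _ ⟨(b.rev, a.rev), hab', h2⟩,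
      ← neg_eq_iff_eq_neg]
    exact (congrFun (congrFun hm a) b).symm

lemma map_skewOf {S : Type} [CommRing S] (φ : R →+* S) (hJ : IsChainIndex g J)
    (r : Param (g := g) J → R) : (skewOf hJ r).map φ = skewOf hJ (φ ∘ r) := by
  have h := eq_skewOf hJ (m := (skewOf hJ r).map φ)
    (by rw [adj_map, adj_skewOf]; ext a b; simp)
    (fun a b hab => by rw [map_apply, skewOf_of_sameBlock hJ r hab, map_zero])
  rw [h]
  congr 1
  funext t
  rw [map_apply, skewOf_apply]
  rfl

lemma blockFam_chainOf_skewOf (hJ : IsChainIndex g J) (r : Param (g := g) J → R) :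
    blockFam hJ (chainOf (skewOf hJ r)) = 0 := by
  refine (isBlockDiag_blockFam hJ _).ext (fun _ _ _ => rfl) fun a b h => ?_
  rw [blockFam, blockPart_of_sameBlock _ h, chainOf_apply, skewOf_of_sameBlock hJ r h, ite_self]
  rfl

lemma isUnit_one_add (hJ : IsChainIndex g J) (hR : (p : R) = 0)
    {f : J → Matrix (Fin (2 * g)) (Fin (2 * g)) R} (hf : IsChain p f) (h : blockFam hJ f = 0) :
    IsUnit (1 + f) :=
  (IsChain.one.add hf).isUnit hJ hR isUnit_one
    (by rw [blockFam_add, blockFam_one, h, add_zero, one_smul])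

lemma isUnit_one_add' (hJ : IsChainIndex g J) (hR : (p : R) = 0) (h2 : IsUnit (2 : R))
    {f : J → Matrix (Fin (2 * g)) (Fin (2 * g)) R} (hf : IsChain p f) (h : blockFam hJ f = 1) :
    IsUnit (1 + f) :=
  (IsChain.one.add hf).isUnit hJ hR h2
    (by rw [blockFam_add, blockFam_one, h, two_smul])

lemma blockFam_cay_eq_one (hJ : IsChainIndex g J) (hR : (p : R) = 0)
    {f : J → Matrix (Fin (2 * g)) (Fin (2 * g)) R} (hf : IsChain p f) (h : blockFam hJ f = 0) :
    blockFam hJ (cay f) = 1 := by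
  have hu := isUnit_one_add hJ hR hf h
  have h1 := congrArg (blockFam hJ) (cay_mul hu)
  rwa [(hf.cay hu).blockFam_mul hJ hR (IsChain.one.add hf), blockFam_add, blockFam_sub,
    blockFam_one, h, add_zero, sub_zero, mul_one] at h1

/-- Since the block part is multiplicative on chains, applying it to cay f · (1 + f) = 1 - f gives
twice the block part of cay f equal to 0. -/
lemma blockFam_cay_eq_zero (hJ : IsChainIndex g J) (hR : (p : R) = 0) (h2 : IsUnit (2 : R))
    {f : J → Matrix (Fin (2 * g)) (Fin (2 * g)) R} (hf : IsChain p f) (h : blockFam hJ f = 1) :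
    blockFam hJ (cay f) = 0 := by
  have hu := isUnit_one_add' hJ hR h2 hf h
  have h1 := congrArg (blockFam hJ) (cay_mul hu)
  rw [(hf.cay hu).blockFam_mul hJ hR (IsChain.one.add hf), blockFam_add, blockFam_sub,
    blockFam_one, h, sub_self, mul_add, mul_one, ← two_smul R] at h1
  exact (h2.smul_eq_zero).1 h1

lemma isUnit_two_fam (h2 : IsUnit (2 : R)) :
    IsUnit (2 : J → Matrix (Fin (2 * g)) (Fin (2 * g)) R) := by
  have := h2.map (algebraMap R (J → Matrix (Fin (2 * g)) (Fin (2 * g)) R))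
  rwa [map_ofNat] at this

/-- Change of coefficients for families of matrices. -/
def famMap (J : Set ℤ) (g : ℕ) {S : Type} [CommRing S] (φ : R →+* S) :
    (J → Matrix (Fin (2 * g)) (Fin (2 * g)) R) →+* (J → Matrix (Fin (2 * g)) (Fin (2 * g)) S) :=
  RingHom.pi fun l => φ.mapMatrix.comp (Pi.evalRingHom _ l)

end Parameters

/-! ### The kernel of π as an affine space -/

section Radical

variable {p g : ℕ} {J : Set ℤ} {R : Type} [CommRing R]

/-- The family of matrices of a point of the parahoric group. -/
def famHom (p g : ℕ) (J : Set ℤ) (R : Type) [CommRing R] :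
    chainAut p g J R →* (J → Matrix (Fin (2 * g)) (Fin (2 * g)) R) where
  toFun x l := (x.1.1 l).1
  map_one' := rfl
  map_mul' _ _ := rfl

lemma isChain_famHom (hJ : IsChainIndex g J) (x : chainAut p g J R) : IsChain p (famHom p g J R x) :=
  ((mem_chainAut_iff hJ x.1).1 x.2).1

lemma adjFam_mul_famHom (hJ : IsChainIndex g J) {x : chainAut p g J R} (hx : (x.1.2 : R) = 1) :
    adjFam hJ (famHom p g J R x) * famHom p g J R x = 1 := by
  funext l
  have := ((mem_chainAut_iff hJ x.1).1 x.2).2 l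
  rwa [hx, one_smul] at this

lemma piHom_eq_one_iff (hJ : IsChainIndex g J) (hR : (p : R) = 0) (x : chainAut p g J R) :
    piHom p hJ hR x = 1 ↔ blockFam hJ (famHom p g J R x) = 1 ∧ (x.1.2 : R) = 1 := by
  constructor
  · intro h
    exact ⟨congrArg (fun y : distAut p g J R => y.1.1.1) h,
      congrArg (fun y : distAut p g J R => (y.1.2 : R)) h⟩
  · rintro ⟨h1, h2⟩
    exact distAut_ext h1 h2

/-- The elements of the kernel of `π` with given independent entries of the Cayley transform. -/
def cayPoint (hJ : IsChainIndex g J) (hR : (p : R) = 0) (r : Param (g := g) J → R) :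
    chainAut p g J R :=
  have hX := isChain_chainOf hJ hR (skewOf hJ r)
  have hu := isUnit_one_add hJ hR hX (blockFam_chainOf_skewOf hJ r)
  mkChainAut hJ (f := cay (chainOf (skewOf hJ r))) (c := 1) (hX.cay hu) fun l => by
    have := congrFun (adjFam_cay_mul_cay hJ hu (by
      rw [adjFam_chainOf, adj_skewOf]
      funext l
      ext a b
      rw [Pi.neg_apply, neg_apply, chainOf_apply, chainOf_apply, neg_apply]
      split_ifs <;> simp)) l
    rw [Units.val_one, one_smul]
    exact this

lemma famHom_cayPoint (hJ : IsChainIndex g J) (hR : (p : R) = 0) (r : Param (g := g) J → R) :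
    famHom p g J R (cayPoint hJ hR r) = cay (chainOf (skewOf hJ r)) := rfl

lemma piHom_cayPoint (hJ : IsChainIndex g J) (hR : (p : R) = 0) (r : Param (g := g) J → R) :
    piHom p hJ hR (cayPoint hJ hR r) = 1 :=
  (piHom_eq_one_iff hJ hR _).2 ⟨blockFam_cay_eq_one hJ hR (isChain_chainOf hJ hR (skewOf hJ r))
    (blockFam_chainOf_skewOf hJ r), rfl⟩

lemma cayPoint_injective (hJ : IsChainIndex g J) (hR : (p : R) = 0) (h2 : IsUnit (2 : R)) :
    Function.Injective (cayPoint (R := R) hJ hR) := by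
  intro r r' h
  have h1 : cay (famHom p g J R (cayPoint hJ hR r)) = cay (famHom p g J R (cayPoint hJ hR r')) :=
    by rw [h]
  have hu : ∀ r : Param (g := g) J → R, IsUnit (1 + chainOf (J := J) (skewOf hJ r)) := fun r =>
    isUnit_one_add hJ hR (isChain_chainOf hJ hR _) (blockFam_chainOf_skewOf hJ r)
  rw [famHom_cayPoint, famHom_cayPoint, cay_cay (hu r) (isUnit_two_fam h2),
    cay_cay (hu r') (isUnit_two_fam h2)] at h1
  have h3 := congrArg (coeff hJ) h1
  rw [coeff_chainOf, coeff_chainOf] at h3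
  funext t
  rw [← skewOf_apply hJ r t, h3, skewOf_apply]

lemma exists_cayPoint (hJ : IsChainIndex g J) (hR : (p : R) = 0) (h2 : IsUnit (2 : R))
    (x : chainAut p g J R) (hx : piHom p hJ hR x = 1) : ∃ r, cayPoint hJ hR r = x := by
  obtain ⟨h3, h4⟩ := (piHom_eq_one_iff hJ hR x).1 hx
  set f := famHom p g J R x with hf
  have hc : IsChain p f := isChain_famHom hJ x
  have hu := isUnit_one_add' hJ hR h2 hc h3
  have hX := hc.cay hu
  have hX0 := blockFam_cay_eq_zero hJ hR h2 hc h3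
  have hXadj := adjFam_cay_eq_neg hJ hu (adjFam_mul_famHom hJ h4)
  -- The Cayley transform of f is a skew adjoint chain, so its coefficient matrix is skew adjoint
  -- and is recovered from the independent entries.
  have e1 : adj (coeff hJ (cay f)) = - coeff hJ (cay f) := by
    rw [← coeff_chainOf hJ (adj (coeff hJ (cay f))), ← adjFam_chainOf hJ, hX.chainOf_coeff hJ hR,
      hXadj]
    rfl
  have e2 := eq_skewOf hJ e1 fun a b hab => by
    change cay f _ a b = 0
    rw [← hX.blockFam_apply hJ hR _ hab, hX0]
    rfl
  refine ⟨fun t => coeff hJ (cay f) t.1.1 t.1.2, chainAut_ext (fun l => ?_) h4.symm⟩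
  change famHom p g J R (cayPoint hJ hR _) l = f l
  rw [famHom_cayPoint, ← e2, hX.chainOf_coeff hJ hR, cay_cay hu (isUnit_two_fam h2)]

lemma pairMap_cayPoint {S : Type} [CommRing S] (hJ : IsChainIndex g J) (hR : (p : R) = 0)
    (hS : (p : S) = 0) (φ : R →+* S) (r : Param (g := g) J → R) :
    pairMap g J φ (cayPoint hJ hR r).1 = (cayPoint hJ hS (φ ∘ r)).1 := by
  have hu := isUnit_one_add hJ hR (isChain_chainOf hJ hR (skewOf hJ r))
    (blockFam_chainOf_skewOf hJ r)
  refine Prod.ext (funext fun l => Units.ext ?_) (Units.ext (map_one φ))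
  change famMap J g φ (cay (chainOf (skewOf hJ r))) l = cay (chainOf (skewOf hJ (φ ∘ r))) l
  rw [map_cay _ hu]
  refine congrFun (congrArg cay (funext fun l' => ?_)) l
  exact (map_chainOf φ _ l').trans (by rw [map_skewOf φ hJ r])

variable [Fact p.Prime]

instance : Finite (Param (g := g) J) := Subtype.finite

/-- The kernel of `π` is an affine space. -/
def kernelCorepresentableBy (hp : p ≠ 2) (hJ : IsChainIndex g J) :
    ((kernel (piMap p hJ)).toFunctor ⋙ forget GrpCat).CorepresentableBy
      (CommAlgCat.of (ZMod p) (MvPolynomial (Param (g := g) J) (ZMod p))) where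
  homEquiv {R} := Equiv.ofBijective
    (fun φ => (⟨cayPoint hJ (natCast_eq_zero p R) (fun t => φ.hom (MvPolynomial.X t)),
      piHom_cayPoint hJ _ _⟩ : (kernel (piMap p hJ)).pts R)) (by
      have h2 := isUnit_two_of_char hp (natCast_eq_zero p R)
      constructor
      · intro φ ψ h
        have h1 := cayPoint_injective hJ (natCast_eq_zero p R) h2 (congrArg Subtype.val h)
        refine CommAlgCat.hom_ext (MvPolynomial.algHom_ext fun t => congrFun h1 t)
      · rintro ⟨x, hx⟩
        obtain ⟨r, hr⟩ := exists_cayPoint hJ (natCast_eq_zero p R) h2 x hx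
        exact ⟨CommAlgCat.ofHom (MvPolynomial.aeval r), Subtype.ext ((congrArg (cayPoint hJ _)
          (funext fun t => MvPolynomial.aeval_X r t)).trans hr)⟩)
  homEquiv_comp {R S} φ ψ :=
    Subtype.ext (Subtype.ext (pairMap_cayPoint hJ (natCast_eq_zero p R) (natCast_eq_zero p S)
      φ.hom.toRingHom _).symm)

/-- The coordinate ring is a polynomial ring over a field, which is smooth and a domain. -/
lemma isSmoothConnected_kernel (hp : p ≠ 2) (hJ : IsChainIndex g J) :
    IsSmoothConnected (kernel (piMap p hJ)).toFunctor :=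
  ⟨_, ⟨kernelCorepresentableBy hp hJ⟩, ⟨inferInstance, inferInstance⟩, inferInstance⟩

lemma exists_ideal_of_equations {A : Type} [CommRing A] {ι : Type*} (u v : ι → A) :
    ∃ I : Ideal A, ∀ (S : Type) [CommRing S] (φ : A →+* S),
      (∀ i, φ (u i) = φ (v i)) ↔ ∀ a ∈ I, φ a = 0 := by
  refine ⟨Ideal.span (Set.range fun i => u i - v i), fun S _ φ => ⟨fun h a ha => ?_, fun h i => ?_⟩⟩
  · refine (Ideal.span_le (I := RingHom.ker φ)).2 ?_ ha
    rintro _ ⟨i, rfl⟩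
    exact (map_sub φ _ _).trans (sub_eq_zero.2 (h i))
  · exact sub_eq_zero.1 ((map_sub φ _ _).symm.trans (h _ (Ideal.subset_span ⟨i, rfl⟩)))

lemma isClosed_kernel (hJ : IsChainIndex g J) : (kernel (piMap p hJ)).IsClosed := by
  intro A y
  let f := famHom p g J A y
  obtain ⟨I, hI⟩ := exists_ideal_of_equations (A := A)
    (Sum.elim (fun ab : Fin (2 * g) × Fin (2 * g) => blockFam hJ f ab.1 ab.2)
      (fun _ : Unit => ((show chainAut p g J A from y).1.2 : A)))
    (Sum.elim (fun ab => (1 : Matrix (Fin (2 * g)) (Fin (2 * g)) A) ab.1 ab.2) (fun _ => 1))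
  refine ⟨I, fun R φ => Iff.trans ?_ (hI R φ.hom.toRingHom)⟩
  refine (piHom_eq_one_iff hJ (natCast_eq_zero p R) _).trans ?_
  have e : blockFam hJ (famHom p g J R (((specialFiber p g J).map φ).hom y)) =
      (blockFam hJ f).map φ.hom.toRingHom := blockFam_map φ.hom.toRingHom hJ f
  rw [e, ← Matrix.map_one φ.hom.toRingHom (map_zero _) (map_one _)]
  constructor
  · rintro ⟨h1, h2⟩ (⟨a, b⟩ | _)
    · exact congrFun (congrFun h1 a) b
    · exact h2.trans (map_one φ.hom.toRingHom).symm
  · intro h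
    refine ⟨?_, (h (Sum.inr ())).trans (map_one φ.hom.toRingHom)⟩
    ext a b
    exact h (Sum.inl (a, b))

end Radical

/-! ### A closed embedding of the kernel of π into unitriangular matrices -/

section Unipotent

variable {p g : ℕ} {J : Set ℤ} {R : Type} [CommRing R]

open Classical in
/-- Representatives of the index set modulo periodicity. -/
def repr (hJ : IsChainIndex g J) (l : Fin (2 * g)) : J :=
  -- A residue that does not occur in J is sent to 0; this only repeats a block in the large matrix.
  if h : ((l : ℕ) : ℤ) ∈ J then ⟨_, h⟩ else hJ.zero

/-- Exponent differences are unchanged under shifts by 2g, so the finitely many representatives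
already attain every level. This allows a chain to be recovered from finitely many members. -/
lemma exists_repr_level (hJ : IsChainIndex g J) (a b : Fin (2 * g)) :
    ∃ l, chainExp g (repr hJ l : J) a - chainExp g (repr hJ l : J) b = level g J a b := by
  have h0 : (0 : ℤ) < 2 * g := by have := a.2; omega
  obtain ⟨l, hl, h⟩ := exists_level hJ a b
  have h1 := Int.emod_nonneg l h0.ne'
  have h2 := Int.emod_lt_of_pos l h0
  have h3 : ((l % (2 * g)).toNat : ℤ) = l + (-(l / (2 * g))) * (2 * g) := by
    rw [Int.toNat_of_nonneg h1, Int.emod_def]; ring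
  refine ⟨⟨(l % (2 * g)).toNat, by omega⟩, ?_⟩
  rw [repr, dif_pos (by rw [h3]; exact hJ.add_mul_mem hl _)]
  dsimp only
  rw [h3, chainExp_add_mul hJ.pos, chainExp_add_mul hJ.pos, ← h]
  ring

/-- The positions in a block diagonal matrix with one block for each representative. -/
def position (hJ : IsChainIndex g J) (l a : Fin (2 * g)) : Fin (2 * g * (2 * g)) :=
  finProdFinEquiv (l, rot g (repr hJ l : J) a)

lemma position_surjective (hJ : IsChainIndex g J) (k : Fin (2 * g * (2 * g))) :
    ∃ l a, k = position hJ l a := by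
  obtain ⟨⟨l, a⟩, rfl⟩ := finProdFinEquiv.surjective k
  exact ⟨l, (rot g _).symm a, by rw [position, Equiv.apply_symm_apply]⟩

lemma rot_lt_of_position_lt (hJ : IsChainIndex g J) {l a b : Fin (2 * g)}
    (h : position hJ l a < position hJ l b) :
    rot g (repr hJ l : J) a < rot g (repr hJ l : J) b := by
  rw [Fin.lt_def, position, position, finProdFinEquiv_apply_val, finProdFinEquiv_apply_val] at h
  rw [Fin.lt_def]
  simpa using h

/-- The block diagonal matrix with the members of a family as blocks, each with its basis
rotated. -/
def blockHom (hJ : IsChainIndex g J) (R : Type) [CommRing R] :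
    (J → Matrix (Fin (2 * g)) (Fin (2 * g)) R) →+*
      Matrix (Fin (2 * g * (2 * g))) (Fin (2 * g * (2 * g))) R :=
  (Matrix.reindexRingEquiv R ((Equiv.prodComm _ _).trans finProdFinEquiv)).toRingHom.comp
    ((Matrix.blockDiagonalRingHom (Fin (2 * g)) (Fin (2 * g)) R).comp
      (RingHom.pi fun l => (Matrix.reindexRingEquiv R (rot g (repr hJ l : J))).toRingHom.comp
        (Pi.evalRingHom _ (repr hJ l))))

lemma blockHom_apply (hJ : IsChainIndex g J) (f : J → Matrix (Fin (2 * g)) (Fin (2 * g)) R)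
    (l a l' b : Fin (2 * g)) :
    blockHom hJ R f (position hJ l a) (position hJ l' b) =
      if l = l' then f (repr hJ l) a b else 0 := by
  have h : blockHom hJ R f (position hJ l a) (position hJ l' b) = if l = l' then
      f (repr hJ l) a ((rot g (repr hJ l : J)).symm (rot g (repr hJ l' : J) b)) else 0 := by
    simp [blockHom, position, blockDiagonal_apply]
  rw [h]
  split_ifs with hl
  · rw [hl, Equiv.symm_apply_apply]
  · rfl

lemma map_blockHom {S : Type} [CommRing S] (φ : R →+* S) (hJ : IsChainIndex g J)
    (f : J → Matrix (Fin (2 * g)) (Fin (2 * g)) R) :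
    (blockHom hJ R f).map φ = blockHom hJ S fun l => (f l).map φ := by
  ext i j
  obtain ⟨l, a, rfl⟩ := position_surjective hJ i
  obtain ⟨l', b, rfl⟩ := position_surjective hJ j
  rw [map_apply, blockHom_apply, blockHom_apply, apply_ite φ, map_zero, map_apply]

/-- The entries of a chain of endomorphisms, read off from its block diagonal matrix. -/
def readOff (hJ : IsChainIndex g J)
    (M : Matrix (Fin (2 * g * (2 * g))) (Fin (2 * g * (2 * g))) R) :
    Matrix (Fin (2 * g)) (Fin (2 * g)) R :=
  of fun a b => M (position hJ (exists_repr_level hJ a b).choose a)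
    (position hJ (exists_repr_level hJ a b).choose b)

lemma IsChain.readOff_blockHom (hJ : IsChainIndex g J) (hR : (p : R) = 0)
    {f : J → Matrix (Fin (2 * g)) (Fin (2 * g)) R} (hf : IsChain p f) :
    readOff hJ (blockHom hJ R f) = coeff hJ f := by
  ext a b
  change blockHom hJ R f (position hJ _ a) (position hJ _ b) = _
  rw [blockHom_apply, if_pos rfl]
  exact hf.apply_eq_coeff hJ hR _ a b (exists_repr_level hJ a b).choose_spec

lemma famHom_injective (hJ : IsChainIndex g J) (hR : (p : R) = 0) {x y : chainAut p g J R}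
    (hxy : (x.1.2 : R) = y.1.2)
    (h : blockHom hJ R (famHom p g J R x) = blockHom hJ R (famHom p g J R y)) : x = y := by
  have h1 := congrArg (readOff hJ) h
  rw [(isChain_famHom hJ x).readOff_blockHom hJ hR, (isChain_famHom hJ y).readOff_blockHom hJ hR]
    at h1
  have h2 := congrArg (chainOf (J := J)) h1
  rw [(isChain_famHom hJ x).chainOf_coeff hJ hR, (isChain_famHom hJ y).chainOf_coeff hJ hR] at h2
  exact chainAut_ext (fun l => congrFun h2 l) hxy

variable [Fact p.Prime]

/-- The representation of the kernel of `π` by block diagonal matrices. -/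
def kernelRep (p : ℕ) [Fact p.Prime] (hJ : IsChainIndex g J) :
    (kernel (piMap p hJ)).toFunctor ⟶ generalLinear (ZMod p) (2 * g * (2 * g)) where
  app R := GrpCat.ofHom (MonoidHom.toHomUnits
    ((blockHom hJ R : _ →* _).comp ((famHom p g J R).comp
      ((kernel (piMap p hJ)).pts R).subtype)))
  naturality {R S} φ := by
    ext x : 2
    exact Units.ext (map_blockHom φ.hom.toRingHom hJ (famHom p g J R x.1)).symm

/-- A matrix in the image determines its chain through `readOff`. The image is thus cut out by
polynomial equations: the matrix is rebuilt from the chain read off from it, the block part of that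
chain is 1, and it is symplectic with multiplier 1. -/
lemma mem_range_kernelRep_iff (hJ : IsChainIndex g J) (R : CommAlgCat.{0} (ZMod p))
    (y : GL (Fin (2 * g * (2 * g))) R) :
    y ∈ ((kernelRep p hJ).app R).hom.range ↔
      blockHom hJ R (chainOf (readOff hJ y.1)) = y.1 ∧
      blockFam hJ (chainOf (readOff hJ y.1)) = 1 ∧
      adjFam hJ (chainOf (readOff hJ y.1)) * chainOf (readOff hJ y.1) = 1 := by
  have hR := natCast_eq_zero p R
  constructor
  · rintro ⟨x, hx⟩
    have hy : blockHom hJ R (famHom p g J R x.1) = y.1 := congrArg Units.val hx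
    have h : ∀ z : chainAut p g J R, piHom p hJ hR z = 1 →
        chainOf (readOff hJ (blockHom hJ R (famHom p g J R z))) = famHom p g J R z ∧
          blockFam hJ (famHom p g J R z) = 1 ∧
          adjFam hJ (famHom p g J R z) * famHom p g J R z = 1 := fun z hz => by
      obtain ⟨h1, h2⟩ := (piHom_eq_one_iff hJ hR z).1 hz
      rw [(isChain_famHom hJ z).readOff_blockHom hJ hR, (isChain_famHom hJ z).chainOf_coeff hJ hR]
      exact ⟨rfl, h1, adjFam_mul_famHom hJ h2⟩
    obtain ⟨h1, h2⟩ := h x.1 x.2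
    rw [← hy, h1]
    exact ⟨rfl, h2⟩
  · rintro ⟨h1, h2, h3⟩
    let x : chainAut p g J R := mkChainAut hJ (isChain_chainOf hJ hR (readOff hJ y.1)) (c := 1)
      fun l => by rw [Units.val_one, one_smul]; exact congrFun h3 l
    exact ⟨⟨x, (piHom_eq_one_iff hJ hR x).2 ⟨h2, rfl⟩⟩, Units.ext h1⟩

lemma kernelRep_isClosedImmersion (hJ : IsChainIndex g J) : IsClosedImmersion (kernelRep p hJ) := by
  constructor
  · intro R x y hxy
    have hx := ((piHom_eq_one_iff hJ (natCast_eq_zero p R) _).1 x.2).2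
    have hy := ((piHom_eq_one_iff hJ (natCast_eq_zero p R) _).1 y.2).2
    exact Subtype.ext (famHom_injective hJ (natCast_eq_zero p R) (hx.trans hy.symm)
      (congrArg Units.val hxy))
  · intro A y
    let M : Matrix (Fin (2 * g * (2 * g))) (Fin (2 * g * (2 * g))) A := (show GL _ A from y).1
    let f : J → Matrix (Fin (2 * g)) (Fin (2 * g)) A := chainOf (readOff hJ M)
    obtain ⟨I, hI⟩ := exists_ideal_of_equations (A := A)
      (Sum.elim (fun ij : Fin (2 * g * (2 * g)) × Fin (2 * g * (2 * g)) =>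
          blockHom hJ A f ij.1 ij.2)
        (Sum.elim (fun ab : Fin (2 * g) × Fin (2 * g) => blockFam hJ f ab.1 ab.2)
          (fun lab : J × Fin (2 * g) × Fin (2 * g) =>
            (adjFam hJ f * f) lab.1 lab.2.1 lab.2.2)))
      (Sum.elim (fun ij => M ij.1 ij.2)
        (Sum.elim (fun ab => (1 : Matrix (Fin (2 * g)) (Fin (2 * g)) A) ab.1 ab.2)
          (fun lab => (1 : Matrix (Fin (2 * g)) (Fin (2 * g)) A) lab.2.1 lab.2.2)))
    refine ⟨I, fun R φ => Iff.trans ?_ (hI R φ.hom.toRingHom)⟩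
    refine (mem_range_kernelRep_iff hJ R _).trans ?_
    have eM : (show GL (Fin (2 * g * (2 * g))) R from
        ((generalLinear (ZMod p) (2 * g * (2 * g))).map φ).hom y).1 =
        M.map φ.hom.toRingHom := rfl
    have ef : chainOf (readOff hJ (M.map φ.hom.toRingHom)) = famMap J g φ.hom.toRingHom f :=
      funext fun l => (map_chainOf φ.hom.toRingHom _ l).symm
    have e1 : blockHom hJ R (famMap J g φ.hom.toRingHom f) =
        (blockHom hJ A f).map φ.hom.toRingHom := (map_blockHom φ.hom.toRingHom hJ f).symm
    have e2 : blockFam hJ (famMap J g φ.hom.toRingHom f) =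
        (blockFam hJ f).map φ.hom.toRingHom := blockFam_map φ.hom.toRingHom hJ f
    have e3 : adjFam hJ (famMap J g φ.hom.toRingHom f) * famMap J g φ.hom.toRingHom f =
        famMap J g φ.hom.toRingHom (adjFam hJ f * f) := by
      rw [map_mul]
      congr 1
      funext l
      exact adj_map φ.hom.toRingHom _
    rw [eM, ef, e1, e2, e3, ← Matrix.map_one φ.hom.toRingHom (map_zero _) (map_one _),
      ← map_one (famMap J g φ.hom.toRingHom)]
    constructor
    · rintro ⟨h1, h2, h3⟩ (⟨i, j⟩ | ⟨a, b⟩ | ⟨l, a, b⟩)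
      · exact congrFun (congrFun h1 i) j
      · exact congrFun (congrFun h2 a) b
      · exact congrFun (congrFun (congrFun h3 l) a) b
    · intro h
      refine ⟨?_, ?_, funext fun l => ?_⟩
      · ext i j
        exact h (Sum.inl (i, j))
      · ext a b
        exact h (Sum.inr (Sum.inl (a, b)))
      · ext a b
        exact h (Sum.inr (Sum.inr (l, a, b)))

/-- Each diagonal block is a member of the chain in its rotated basis; block part 1 puts ones on its
diagonal, and the entries below the diagonal vanish. -/
lemma isUnipotent_kernel (hJ : IsChainIndex g J) :
    IsUnipotent (kernel (piMap p hJ)).toFunctor := by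
  refine ⟨_, kernelRep p hJ, kernelRep_isClosedImmersion hJ, fun R x => ?_⟩
  have hR := natCast_eq_zero p R
  have hx := ((piHom_eq_one_iff hJ hR _).1 x.2).1
  have hf := isChain_famHom hJ (show chainAut p g J R from x.1)
  rw [← one_smul R (1 : Matrix _ _ R)] at hx
  change (∀ i j, j < i → blockHom hJ R (famHom p g J R x.1) i j = 0) ∧
    ∀ i, blockHom hJ R (famHom p g J R x.1) i i = 1
  constructor
  · intro i j hij
    obtain ⟨l, a, rfl⟩ := position_surjective hJ i
    obtain ⟨l', b, rfl⟩ := position_surjective hJ j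
    rw [blockHom_apply]
    split_ifs with h
    · subst h
      exact hf.apply_eq_zero_of_rot_lt hJ hR hx _ (rot_lt_of_position_lt hJ hij)
    · rfl
  · intro i
    obtain ⟨l, a, rfl⟩ := position_surjective hJ i
    rw [blockHom_apply, if_pos rfl]
    exact hf.apply_self hJ hR hx _ a

end Unipotent

/-! ### The unipotent radical -/

section Main

variable {p g : ℕ} {J : Set ℤ} [Fact p.Prime]

lemma isUnipotentNormal_kernel (hp : p ≠ 2) (hJ : IsChainIndex g J) :
    IsUnipotentNormal (kernel (piMap p hJ)) where
  closed := isClosed_kernel hJ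
  normal _ := MonoidHom.normal_ker _
  smoothConnected := isSmoothConnected_kernel hp hJ
  unipotent := isUnipotent_kernel hJ

/-- The section s makes π surjective on points over every algebra, so π kills every smooth connected
unipotent closed normal subgroup of the special fibre. -/
lemma isUnipotentRadical_kernel (hp : p ≠ 2) (hJ : IsChainIndex g J) :
    IsUnipotentRadical (kernel (piMap p hJ)) := by
  refine ⟨isUnipotentNormal_kernel hp hJ, fun U hU R x hx => ?_⟩
  exact map_eq_one_of_isUnipotentNormal (k := ZMod p) hp hJ
    (fun R => piHom p hJ (natCast_eq_zero p R))
    (fun {R S} φ x => blockFam_map φ.hom.toRingHom hJ (famHom p g J R x))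
    (fun R y => ⟨sHom p hJ (natCast_eq_zero p R) y, piHom_sHom hJ _ y⟩) hU R x hx

end Main

end SiegelParahoric

end

theorem mainTheorem8 (p : ℕ) [Fact p.Prime] (hp : p ≠ 2) (g : ℕ) (hg : 1 ≤ g) (J : Set ℤ)
    (hneg : ∀ j ∈ J, -j ∈ J) (hper : ∀ j : ℤ, j ∈ J ↔ j + 2 * g ∈ J) (h0 : (0 : ℤ) ∈ J) :
    SiegelParahoric.IsReductive (SiegelParahoric.distinguished p g J) ∧
    ∃ (π : SiegelParahoric.specialFiber p g J ⟶ SiegelParahoric.distinguished p g J)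
      (s : SiegelParahoric.distinguished p g J ⟶ SiegelParahoric.specialFiber p g J),
      -- the action of `π f` on the kernel of the transition map between neighbours is given by `f`
      (∀ (R : CommAlgCat.{0} (ZMod p)) (f : (SiegelParahoric.specialFiber p g J).obj R) (i j : J),
        (i : ℤ) < j → (∀ l ∈ J, l ≤ (i : ℤ) ∨ (j : ℤ) ≤ l) →
        ∀ v ∈ SiegelParahoric.transitionKer p g R j i,
          (SiegelParahoric.matrixOf ((π.app R).hom f)).mulVec v =
            (SiegelParahoric.component f j).mulVec v) ∧
      -- `s h` is the automorphism all of whose components are equal to `h`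
      (∀ (R : CommAlgCat.{0} (ZMod p)) (h : (SiegelParahoric.distinguished p g J).obj R),
        (∀ j : J, SiegelParahoric.component ((s.app R).hom h) j = SiegelParahoric.matrixOf h) ∧
        SiegelParahoric.multiplier ((s.app R).hom h) = SiegelParahoric.multiplierOf h) ∧
      -- the kernel of `π` is the unipotent radical
      SiegelParahoric.IsUnipotentRadical (SiegelParahoric.kernel π) ∧
      -- `π` is a split surjection and the group is the semidirect product
      CategoryTheory.CategoryStruct.comp s π =
        CategoryTheory.CategoryStruct.id (SiegelParahoric.distinguished p g J) ∧
      ∀ R : CommAlgCat.{0} (ZMod p),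
        Subgroup.IsComplement' (s.app R).hom.range ((SiegelParahoric.kernel π).pts R) := by
  have hJ : SiegelParahoric.IsChainIndex g J := ⟨hg, hneg, hper, h0⟩
  exact ⟨SiegelParahoric.isReductive_distinguished hp hJ, SiegelParahoric.piMap p hJ,
    SiegelParahoric.sMap p hJ, SiegelParahoric.piMap_mulVec hJ, fun _ _ => ⟨fun _ => rfl, rfl⟩,
    SiegelParahoric.isUnipotentRadical_kernel hp hJ, SiegelParahoric.sMap_piMap hJ, fun R =>
      SiegelParahoric.isComplement'_range_ker _ _
        (SiegelParahoric.piHom_sHom hJ (SiegelParahoric.natCast_eq_zero p R))⟩
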